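/- **Setting.** Let $N\ge 3$ be an integer, $t_0\in\mathbb C$, and let $F$ be a commutative $\mathbb C$-algebra of functions of one variable $t_N$, with derivation $'=d/dt_N$, containing $t_N$ (for example formal Laurent series, or functions analytic in an annulus). Let $K=1+\sum_{j\ge1}K_j\partial^{-j}$, $\partial=\partial_x$, be the generic formal dressing operator (the $K_j$ and all their $x$-derivatives are independent), with $K_j$ depending on $x$, $y=t_2$, $t_N$ through $$\partial_yK=-(K\partial^2K^{-1})_-K,\qquad \partial_{t_N}K=-(K\partial^NK^{-1})_-K ,$$ where $(\cdot)_-$ is the part with negative powers of $\partial$; put $w=-2K_1$. All other times $t_k$ are zero. This system in $x,y,t_N$ is the $KP_N$ equation. Put $\zeta=\lambda x+\lambda^2y+\lambda^Nt_N+t_0\ln\lambda$, $\varphi=Ke^{\zeta}$, $\varphi^*=(K^{-1})^*e^{-\zeta}$ (with $(\sum a_n\partial^n)^*=\sum(-\partial)^na_n$), $E=\lambda^N$, $\hat x=x+t_0\partial^{-1}+2y\partial+Nt_N\partial^{N-1}$. For $\alpha\in\mathbb Z$, $\alpha\le N$, and $h\in F$ let $V^N(\alpha,h)$ be the evolutionary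 vector field $$V^N(\alpha,h)K=-(KAK^{-1})_-K,\qquad A=h\bigl(\tfrac1N\hat x\,\partial^{1-N}\bigr)\partial^\alpha ,$$ where $h(\cdot)$ is the Taylor expansion at $t_N$, a series in $\partial^{-1}$ (so that negative powers of $\hat x$ are expanded in $\partial^{-1}$ with leading term $(Nt_N)^{-1}\partial^{1-N}$). An evolutionary vector field $V$ is a *Lie point symmetry* of $KP_N$ if it commutes with $\partial_x,\partial_y,\partial_{t_N}$ and $Vw=v_1w_x+v_2w_y+v_Nw_{t_N}-p$ with functions $v_i,p$ of $(x,y,t_N,w)$ (polynomial in $x,y,w$ with coefficients in $F$); to it corresponds the vector field $v_1\partial_x+v_2\partial_y+v_N\partial_{t_N}+p\,\partial_w$ on the space of $(x,y,t_N,w)$. It is nonvanishing if $Vw\neq0$. **Theorem.** For all $\alpha\le N$ and $h\in F$ one has $V^N(\alpha,h)w=2\operatorname{res}_\lambda\lambda^\alpha[h(\partial_E)\varphi]\varphi^*$. The flow $V^N(\alpha,h)$ is a nonvanishing Lie point symmetry of $KP_N$ if and only if either $\alpha\in\{N,2,1,-1\}$ and $h\ne0$, or $\alpha=0$, $N=3$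 and $h'\neq0$. Moreover: (a) The vector fields $T(f)$ corresponding to $V^N(N,f)$, $f\in F$, form a centerless Virasoro algebra of reparametrizations of $t_N$: $T$ is linear and injective, $T(f)$ acts on functions $g$ of $t_N$ by $g\mapsto fg'$, and $[T(f),T(g)]=T(fg'-f'g)$; if $t_N$ is invertible in $F$, then $L_n=T(-t_N^{n+1})$, $n\in\mathbb Z$, satisfy $[L_m,L_n]=(m-n)L_{m+n}$. These fields are all of the Lie algebra generated by the symmetries with $\alpha=N$. (b) The vector fields corresponding to $V^N(\alpha,h)$ with $\alpha=2,1,-1$ (and also $\alpha=0$ when $N=3$) generate a nilpotent current (Kac–Moody) algebra with loop parameter $t_N$: this Lie algebra is nilpotent and, for some $n$, has an injective Lie algebra homomorphism $\iota$ into the algebra of strictly upper triangular $n\times n$ matrices with entries in $F$ (a subalgebra of the centerless loop algebra $\mathfrak{sl}_n\otimes F$) which sends the field of $V^N(\alpha,h)$ to a finite sum $\sum_k h^{(k)}M_{\alpha,k}$ with constant complex matrices $M_{\alpha,k}$. (c) The vector fields corresponding to the Lie point symmetries among all finite linear combinations of the flows $V^N(\alpha,h)$, $\alpha\le N$, form a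 Lie algebra. It is the semidirect sum of the algebras in (a) and (b): it is their direct sum as a vector space, and the algebra in (b) is an ideal of it. -/

import Mathlib

namespace KPSym

noncomputable section

/-! ### Differential polynomials

`F` is a commutative `ℂ`-algebra of functions of the time `t_N`, with derivation `δ = d/dt_N`.
The fields `K₁, K₂, …` are generic: together with all their `x`-derivatives they are independent
variables, so an identity below is an identity valid for all formal dressing operators. -/

/-- The coordinates: `x`, `y` and the jets `K j i = ∂ₓ^i K_{j+1}` (so `K 0 0` is `K₁`). -/
inductive Coord
  | x : Coord
  | y : Coord
  | K (j i : ℕ) : Coord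

/-- Differential polynomials in `K₁, K₂, …` whose coefficients are polynomials in `x`, `y`
over the functions of `t_N`. -/
abbrev DiffPoly (F : Type*) [CommRing F] := MvPolynomial Coord F

/-- The derivation of a polynomial ring that acts on coefficients by `δ` and kills the variables:
the explicit `∂/∂t_N`. -/
def coeffDer {F σ : Type*} [CommRing F] [Algebra ℂ F] (δ : Derivation ℂ F F) :
    Derivation ℂ (MvPolynomial σ F) (MvPolynomial σ F) :=
  have hc : ∀ (p : MvPolynomial σ F) (m : σ →₀ ℕ), MvPolynomial.coeff m
      (AddMonoidAlgebra.map δ.toLinearMap.toAddMonoidHom p) = δ (MvPolynomial.coeff m p) :=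
    fun _ _ => rfl
  Derivation.mk'
    { toFun := fun p => AddMonoidAlgebra.map δ.toLinearMap.toAddMonoidHom p
      map_add' := fun p q => by
        ext m
        simp only [hc, MvPolynomial.coeff_add, map_add]
      map_smul' := fun c p => by
        ext m
        simp only [hc, MvPolynomial.coeff_smul, δ.map_smul, RingHom.id_apply] }
    (fun p q => by
      classical
      ext m
      change MvPolynomial.coeff m (AddMonoidAlgebra.map δ.toLinearMap.toAddMonoidHom (p * q)) =
        MvPolynomial.coeff m (p * AddMonoidAlgebra.map δ.toLinearMap.toAddMonoidHom q +
          q * AddMonoidAlgebra.map δ.toLinearMap.toAddMonoidHom p)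
      rw [mul_comm q]
      simp only [hc, MvPolynomial.coeff_add, MvPolynomial.coeff_mul, map_sum, Derivation.leibniz,
        Finset.sum_add_distrib, smul_eq_mul]
      congr 1
      exact Finset.sum_congr rfl fun _ _ => mul_comm _ _)

section Fields

variable {F : Type*} [CommRing F]

/-- The total derivative `∂ = ∂ₓ`. -/
def Dx : Derivation F (DiffPoly F) (DiffPoly F) :=
  MvPolynomial.mkDerivation F fun v => match v with
    | .x => 1
    | .y => 0
    | .K j i => MvPolynomial.X (.K j (i + 1))

/-- The unknown function `w = -2 K₁`. -/
def w : DiffPoly F := -2 * MvPolynomial.X (.K 0 0)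

/-! ### Pseudodifferential operators

An element of `LaurentSeries R` is read in two ways, with the coefficient of index `n` attached
to `∂^(-n)`, respectively to `λ^(-n)`. The built-in commutative product is the one of series in
`λ⁻¹`; the product of pseudodifferential operators is `pmul`. In both readings the residue is the
coefficient of index `1`. -/

/-- Formal series in `∂⁻¹` (or `λ⁻¹`) with coefficients in `DiffPoly F`. -/
abbrev Ser (F : Type*) [CommRing F] := LaurentSeries (DiffPoly F)

/-- The series `∑_{n ≥ 0} c n ∂^(-n)`. -/
def ofCoeffs (c : ℕ → DiffPoly F) : Ser F :=
  HahnSeries.ofPowerSeries ℤ (DiffPoly F) (PowerSeries.mk c)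

/-- The operator `a ∂^n`. -/
def op (a : DiffPoly F) (n : ℤ) : Ser F := HahnSeries.single (-n) a

/-- Coefficients of the product of pseudodifferential operators, from the rule
`∂^m b = ∑_k (m choose k) b^{(k)} ∂^(m-k)`; only finitely many terms are nonzero. -/
def pmulCoeff (a b : Ser F) (n : ℤ) : DiffPoly F :=
  ∑ᶠ p : ℤ × ℕ,
    Ring.choose (-p.1) p.2 • (a.coeff p.1 * (Dx : DiffPoly F → DiffPoly F)^[p.2]
      (b.coeff (n - p.1 - p.2)))

theorem pmulCoeff_bdd (a b : Ser F) : BddBelow (Function.support (pmulCoeff a b)) := by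
  refine ⟨a.order + b.order, fun n hn => ?_⟩
  by_contra hlt
  apply hn
  unfold pmulCoeff
  rw [finsum_eq_zero_of_forall_eq_zero]
  rintro ⟨i, k⟩
  by_cases hi : i < a.order
  · simp [HahnSeries.coeff_eq_zero_of_lt_order hi]
  · have hb : b.coeff (n - i - k) = 0 := by
      apply HahnSeries.coeff_eq_zero_of_lt_order
      omega
    have h0 : ∀ m : ℕ, (Dx : DiffPoly F → DiffPoly F)^[m] 0 = 0 := fun m =>
      Function.iterate_fixed (map_zero _) m
    simp [hb, h0]

/-- The product of pseudodifferential operators. -/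
def pmul (a b : Ser F) : Ser F := HahnSeries.ofSuppBddBelow (pmulCoeff a b) (pmulCoeff_bdd a b)

/-- Powers for the product of pseudodifferential operators. -/
def ppow (a : Ser F) : ℕ → Ser F
  | 0 => op 1 0
  | k + 1 => pmul (ppow a k) a

/-- `∑_k c k • g k`, for series `g k` in which only the indices `≥ k` occur. -/
def adicSum (c : ℕ → DiffPoly F) (g : ℕ → Ser F) : Ser F :=
  ofCoeffs fun n => ∑ k ∈ Finset.range (n + 1), c k * (g k).coeff n

/-- The inverse `∑_k (1 - a)^k` of an operator `a = 1 + a₁ ∂⁻¹ + a₂ ∂⁻² + …`. -/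
def pinv (a : Ser F) : Ser F := adicSum (fun _ => 1) (ppow (op 1 0 - a))

/-- The integral part `(·)₋` of an operator. For the operator `∑_n a_n ∂^n` it is
`∑_{n < 0} a_n ∂^n`. -/
def minusPart (a : Ser F) : Ser F := ofCoeffs fun n => if n = 0 then 0 else a.coeff n

/-- The conjugate operator, `(∑_n a_n ∂^n)^* = ∑_n (-∂)^n a_n`, of an operator
`a = a₀ + a₁ ∂⁻¹ + a₂ ∂⁻² + …`. -/
def conj (a : Ser F) : Ser F :=
  ofCoeffs fun n => ∑ m ∈ Finset.range (n + 1),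
    (-1) ^ m * (pmul (op 1 (-m)) (op (a.coeff m) 0)).coeff n

/-! ### Dressing operator and flows -/

/-- The generic formal Zakharov-Shabat dressing operator `K = 1 + K₁ ∂⁻¹ + K₂ ∂⁻² + …`. -/
def dressing : Ser F :=
  ofCoeffs fun n => match n with
    | 0 => 1
    | j + 1 => MvPolynomial.X (.K j 0)

/-- The dressed operator `K A K⁻¹`. -/
def dress (A : Ser F) : Ser F := pmul (pmul dressing A) (pinv dressing)

/-- The vector field `V_A` on the space of dressing operators, `V_A K = -(K A K⁻¹)₋ K`, as the
derivation of the ring of differential polynomials which commutes with `∂ₓ`, does not act on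
functions of `x, y, t_N` and is given by this formula on the fields `K_j`. -/
def flow (A : Ser F) : Derivation F (DiffPoly F) (DiffPoly F) :=
  MvPolynomial.mkDerivation F fun v => match v with
    | .x => 0
    | .y => 0
    | .K j i => (Dx : DiffPoly F → DiffPoly F)^[i]
        ((-(pmul (minusPart (dress A)) dressing)).coeff (j + 1))

/-- The total derivative `∂_y`, `y = t₂`: fields evolve by the second flow of the hierarchy,
`∂K/∂t₂ = -(K ∂² K⁻¹)₋ K`. -/
def Dy : Derivation F (DiffPoly F) (DiffPoly F) :=
  MvPolynomial.mkDerivation F (fun v => match v with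
    | .x => 0
    | .y => 1
    | .K _ _ => 0) + flow (op 1 2)

variable [Algebra ℂ F]

/-- The total derivative `∂_{t_N}`: fields evolve by the `N`-th flow of the hierarchy,
`∂K/∂t_N = -(K ∂^N K⁻¹)₋ K`. -/
def Dt (δ : Derivation ℂ F F) (N : ℕ) : Derivation ℂ (DiffPoly F) (DiffPoly F) :=
  coeffDer δ + (flow (op 1 N)).restrictScalars ℂ

/-! ### The flows `V^N(α, h)` -/

/-- A complex constant as a differential polynomial. -/
def const (c : ℂ) : DiffPoly F := MvPolynomial.C (algebraMap ℂ F c)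

/-- `x̂ = x + t₀ ∂⁻¹ + 2 y ∂ + N t_N ∂^(N-1)`, all other times being zero. -/
def xhat (t : F) (t₀ : ℂ) (N : ℕ) : Ser F :=
  op (MvPolynomial.X .x) 0 + op (const t₀) (-1) + op (2 * MvPolynomial.X .y) 1 +
    op (MvPolynomial.C (N * t)) (N - 1)

/-- `(1/N) x̂ ∂^(1-N)`, the operator that represents `∂_E`, `E = λ^N`, on `e^ζ`. -/
def opE (t : F) (t₀ : ℂ) (N : ℕ) : Ser F :=
  (N : ℂ)⁻¹ • pmul (xhat t t₀ N) (op 1 (1 - N))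

/-- The coefficients `h^{(k)}(t_N) / k!` of the Taylor expansion of `h` at `t_N`. -/
def taylorCoeff (δ : Derivation ℂ F F) (h : F) (k : ℕ) : DiffPoly F :=
  MvPolynomial.C (((k.factorial : ℂ)⁻¹) • (δ : F → F)^[k] h)

/-- `h((1/N) x̂ ∂^(1-N))`. As `(1/N) x̂ ∂^(1-N) - t_N` is a purely integral operator (for `N ≥ 3`)
and commutes with functions of `t_N`, this is its Taylor series at `t_N`. For a negative power `h`
of `t_N` this is the power of the inverse of `(1/N) x̂ ∂^(1-N)` expanded in powers of `∂⁻¹`. -/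
def funOp (δ : Derivation ℂ F F) (t : F) (t₀ : ℂ) (N : ℕ) (h : F) : Ser F :=
  adicSum (taylorCoeff δ h) (ppow (opE t t₀ N - op (MvPolynomial.C t) 0))

/-- The vector field `V^N(α, h)`: the flow of `A = h((1/N) x̂ ∂^(1-N)) ∂^α`, which acts on `e^ζ` as
`λ^α h(∂_E)`. -/
def V (δ : Derivation ℂ F F) (t : F) (t₀ : ℂ) (N : ℕ) (α : ℤ) (h : F) :
    Derivation ℂ (DiffPoly F) (DiffPoly F) :=
  (flow (pmul (funOp δ t t₀ N h) (op 1 α))).restrictScalars ℂ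

/-! ### Baker-Akhiezer functions

Here series are read as series in `λ⁻¹`; the factors `e^ζ` and `e^{-ζ}`, with
`ζ = λ x + λ² y + λ^N t_N + t₀ ln λ`, are split off. -/

/-- `e^{-ζ} φ`, where `φ = K e^ζ`. -/
def baker : Ser F := dressing

/-- `e^ζ φ^*`, where `φ^* = (K⁻¹)^* e^{-ζ}`; note that `∂^n e^{-ζ} = (-λ)^n e^{-ζ}`. -/
def bakerStar : Ser F :=
  ofCoeffs fun n => (-1) ^ n * (conj (pinv dressing)).coeff n

/-- The operator `λ ∂_λ`. -/
def euler (b : Ser F) : Ser F :=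
  HahnSeries.mk (fun n => -n • b.coeff n) (b.isPWO_support.mono fun n hn hb => hn (by
    simp [hb]))

/-- `e^{-ζ} (∂_E - t_N) e^ζ`, where `E = λ^N`, that is, the operator
`(1/N) (λ^(1-N) ∂_λ + 2 y λ^(2-N) + x λ^(1-N) + t₀ λ^(-N))`. -/
def shiftE (t₀ : ℂ) (N : ℕ) (b : Ser F) : Ser F :=
  (N : ℂ)⁻¹ • (HahnSeries.single (N : ℤ) 1 * euler b +
    (HahnSeries.single ((N : ℤ) - 2) (2 * MvPolynomial.X .y) +
      HahnSeries.single ((N : ℤ) - 1) (MvPolynomial.X .x) +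
      HahnSeries.single (N : ℤ) (const t₀)) * b)

/-- `e^{-ζ} h(∂_E) φ`, through the Taylor series of `h` at `t_N`. -/
def funBaker (δ : Derivation ℂ F F) (t₀ : ℂ) (N : ℕ) (h : F) : Ser F :=
  adicSum (taylorCoeff δ h) (fun k => (shiftE t₀ N)^[k] baker)

/-- `2 res_λ λ^α [h(∂_E) φ] φ^*`, with `E = λ^N`. -/
def residueForm (δ : Derivation ℂ F F) (t₀ : ℂ) (N : ℕ) (α : ℤ) (h : F) : DiffPoly F :=
  2 * (HahnSeries.single (-α) 1 * funBaker δ t₀ N h * bakerStar).coeff 1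

/-! ### Symmetries and point symmetries -/

/-- Symmetries of the `KP_N` equation: evolutionary vector fields on the space of dressing
operators (they do not act on functions of `x, y, t_N`) that are compatible with the evolution in
`x`, `y` and `t_N`. -/
def IsKPSymmetry (δ : Derivation ℂ F F) (N : ℕ) (U : Derivation ℂ (DiffPoly F) (DiffPoly F)) :
    Prop :=
  (∀ a : F, U (MvPolynomial.C a) = 0) ∧ U (MvPolynomial.X .x) = 0 ∧ U (MvPolynomial.X .y) = 0 ∧
    ⁅U, (Dx (F := F)).restrictScalars ℂ⁆ = 0 ∧ ⁅U, (Dy (F := F)).restrictScalars ℂ⁆ = 0 ∧ ⁅U, Dt δ N⁆ = 0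

end Fields

/-- The coordinates `x`, `y`, `w` of the space of point transformations; the fourth coordinate
`t_N` enters through the coefficient ring `F`. -/
inductive PCoord
  | x : PCoord
  | y : PCoord
  | w : PCoord

/-- Functions of `x, y, w, t_N`, polynomial in `x, y, w`. -/
abbrev PFun (F : Type*) [CommRing F] := MvPolynomial PCoord F

section Points

variable {F : Type*} [CommRing F] [Algebra ℂ F]

/-- The vector field `v₁ ∂_x + v₂ ∂_y + v_N ∂_{t_N} + p ∂_w`. -/
def pointField (δ : Derivation ℂ F F) (v₁ v₂ vN p : PFun F) :
    Derivation ℂ (PFun F) (PFun F) :=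
  v₁ • (MvPolynomial.pderiv PCoord.x).restrictScalars ℂ +
    v₂ • (MvPolynomial.pderiv PCoord.y).restrictScalars ℂ +
    vN • coeffDer δ + p • (MvPolynomial.pderiv PCoord.w).restrictScalars ℂ

/-- Evaluation of a function of `x, y, w, t_N` at `w = -2 K₁`. -/
def evalW : PFun F →ₐ[F] DiffPoly F :=
  MvPolynomial.aeval fun v => match v with
    | .x => MvPolynomial.X .x
    | .y => MvPolynomial.X .y
    | .w => w

/-- The flow `U` has the form `∂w/∂z = v₁ w_x + v₂ w_y + v_N w_{t_N} - p` of a point symmetry, with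
functions `v₁, v₂, v_N, p` of `(x, y, t_N, w)`, and `Z = v₁ ∂_x + v₂ ∂_y + v_N ∂_{t_N} + p ∂_w` is
the corresponding vector field on the space of `(x, y, t_N, w)`. -/
def Represents (δ : Derivation ℂ F F) (N : ℕ) (U : Derivation ℂ (DiffPoly F) (DiffPoly F))
    (Z : Derivation ℂ (PFun F) (PFun F)) : Prop :=
  ∃ v₁ v₂ vN p : PFun F, Z = pointField δ v₁ v₂ vN p ∧
    U w = evalW v₁ * Dx w + evalW v₂ * Dy w + evalW vN * Dt δ N w - evalW p

/-- Lie point symmetries of the `KP_N` equation. -/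
def IsLiePointSymmetry (δ : Derivation ℂ F F) (N : ℕ)
    (U : Derivation ℂ (DiffPoly F) (DiffPoly F)) : Prop :=
  IsKPSymmetry δ N U ∧ ∃ Z, Represents δ N U Z

/-- The Lie algebra of vector fields generated by all Lie point symmetries of `KP_N` among the
linear combinations of the flows `V^N(α, h)`, `α ≤ N`. -/
def pointAlgebra (δ : Derivation ℂ F F) (t : F) (t₀ : ℂ) (N : ℕ) :
    LieSubalgebra ℂ (Derivation ℂ (PFun F) (PFun F)) :=
  LieSubalgebra.lieSpan ℂ _ {Z | ∃ U ∈ Submodule.span ℂ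
    {U | ∃ α : ℤ, α ≤ N ∧ ∃ h : F, U = V δ t t₀ N α h}, IsKPSymmetry δ N U ∧ Represents δ N U Z}

/-- The Lie algebra of vector fields generated by the symmetries with `α = N`. -/
def virasoroPart (δ : Derivation ℂ F F) (t : F) (t₀ : ℂ) (N : ℕ) :
    LieSubalgebra ℂ (Derivation ℂ (PFun F) (PFun F)) :=
  LieSubalgebra.lieSpan ℂ _ {Z | ∃ h : F, Represents δ N (V δ t t₀ N N h) Z}

/-- The values `α = 2, 1, -1`, and also `α = 0` when `N = 3`. -/
def IsCurrentIndex (N : ℕ) (α : ℤ) : Prop := α = 2 ∨ α = 1 ∨ α = -1 ∨ (α = 0 ∧ N = 3)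

/-- The Lie algebra of vector fields generated by the symmetries with `α = 2, 1, -1` (and `α = 0`
when `N = 3`). -/
def currentPart (δ : Derivation ℂ F F) (t : F) (t₀ : ℂ) (N : ℕ) :
    LieSubalgebra ℂ (Derivation ℂ (PFun F) (PFun F)) :=
  LieSubalgebra.lieSpan ℂ _
    {Z | ∃ α : ℤ, IsCurrentIndex N α ∧ ∃ h : F, Represents δ N (V δ t t₀ N α h) Z}

end Points

end

end KPSym

/-!
Point symmetries of the `KP_N` equation.

*Calculus of operators.* The series in `∂⁻¹` with the product `pmul` form a ring (`PDO`). Identities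
between infinite series are checked modulo the subgroups `deep F m` of operators in which only
`∂^(-i)`, `i ≥ m`, occur; these are compatible with the product and separated, so that it suffices
to treat monomials and finite partial sums.

*The flows are symmetries.* For generators `A`, `B` with `∂A = [B, A]` and `B` constant, the flows
`K ↦ -(K A K⁻¹)₋ K` and `K ↦ -(K B K⁻¹)₋ K` commute (`flows_commute_on_dressing`), an identity that
only uses that both the integral and the differential operators are closed under multiplication.
With `X = (1/N) x̂ ∂^(1-N) - t_N` one has `[∂ⁿ, X] = (n/N) ∂^(n-N)`, so that
`A = h(t_N + X) ∂^α` satisfies this equation for the evolutions in `y` (`n = 2`) and in `t_N`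
(`n = N`), and all the flows `V^N(α, h)` are symmetries (`isKPSymmetry_V`). Whether a flow is a
point symmetry depends on `V w` alone.

*The residue formula.* From the coefficient of `∂⁻¹` in the equation for `K` one gets
`V w = 2 res (K A K⁻¹)`. The residue of a product of operators is the residue in `λ` of the product
of a symbol and of a conjugate symbol (`coeff_pmul_eq_coeff_mul_starSymbol`), and right
multiplication by `X` acts on symbols as `∂_E - t_N` (`pmul_shiftOp`).

*The point symmetries.* The powers `X^k` have order at most `-(N-2) k`, hence only finitely many
Taylor coefficients of `h` enter the residue (`res_V`). For `α = 2, 1, 0, -1` and for `α = N` the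
residues that occur are, up to factors in `y` and `t_N`, those of `∂^N` and `∂²`, which are
multiples of `w_{t_N}` and `w_y`, and those of operators of order at most one, which are affine in
`w` and `w_x`. This yields the explicit fields `curField` and `virField`. For `α ≤ -2` the residue
vanishes.

*Uniqueness and absence of other terms.* Let `n ≥ 2` and let `jetDer (n - 1)` be the evolutionary
vector field with `∂K_n = x`, all other `K_i` being constant. It annihilates functions of
`x, y, t_N, w`; it annihilates the residues `res (K Z K⁻¹)` with `Z` of order below `n`, while for
`Z` of order `n` with leading coefficient `c` free of `x` the result is `-n c` (`jetDer_res`). For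
`n = N` and `n = 2` this reads off the components of a point field along `∂_{t_N}` and `∂_y`, so the
field is determined by `V w` (`Represents.unique`). By descending induction over `3 ≤ n < N` it also
shows that a combination of flows which is a point symmetry contains no terms with `3 ≤ α < N`
(`eq_virField_add_curField`).

*The algebras.* The commutators of the explicit fields are computed directly (`virField_lie`,
`curField_lie`, `virField_lie_curField`). The fields with `α ≠ N` preserve the span of
`1, y, x, y², xy, y³, w` over the functions of `t_N` and are strictly upper triangular there
(`loopMatrix`). Each commutator moves the entries one diagonal further up, which gives nilpotency.
A field with `α = N` is recognized by its action `f ∂_{t_N}` on `t_N`, which is killed by the fields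
with `α ≠ N`; therefore the sum of the two algebras is direct.
-/

namespace KPSym

noncomputable section

section PseudoDiff

variable {F : Type*} [CommRing F]

/-! ### The algebra of pseudodifferential operators -/

/-- The iterated total derivative `∂ₓ^k` as a linear map. -/
def dx (k : ℕ) : DiffPoly F →ₗ[F] DiffPoly F := (Dx : Derivation F _ (DiffPoly F)).toLinearMap ^ k

theorem iterate_Dx (k : ℕ) (b : DiffPoly F) : (Dx : DiffPoly F → DiffPoly F)^[k] b = dx k b := by
  simp only [dx, Module.End.pow_apply]; rfl

@[simp] theorem dx_zero (b : DiffPoly F) : dx 0 b = b := rfl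

theorem dx_succ (k : ℕ) (b : DiffPoly F) : dx (k + 1) b = Dx (dx k b) := by
  simp only [← iterate_Dx, Function.iterate_succ', Function.comp_apply]

theorem dx_succ' (k : ℕ) (b : DiffPoly F) : dx (k + 1) b = dx k (Dx b) := by
  simp only [← iterate_Dx, Function.iterate_succ, Function.comp_apply]

@[simp] theorem dx_one (b : DiffPoly F) : dx 1 b = Dx b := dx_succ 0 b

theorem dx_add (k l : ℕ) (b : DiffPoly F) : dx (k + l) b = dx k (dx l b) := by
  simp only [← iterate_Dx, Function.iterate_add, Function.comp_apply]

/-- The Leibniz rule for iterated derivatives. -/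
theorem dx_mul (k : ℕ) (b c : DiffPoly F) :
    dx k (b * c) =
      ∑ p ∈ Finset.HasAntidiagonal.antidiagonal k, k.choose p.1 • (dx p.1 b * dx p.2 c) := by
  induction k with
  | zero => simp
  | succ k ih =>
    rw [Finset.Nat.antidiagonal_succ', dx_succ, ih, map_sum]
    rw [Finset.sum_cons, Finset.sum_map]
    have h1 : ∀ p ∈ Finset.HasAntidiagonal.antidiagonal k,
        Dx (k.choose p.1 • (dx p.1 b * dx p.2 c)) =
          k.choose p.1 • (dx p.1 b * dx (p.2 + 1) c) +
            k.choose p.1 • (dx (p.1 + 1) b * dx p.2 c) := by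
      intro p _
      rw [map_nsmul, Derivation.leibniz, dx_succ, dx_succ, smul_add, smul_eq_mul, smul_eq_mul,
        mul_comm (dx p.2 c)]
    rw [Finset.sum_congr rfl h1, Finset.sum_add_distrib]
    have h2 : ∑ p ∈ Finset.HasAntidiagonal.antidiagonal k,
        k.choose p.1 • (dx (p.1 + 1) b * dx p.2 c) =
        ∑ p ∈ Finset.HasAntidiagonal.antidiagonal (k + 1), (match p.1 with
          | 0 => 0
          | i + 1 => k.choose i) • (dx p.1 b * dx p.2 c) := by
      rw [Finset.Nat.antidiagonal_succ, Finset.sum_cons, Finset.sum_map]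
      simp
    rw [h2, Finset.Nat.antidiagonal_succ', Finset.sum_cons, Finset.sum_map]
    rw [add_left_comm, ← Finset.sum_add_distrib]
    congr 1
    · simp
    · refine Finset.sum_congr rfl fun p _ => ?_
      rcases p with ⟨_ | i, j⟩
      · simp
      · simp only [Function.Embedding.coeFn_mk, Function.Embedding.prodMap, Prod.map,
          Function.Embedding.refl_apply, ← add_smul]
        congr 1
        rw [Nat.choose_succ_succ, add_comm]

/-- The operators in which only the powers `∂^(-i)`, `i ≥ m`, occur. -/
def deep (F : Type*) [CommRing F] (m : ℤ) : AddSubgroup (Ser F) where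
  carrier := {a | ∀ i < m, a.coeff i = 0}
  zero_mem' := fun i _ => by simp
  add_mem' := fun ha hb i hi => by simp [ha i hi, hb i hi]
  neg_mem' := fun ha i hi => by simp [ha i hi]

theorem deep_mono {m n : ℤ} (h : m ≤ n) : deep F n ≤ deep F m :=
  fun _ ha i hi => ha i (by omega)

theorem exists_deep (a : Ser F) : ∃ m, a ∈ deep F m :=
  ⟨a.order, fun _ hi => HahnSeries.coeff_eq_zero_of_lt_order hi⟩

theorem eq_of_forall_sub_mem_deep {a b : Ser F} (h : ∀ m : ℕ, a - b ∈ deep F m) : a = b := by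
  ext1; funext i
  have := h (i + 1).toNat i (by omega)
  simpa [sub_eq_zero] using this

@[simp] theorem coeff_op (a : DiffPoly F) (n i : ℤ) :
    (op a n).coeff i = if i = -n then a else 0 := by
  classical
  simp [op, HahnSeries.coeff_single]

theorem op_mem_deep (a : DiffPoly F) (n : ℤ) : op a n ∈ deep F (-n) := by
  intro i hi
  simp [hi.ne]

theorem op_add (a b : DiffPoly F) (n : ℤ) : op (a + b) n = op a n + op b n := by
  simp [op]

@[simp] theorem op_zero (n : ℤ) : op (0 : DiffPoly F) n = 0 := by simp [op]

/-- To prove an additive property of an operator in `deep F A` it suffices to treat monomials and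
operators of very low order. -/
theorem deep_induction {P : Ser F → Prop} (A : ℤ) (hadd : ∀ a b, P a → P b → P (a + b))
    (hop : ∀ u n, n ≤ -A → P (op u n)) (hdeep : ∃ m, ∀ a ∈ deep F m, P a)
    {a : Ser F} (ha : a ∈ deep F A) : P a := by
  obtain ⟨m, hm⟩ := hdeep
  have h0 : P 0 := hm 0 (zero_mem _)
  have hsum : ∀ s : Finset ℤ, (∀ i ∈ s, A ≤ i) → P (∑ i ∈ s, op (a.coeff i) (-i)) := by
    intro s
    induction s using Finset.induction_on with
    | empty => intro _; simpa using h0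
    | insert i s hi ih =>
      intro hs
      rw [Finset.sum_insert hi]
      exact hadd _ _ (hop _ _ (by have := hs i (by simp); omega))
        (ih fun j hj => hs j (by simp [hj]))
  have key := hadd _ _ (hsum (Finset.Ico A m) fun i hi => (Finset.mem_Ico.1 hi).1)
    (hm (a - ∑ i ∈ Finset.Ico A m, op (a.coeff i) (-i)) ?_)
  · simpa using key
  · intro i hi
    simp only [HahnSeries.coeff_sub, HahnSeries.coeff_sum, coeff_op, neg_neg]
    by_cases hA : A ≤ i
    · simp [hA, hi]
    · simp [hA, ha i (by omega)]

theorem op_induction {P : Ser F → Prop} (hadd : ∀ a b, P a → P b → P (a + b))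
    (hop : ∀ u n, P (op u n)) (hdeep : ∃ m, ∀ a ∈ deep F m, P a) (a : Ser F) : P a := by
  obtain ⟨A, hA⟩ := exists_deep a
  exact deep_induction A hadd (fun u n _ => hop u n) hdeep hA

theorem coeff_pmul (a b : Ser F) (n : ℤ) : (pmul a b).coeff n =
    ∑ᶠ p : ℤ × ℕ, Ring.choose (-p.1) p.2 • (a.coeff p.1 * dx p.2 (b.coeff (n - p.1 - p.2))) := by
  simp only [pmul, HahnSeries.coeff_ofSuppBddBelow, pmulCoeff, iterate_Dx]

theorem pmul_support {A B : ℤ} {a b : Ser F} (ha : a ∈ deep F A) (hb : b ∈ deep F B) (n : ℤ) :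
    (Function.support fun p : ℤ × ℕ =>
      Ring.choose (-p.1) p.2 • (a.coeff p.1 * dx p.2 (b.coeff (n - p.1 - p.2)))) ⊆
      {p : ℤ × ℕ | A ≤ p.1 ∧ B ≤ n - p.1 - p.2} := by
  intro p hp
  by_contra hc
  apply hp
  simp only [Set.mem_ofPred_eq, not_and_or, not_le] at hc
  rcases hc with hc | hc
  · simp [ha _ hc]
  · simp [hb _ hc]

theorem pmul_support_finite (a b : Ser F) (n : ℤ) : (Function.support fun p : ℤ × ℕ =>
    Ring.choose (-p.1) p.2 • (a.coeff p.1 * dx p.2 (b.coeff (n - p.1 - p.2)))).Finite := by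
  obtain ⟨A, hA⟩ := exists_deep a
  obtain ⟨B, hB⟩ := exists_deep b
  refine Set.Finite.subset ((Finset.Icc A (n - B) ×ˢ
    Finset.range (n - A - B + 1).toNat).finite_toSet) ((pmul_support hA hB n).trans ?_)
  rintro ⟨i, k⟩ ⟨h1, h2⟩
  simp only [Finset.coe_product, Set.mem_prod, Finset.mem_coe, Finset.mem_Icc, Finset.mem_range]
  simp only at h1 h2
  omega

theorem pmul_add (a b c : Ser F) : pmul a (b + c) = pmul a b + pmul a c := by
  ext1; funext n
  rw [HahnSeries.coeff_add, coeff_pmul, coeff_pmul, coeff_pmul,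
    ← finsum_add_distrib (pmul_support_finite a b n) (pmul_support_finite a c n)]
  refine finsum_congr fun p => ?_
  rw [HahnSeries.coeff_add, map_add, mul_add, smul_add]

theorem add_pmul (a b c : Ser F) : pmul (a + b) c = pmul a c + pmul b c := by
  ext1; funext n
  rw [HahnSeries.coeff_add, coeff_pmul, coeff_pmul, coeff_pmul,
    ← finsum_add_distrib (pmul_support_finite a c n) (pmul_support_finite b c n)]
  refine finsum_congr fun p => ?_
  rw [HahnSeries.coeff_add, add_mul, smul_add]

theorem pmul_mem_deep {A B : ℤ} {a b : Ser F} (ha : a ∈ deep F A) (hb : b ∈ deep F B) :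
    pmul a b ∈ deep F (A + B) := by
  intro n hn
  rw [coeff_pmul, finsum_eq_zero_of_forall_eq_zero]
  intro p
  by_contra hp
  obtain ⟨h1, h2⟩ := pmul_support ha hb n hp
  omega

/-- Coefficients of a product with a monomial on the left. -/
theorem coeff_op_pmul (u : DiffPoly F) (m : ℤ) {B : ℤ} {b : Ser F} (hb : b ∈ deep F B) (n : ℤ)
    (T : ℕ) (hT : (T : ℤ) = n + m - B) : (pmul (op u m) b).coeff n =
      ∑ p ∈ Finset.HasAntidiagonal.antidiagonal T,
        Ring.choose m p.1 • (u * dx p.1 (b.coeff (B + p.2))) := by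
  rw [coeff_pmul, finsum_eq_sum_of_support_subset
    (s := (Finset.HasAntidiagonal.antidiagonal T).image fun p => ((-m, p.1) : ℤ × ℕ)),
    Finset.sum_image]
  · refine Finset.sum_congr rfl fun p hp => ?_
    have hp' := Finset.HasAntidiagonal.mem_antidiagonal.1 hp
    have : n - -m - (p.1 : ℤ) = B + p.2 := by omega
    simp only [this, coeff_op, if_true, neg_neg]
  · rintro ⟨k, l⟩ hk ⟨k', l'⟩ hk' h
    have h1 := Finset.HasAntidiagonal.mem_antidiagonal.1 hk
    have h2 := Finset.HasAntidiagonal.mem_antidiagonal.1 hk'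
    simp only [Prod.mk.injEq, true_and] at h h1 h2 ⊢
    omega
  · rintro ⟨i, k⟩ hp
    obtain ⟨h1, h2⟩ := pmul_support (op_mem_deep u m) hb n hp
    have h3 : i = -m := by
      by_contra h
      apply hp
      simp [h]
    simp only at h1 h2
    simp only [Finset.coe_image, Set.mem_image, Finset.mem_coe,
      Finset.HasAntidiagonal.mem_antidiagonal, Prod.mk.injEq]
    exact ⟨(k, T - k), by simp only; omega, by omega, rfl⟩

/-- Coefficients of a product with a monomial on the right. -/
theorem coeff_pmul_op (u : DiffPoly F) (m : ℤ) {A : ℤ} {a : Ser F} (ha : a ∈ deep F A) (n : ℤ)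
    (T : ℕ) (hT : (T : ℤ) = n + m - A) : (pmul a (op u m)).coeff n =
      ∑ p ∈ Finset.HasAntidiagonal.antidiagonal T,
        Ring.choose (-(A + p.1)) p.2 • (a.coeff (A + p.1) * dx p.2 u) := by
  rw [coeff_pmul, finsum_eq_sum_of_support_subset
    (s := (Finset.HasAntidiagonal.antidiagonal T).image fun p => ((A + p.1, p.2) : ℤ × ℕ)),
    Finset.sum_image]
  · refine Finset.sum_congr rfl fun p hp => ?_
    have hp' := Finset.HasAntidiagonal.mem_antidiagonal.1 hp
    have : n - (A + p.1) - (p.2 : ℤ) = -m := by omega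
    simp [this]
  · rintro ⟨k, l⟩ hk ⟨k', l'⟩ hk' h
    simp only [Prod.mk.injEq] at h ⊢
    omega
  · rintro ⟨i, k⟩ hp
    obtain ⟨h1, h2⟩ := pmul_support ha (op_mem_deep u m) n hp
    have h3 : n - i - k = -m := by
      by_contra h
      apply hp
      simp [h]
    simp only at h1 h2
    simp only [Finset.coe_image, Set.mem_image, Finset.mem_coe,
      Finset.HasAntidiagonal.mem_antidiagonal, Prod.mk.injEq]
    exact ⟨((i - A).toNat, k), by simp only; omega, by simp only; omega, rfl⟩

/-- Coefficients of a product of monomials. -/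
theorem coeff_op_pmul_op (u v : DiffPoly F) (m l n : ℤ) (k : ℕ) (hk : (k : ℤ) = n + m + l) :
    (pmul (op u m) (op v l)).coeff n = Ring.choose m k • (u * dx k v) := by
  rw [coeff_op_pmul u m (op_mem_deep v l) n k (by omega),
    Finset.sum_eq_single_of_mem (k, 0) (by simp)]
  · simp
  · rintro ⟨i, j⟩ hp h
    have hp' := Finset.HasAntidiagonal.mem_antidiagonal.1 hp
    have : j ≠ 0 := by
      rintro rfl
      simp at hp'
      exact h (by simp [hp'])
    simp [this]

theorem op_pmul_op_mem_deep (u v : DiffPoly F) (m l : ℤ) :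
    pmul (op u m) (op v l) ∈ deep F (-(m + l)) := by
  have := pmul_mem_deep (op_mem_deep u m) (op_mem_deep v l)
  rwa [show -(m + l) = -m + -l by ring]

theorem pmul_assoc_op (a b c : DiffPoly F) (i j l : ℤ) :
    pmul (pmul (op a i) (op b j)) (op c l) = pmul (op a i) (pmul (op b j) (op c l)) := by
  have hab := op_pmul_op_mem_deep a b i j
  have hbc := op_pmul_op_mem_deep b c j l
  have h1 := pmul_mem_deep hab (op_mem_deep c l)
  have h2 := pmul_mem_deep (op_mem_deep a i) hbc
  ext1; funext n
  rcases lt_or_ge (n + i + j + l) 0 with hn | hn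
  · rw [h1 n (by omega), h2 n (by omega)]
  obtain ⟨T, hT⟩ := Int.eq_ofNat_of_zero_le hn
  rw [coeff_pmul_op c l hab n T (by omega), coeff_op_pmul a i hbc n T (by omega)]
  have e1 : ∀ p ∈ Finset.HasAntidiagonal.antidiagonal T,
      Ring.choose (-(-(i + j) + (p.1 : ℤ))) p.2 •
        ((pmul (op a i) (op b j)).coeff (-(i + j) + p.1) * dx p.2 c) =
      ∑ q ∈ Finset.HasAntidiagonal.antidiagonal p.2,
        (Ring.choose i p.1 * (Ring.choose (i - p.1) q.1 * Ring.choose j q.2)) •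
          (a * (dx p.1 b * dx (q.1 + q.2) c)) := by
    intro p _
    rw [coeff_op_pmul_op a b i j _ p.1 (by omega),
      show (-(-(i + j) + (p.1 : ℤ))) = (i - p.1) + j by ring,
      Ring.add_choose_eq p.2 (Commute.all (i - (p.1 : ℤ)) j), Finset.sum_smul]
    refine Finset.sum_congr rfl fun q hq => ?_
    rw [Finset.HasAntidiagonal.mem_antidiagonal.1 hq]
    simp only [smul_mul_assoc, smul_smul, mul_assoc]
    congr 1
    ring
  have e2 : ∀ p ∈ Finset.HasAntidiagonal.antidiagonal T,
      Ring.choose i p.1 • (a * dx p.1 ((pmul (op b j) (op c l)).coeff (-(j + l) + p.2))) =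
      ∑ q ∈ Finset.HasAntidiagonal.antidiagonal p.1,
        (Ring.choose i q.1 * (Ring.choose (i - q.1) q.2 * Ring.choose j p.2)) •
          (a * (dx q.1 b * dx (q.2 + p.2) c)) := by
    intro p _
    rw [coeff_op_pmul_op b c j l _ p.2 (by omega), map_zsmul, dx_mul, Finset.smul_sum,
      Finset.mul_sum, Finset.smul_sum]
    refine Finset.sum_congr rfl fun q hq => ?_
    have hq' := Finset.HasAntidiagonal.mem_antidiagonal.1 hq
    have hc := Ring.choose_smul_choose i (n := p.1) (k := q.1) (by omega)
    rw [show p.1 - q.1 = q.2 by omega] at hc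
    rw [← mul_assoc (Ring.choose i q.1), ← hc, dx_add]
    simp only [mul_smul_comm, ← natCast_zsmul, smul_smul]
    congr 1
    simp only [smul_eq_mul]
    ring
  rw [Finset.sum_congr rfl e1, Finset.sum_congr rfl e2, Finset.sum_sigma', Finset.sum_sigma']
  refine Finset.sum_bij' (fun x _ => ⟨(x.1.1 + x.2.1, x.2.2), (x.1.1, x.2.1)⟩)
    (fun x _ => ⟨(x.2.1, x.2.2 + x.1.2), (x.2.2, x.1.2)⟩) ?_ ?_ ?_ ?_ ?_
  · rintro ⟨⟨r, s⟩, ⟨u, v⟩⟩ h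
    simp only [Finset.mem_sigma, Finset.HasAntidiagonal.mem_antidiagonal] at h ⊢
    obtain ⟨rfl, rfl⟩ := h
    simp [add_assoc]
  · rintro ⟨⟨r, s⟩, ⟨u, v⟩⟩ h
    simp only [Finset.mem_sigma, Finset.HasAntidiagonal.mem_antidiagonal] at h ⊢
    obtain ⟨rfl, rfl⟩ := h
    simp [add_assoc]
  · rintro ⟨⟨r, s⟩, ⟨u, v⟩⟩ h
    simp only [Finset.mem_sigma, Finset.HasAntidiagonal.mem_antidiagonal] at h
    obtain ⟨-, rfl⟩ := h
    rfl
  · rintro ⟨⟨r, s⟩, ⟨u, v⟩⟩ h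
    simp only [Finset.mem_sigma, Finset.HasAntidiagonal.mem_antidiagonal] at h
    obtain ⟨-, rfl⟩ := h
    rfl
  · rintro ⟨⟨r, s⟩, ⟨u, v⟩⟩ _
    rfl

/-- The product of pseudodifferential operators is associative. -/
theorem pmul_assoc (a b c : Ser F) : pmul (pmul a b) c = pmul a (pmul b c) := by
  ext1; funext n
  obtain ⟨A, hA⟩ := exists_deep a
  obtain ⟨B, hB⟩ := exists_deep b
  obtain ⟨C, hC⟩ := exists_deep c
  refine op_induction (P := fun a => (pmul (pmul a b) c).coeff n = (pmul a (pmul b c)).coeff n)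
    (fun a a' h h' => ?_) (fun u i => ?_) ⟨n - B - C + 1, fun a ha => ?_⟩ a
  · simp only [add_pmul, HahnSeries.coeff_add, h, h']
  · refine op_induction (P := fun b => (pmul (pmul (op u i) b) c).coeff n =
      (pmul (op u i) (pmul b c)).coeff n)
      (fun b b' h h' => ?_) (fun v j => ?_) ⟨n + i - C + 1, fun b hb => ?_⟩ b
    · simp only [add_pmul, pmul_add, HahnSeries.coeff_add, h, h']
    · refine op_induction (P := fun c => (pmul (pmul (op u i) (op v j)) c).coeff n =
        (pmul (op u i) (pmul (op v j) c)).coeff n)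
        (fun c c' h h' => ?_) (fun x l => ?_) ⟨n + i + j + 1, fun c hc => ?_⟩ c
      · simp only [pmul_add, HahnSeries.coeff_add, h, h']
      · rw [pmul_assoc_op]
      · rw [pmul_mem_deep (op_pmul_op_mem_deep u v i j) hc n (by omega),
          pmul_mem_deep (op_mem_deep u i) (pmul_mem_deep (op_mem_deep v j) hc) n (by omega)]
    · rw [pmul_mem_deep (pmul_mem_deep (op_mem_deep u i) hb) hC n (by omega),
        pmul_mem_deep (op_mem_deep u i) (pmul_mem_deep hb hC) n (by omega)]
  · rw [pmul_mem_deep (pmul_mem_deep ha hB) hC n (by omega),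
      pmul_mem_deep ha (pmul_mem_deep hB hC) n (by omega)]

theorem one_pmul (a : Ser F) : pmul (op 1 0) a = a := by
  obtain ⟨A, hA⟩ := exists_deep a
  ext1; funext n
  rcases lt_or_ge n A with h | h
  · rw [hA n h, pmul_mem_deep (op_mem_deep 1 0) hA n (by omega)]
  obtain ⟨T, hT⟩ := Int.eq_ofNat_of_zero_le (a := n - A) (by omega)
  rw [coeff_op_pmul 1 0 hA n T (by omega), Finset.sum_eq_single_of_mem (0, T) (by simp)]
  · simp [show A + (T : ℤ) = n by omega]
  · rintro ⟨i, j⟩ hp h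
    have hp' := Finset.HasAntidiagonal.mem_antidiagonal.1 hp
    have : 0 < i := by
      rcases Nat.eq_zero_or_pos i with rfl | hi
      · simp at hp'
        exact absurd (by simp [hp']) h
      · exact hi
    simp [Ring.choose_zero_pos ℤ this]

theorem pmul_one (a : Ser F) : pmul a (op 1 0) = a := by
  obtain ⟨A, hA⟩ := exists_deep a
  ext1; funext n
  rcases lt_or_ge n A with h | h
  · rw [hA n h, pmul_mem_deep hA (op_mem_deep 1 0) n (by omega)]
  obtain ⟨T, hT⟩ := Int.eq_ofNat_of_zero_le (a := n - A) (by omega)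
  rw [coeff_pmul_op 1 0 hA n T (by omega), Finset.sum_eq_single_of_mem (T, 0) (by simp)]
  · simp [show A + (T : ℤ) = n by omega]
  · rintro ⟨i, j⟩ hp h
    have hp' := Finset.HasAntidiagonal.mem_antidiagonal.1 hp
    have : j ≠ 0 := by
      rintro rfl
      simp at hp'
      exact h (by simp [hp'])
    obtain ⟨j, rfl⟩ := Nat.exists_eq_succ_of_ne_zero this
    simp [dx_succ']

/-- The noncommutative ring of pseudodifferential operators: the series in `∂⁻¹` with the
product `pmul`. -/
def PDO (F : Type*) [CommRing F] := Ser F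

instance : AddCommGroup (PDO F) := inferInstanceAs (AddCommGroup (Ser F))

instance : Ring (PDO F) :=
  { (inferInstance : AddCommGroup (PDO F)) with
    mul := fun a b => pmul (F := F) a b
    one := op (F := F) 1 0
    left_distrib := pmul_add
    right_distrib := add_pmul
    mul_assoc := pmul_assoc
    one_mul := one_pmul
    mul_one := pmul_one
    zero_mul := fun a => by
      have h := add_pmul (F := F) 0 0 a
      rw [add_zero] at h
      exact left_eq_add.1 h
    mul_zero := fun a => by
      have h := pmul_add (F := F) a 0 0
      rw [add_zero] at h
      exact left_eq_add.1 h }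

/-- A series in `∂⁻¹` as an element of the ring of pseudodifferential operators. -/
def toPDO : Ser F ≃+ PDO F := AddEquiv.refl _

theorem toPDO_one : toPDO (op (1 : DiffPoly F) 0) = 1 := rfl

theorem toPDO_ppow (a : Ser F) (k : ℕ) : toPDO (ppow a k) = toPDO a ^ k := by
  induction k with
  | zero => rw [pow_zero]; rfl
  | succ k ih => rw [pow_succ, ← ih]; rfl

theorem pmul_zero (a : Ser F) : pmul a 0 = 0 := mul_zero (toPDO a)
theorem zero_pmul (a : Ser F) : pmul 0 a = 0 := zero_mul (toPDO a)
theorem pmul_neg (a b : Ser F) : pmul a (-b) = -pmul a b := mul_neg (toPDO a) (toPDO b)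
theorem pmul_sub (a b c : Ser F) : pmul a (b - c) = pmul a b - pmul a c :=
  mul_sub (toPDO a) (toPDO b) (toPDO c)
theorem sub_pmul (a b c : Ser F) : pmul (a - b) c = pmul a c - pmul b c :=
  sub_mul (toPDO a) (toPDO b) (toPDO c)
theorem pmul_sum {ι : Type*} (s : Finset ι) (a : Ser F) (b : ι → Ser F) :
    pmul a (∑ i ∈ s, b i) = ∑ i ∈ s, pmul a (b i) := Finset.mul_sum (R := PDO F) s b a
theorem sum_pmul {ι : Type*} (s : Finset ι) (a : ι → Ser F) (b : Ser F) :
    pmul (∑ i ∈ s, a i) b = ∑ i ∈ s, pmul (a i) b := Finset.sum_mul (R := PDO F) s a b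

theorem op_pmul_op_of_Dx_eq_zero (u v : DiffPoly F) (m l : ℤ) (hv : Dx v = 0) :
    pmul (op u m) (op v l) = op (u * v) (m + l) := by
  ext1; funext n
  rcases lt_or_ge (n + m + l) 0 with h | h
  · rw [op_pmul_op_mem_deep u v m l n (by omega), coeff_op, if_neg (by omega)]
  obtain ⟨T, hT⟩ := Int.eq_ofNat_of_zero_le h
  rw [coeff_op_pmul_op u v m l n T (by omega), coeff_op]
  rcases T with _ | T
  · rw [if_pos (by simp at hT; omega)]
    simp
  · rw [if_neg (by push_cast at hT; omega), dx_succ', hv]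
    simp

theorem op_zero_pmul (u : DiffPoly F) (b : Ser F) (n : ℤ) :
    (pmul (op u 0) b).coeff n = u * b.coeff n := by
  obtain ⟨B, hB⟩ := exists_deep b
  rcases lt_or_ge n B with h | h
  · rw [hB n h, pmul_mem_deep (op_mem_deep u 0) hB n (by omega), mul_zero]
  obtain ⟨T, hT⟩ := Int.eq_ofNat_of_zero_le (a := n - B) (by omega)
  rw [coeff_op_pmul u 0 hB n T (by omega), Finset.sum_eq_single_of_mem (0, T) (by simp)]
  · simp [show B + (T : ℤ) = n by omega]
  · rintro ⟨i, j⟩ hp h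
    have hp' := Finset.HasAntidiagonal.mem_antidiagonal.1 hp
    have : 0 < i := by
      rcases Nat.eq_zero_or_pos i with rfl | hi
      · simp at hp'
        exact absurd (by simp [hp']) h
      · exact hi
    simp [Ring.choose_zero_pos ℤ this]

/-- Functions that do not depend on `x` and the fields commute with all operators. -/
theorem pmul_op_zero_comm (u : DiffPoly F) (hu : Dx u = 0) (b : Ser F) :
    pmul b (op u 0) = pmul (op u 0) b := by
  ext1; funext n
  obtain ⟨B, hB⟩ := exists_deep b
  refine op_induction (P := fun b => (pmul b (op u 0)).coeff n = (pmul (op u 0) b).coeff n)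
    (fun a a' h h' => ?_) (fun v i => ?_) ⟨n + 1, fun a ha => ?_⟩ b
  · simp only [pmul_add, add_pmul, HahnSeries.coeff_add, h, h']
  · rw [op_pmul_op_of_Dx_eq_zero _ _ _ _ hu, op_zero_pmul, coeff_op, coeff_op]
    split_ifs <;> first | omega | simp [mul_comm]
  · rw [pmul_mem_deep ha (op_mem_deep u 0) n (by omega),
      pmul_mem_deep (op_mem_deep u 0) ha n (by omega)]

end PseudoDiff

section Flows

variable {F : Type*} [CommRing F]

/-! ### Convergent sums, the dressing operator and its inverse -/

theorem coeff_ofCoeffs (c : ℕ → DiffPoly F) (n : ℤ) :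
    (ofCoeffs c).coeff n = if 0 ≤ n then c n.toNat else 0 := by
  unfold ofCoeffs
  split_ifs with h
  · obtain ⟨k, rfl⟩ := Int.eq_ofNat_of_zero_le h
    rw [HahnSeries.ofPowerSeries_apply_coeff]
    simp
  · rw [HahnSeries.ofPowerSeries_apply, HahnSeries.embDomain_of_notMem_range]
    rintro ⟨k, hk⟩
    simp at hk
    omega

theorem ofCoeffs_mem_deep (c : ℕ → DiffPoly F) : ofCoeffs c ∈ deep F 0 := by
  intro i hi
  rw [coeff_ofCoeffs, if_neg (by omega)]

/-- An infinite sum is approximated by its partial sums. -/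
theorem adicSum_sub_mem_deep (c : ℕ → DiffPoly F) (g : ℕ → Ser F) (r : ℕ) (hr : 1 ≤ r)
    (hg : ∀ k : ℕ, g k ∈ deep F ((r * k : ℕ) : ℤ)) (M : ℕ) :
    adicSum c g - ∑ k ∈ Finset.range M, pmul (op (c k) 0) (g k) ∈ deep F ((r * M : ℕ) : ℤ) := by
  intro i hi
  rw [HahnSeries.coeff_sub, HahnSeries.coeff_sum]
  simp only [op_zero_pmul]
  have hbig : ∀ k : ℕ, i < (r * k : ℕ) → c k * (g k).coeff i = 0 := fun k hk => by
    rw [hg k i hk, mul_zero]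
  unfold adicSum
  rw [coeff_ofCoeffs]
  split_ifs with h
  · obtain ⟨n, rfl⟩ := Int.eq_ofNat_of_zero_le h
    simp only [Int.toNat_natCast, Nat.cast_lt] at hi hbig ⊢
    rw [Finset.sum_subset (Finset.range_subset_range.2 (le_max_left (n + 1) M)),
      Finset.sum_subset (Finset.range_subset_range.2 (le_max_right (n + 1) M)), sub_self]
    · intro k _ hk
      apply hbig k
      rw [Finset.mem_range, not_lt] at hk
      exact lt_of_lt_of_le hi (Nat.mul_le_mul_left r hk)
    · intro k _ hk
      apply hbig k
      rw [Finset.mem_range, not_lt] at hk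
      nlinarith
  · rw [Finset.sum_eq_zero fun k _ => hbig k (by omega), sub_zero]

theorem ppow_mem_deep {a : Ser F} {r : ℕ} (ha : a ∈ deep F r) (k : ℕ) :
    ppow a k ∈ deep F ((r * k : ℕ) : ℤ) := by
  induction k with
  | zero => simpa [ppow] using op_mem_deep (1 : DiffPoly F) 0
  | succ k ih =>
    have := pmul_mem_deep ih ha
    rwa [show ((r * k : ℕ) : ℤ) + r = ((r * (k + 1) : ℕ) : ℤ) by push_cast; ring] at this

theorem ppow_mem_deep' {a : Ser F} (ha : a ∈ deep F 1) (k : ℕ) :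
    ppow a k ∈ deep F ((1 * k : ℕ) : ℤ) := ppow_mem_deep (r := 1) (by simpa using ha) k

theorem coeff_dressing (n : ℤ) : (dressing (F := F)).coeff n =
    if 0 ≤ n then (match n.toNat with
      | 0 => 1
      | j + 1 => MvPolynomial.X (Coord.K j 0)) else 0 := coeff_ofCoeffs _ _

theorem coeff_dressing_succ (j : ℕ) :
    (dressing (F := F)).coeff (j + 1) = MvPolynomial.X (Coord.K j 0) := by
  rw [coeff_dressing, if_pos (by omega)]
  rfl

theorem coeff_dressing_zero : (dressing (F := F)).coeff 0 = 1 := by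
  rw [coeff_dressing, if_pos le_rfl]
  rfl

theorem dressing_mem_deep : (dressing (F := F)) ∈ deep F 0 := ofCoeffs_mem_deep _

theorem pinv_mem_deep (a : Ser F) : pinv a ∈ deep F 0 := ofCoeffs_mem_deep _

theorem one_sub_dressing_mem_deep : op 1 0 - dressing (F := F) ∈ deep F 1 := by
  intro i hi
  rcases (show i < 0 ∨ i = 0 by omega) with h | rfl
  · rw [HahnSeries.coeff_sub, dressing_mem_deep i h, coeff_op, if_neg (by omega), sub_zero]
  · simp [coeff_dressing_zero]

theorem pinv_sub_mem_deep {a : Ser F} (ha : op 1 0 - a ∈ deep F 1) (M : ℕ) :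
    pinv a - ∑ k ∈ Finset.range M, ppow (op 1 0 - a) k ∈ deep F M := by
  have := adicSum_sub_mem_deep (fun _ => (1 : DiffPoly F)) _ 1 le_rfl (ppow_mem_deep' ha) M
  simpa only [one_pmul, one_mul, pinv] using this

theorem pmul_pinv {a : Ser F} (ha : op 1 0 - a ∈ deep F 1) : pmul a (pinv a) = op 1 0 := by
  have ha0 : a ∈ deep F 0 := by
    have h1 := sub_mem (op_mem_deep (1 : DiffPoly F) 0) (deep_mono (by norm_num) ha)
    simpa using h1
  refine eq_of_forall_sub_mem_deep fun m => ?_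
  have h1 := pmul_mem_deep ha0 (pinv_sub_mem_deep ha m)
  have h2 : pmul a (∑ k ∈ Finset.range m, ppow (op 1 0 - a) k) = op 1 0 - ppow (op 1 0 - a) m := by
    have := mul_neg_geom_sum (toPDO (op 1 0 - a)) m
    simp only [← toPDO_ppow] at this
    rw [map_sub, toPDO_one, sub_sub_cancel, ← map_sum] at this
    exact this
  have h3 := ppow_mem_deep' ha m
  rw [pmul_sub, h2, zero_add] at h1
  rw [one_mul] at h3
  have := sub_mem h1 h3
  rwa [show ∀ p q r : Ser F, p - (q - r) - r = p - q by intros; abel] at this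

theorem pinv_pmul {a : Ser F} (ha : op 1 0 - a ∈ deep F 1) : pmul (pinv a) a = op 1 0 := by
  have ha0 : a ∈ deep F 0 := by
    have h1 := sub_mem (op_mem_deep (1 : DiffPoly F) 0) (deep_mono (by norm_num) ha)
    simpa using h1
  refine eq_of_forall_sub_mem_deep fun m => ?_
  have h1 := pmul_mem_deep (pinv_sub_mem_deep ha m) ha0
  have h2 : pmul (∑ k ∈ Finset.range m, ppow (op 1 0 - a) k) a = op 1 0 - ppow (op 1 0 - a) m := by
    have := geom_sum_mul_neg (toPDO (op 1 0 - a)) m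
    simp only [← toPDO_ppow] at this
    rw [map_sub, toPDO_one, sub_sub_cancel, ← map_sum] at this
    exact this
  have h3 := ppow_mem_deep' ha m
  rw [sub_pmul, h2, add_zero] at h1
  rw [one_mul] at h3
  have := sub_mem h1 h3
  rwa [show ∀ p q r : Ser F, p - (q - r) - r = p - q by intros; abel] at this

theorem dressing_pmul_pinv : pmul (dressing (F := F)) (pinv dressing) = op 1 0 :=
  pmul_pinv one_sub_dressing_mem_deep

theorem pinv_pmul_dressing : pmul (pinv dressing) (dressing (F := F)) = op 1 0 :=
  pinv_pmul one_sub_dressing_mem_deep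

/-! ### The integral part -/

theorem coeff_minusPart (a : Ser F) (n : ℤ) :
    (minusPart a).coeff n = if 1 ≤ n then a.coeff n else 0 := by
  rw [minusPart, coeff_ofCoeffs]
  split_ifs with h1 h2 h3 h4
  · omega
  · rfl
  · rw [Int.toNat_of_nonneg h1]
  · omega
  · omega
  · rfl

theorem minusPart_mem_deep (a : Ser F) : minusPart a ∈ deep F 1 := by
  intro i hi
  rw [coeff_minusPart, if_neg (by omega)]

theorem minusPart_add (a b : Ser F) : minusPart (a + b) = minusPart a + minusPart b := by
  ext1; funext n
  simp only [HahnSeries.coeff_add, coeff_minusPart]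
  split_ifs <;> simp

/-- The integral part as an additive endomorphism of the ring of operators. -/
def minusHom : PDO F →+ PDO F := AddMonoidHom.mk' (fun a => minusPart (F := F) a) minusPart_add

theorem minusPart_of_mem_deep {a : Ser F} (ha : a ∈ deep F 1) : minusPart a = a := by
  ext1; funext n
  rw [coeff_minusPart]
  split_ifs with h
  · rfl
  · rw [ha n (by omega)]

theorem minusPart_op (u : DiffPoly F) (n : ℤ) :
    minusPart (op u n) = if n ≤ -1 then op u n else 0 := by
  split_ifs with h
  · exact minusPart_of_mem_deep (deep_mono (by omega) (op_mem_deep u n))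
  · ext1; funext i
    rw [coeff_minusPart, coeff_op]
    split_ifs <;> first | omega | simp

/-- Products of differential operators are differential operators. -/
theorem minusPart_pmul_differential (a b : Ser F) :
    minusPart (pmul (a - minusPart a) (b - minusPart b)) = 0 := by
  have hadd : ∀ a b : Ser F, a + b - minusPart (a + b) = (a - minusPart a) + (b - minusPart b) := by
    intro a b
    rw [minusPart_add]
    abel
  ext1; funext n
  refine op_induction (P := fun a => (minusPart (pmul (a - minusPart a)
      (b - minusPart b))).coeff n = (0 : Ser F).coeff n)
    (fun a a' h h' => ?_) (fun u i => ?_) ⟨1, fun a ha => ?_⟩ a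
  · rw [hadd, add_pmul, minusPart_add, HahnSeries.coeff_add, h, h']; simp
  · refine op_induction (P := fun b => (minusPart (pmul (op u i - minusPart (op u i))
      (b - minusPart b))).coeff n = (0 : Ser F).coeff n)
      (fun b b' h h' => ?_) (fun v j => ?_) ⟨1, fun b hb => ?_⟩ b
    · rw [hadd, pmul_add, minusPart_add, HahnSeries.coeff_add, h, h']; simp
    · rw [minusPart_op, minusPart_op]
      split_ifs with h1 h2 h2
      · rw [sub_self, zero_pmul]; simp [coeff_minusPart]
      · rw [sub_self, zero_pmul]; simp [coeff_minusPart]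
      · rw [sub_self, pmul_zero]; simp [coeff_minusPart]
      · rw [sub_zero, sub_zero, coeff_minusPart]
        split_ifs with h3
        · rw [coeff_op_pmul_op u v i j n (n + i + j).toNat (by omega)]
          obtain ⟨i', rfl⟩ := Int.eq_ofNat_of_zero_le (a := i) (by omega)
          rw [Ring.choose_natCast, Nat.choose_eq_zero_of_lt (by omega)]
          simp
        · rfl
    · rw [minusPart_of_mem_deep hb, sub_self, pmul_zero]; simp [coeff_minusPart]
  · rw [minusPart_of_mem_deep ha, sub_self, zero_pmul]; simp [coeff_minusPart]

/-! ### Evolutionary derivations acting on operators coefficientwise -/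

section Map

variable {R : Type*} [CommRing R] [Algebra R (DiffPoly F)]
  (U : Derivation R (DiffPoly F) (DiffPoly F))

theorem map_mem_deep {m : ℤ} {a : Ser F} (ha : a ∈ deep F m) : a.map U ∈ deep F m := by
  intro i hi
  simp [ha i hi]

theorem map_add_ser (a b : Ser F) : (a + b).map U = a.map U + b.map U := by
  ext1; funext n; simp

theorem map_sub_ser (a b : Ser F) : (a - b).map U = a.map U - b.map U := by
  ext1; funext n; simp

theorem map_op (u : DiffPoly F) (n : ℤ) : (op u n).map U = op (U u) n := by
  ext1; funext i
  simp only [HahnSeries.map_coeff, coeff_op]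
  split_ifs <;> simp

theorem map_minusPart (a : Ser F) : (minusPart a).map U = minusPart (a.map U) := by
  ext1; funext n
  simp only [HahnSeries.map_coeff, coeff_minusPart]
  split_ifs <;> simp

variable {U}

theorem map_dx (hU : ∀ b, U (Dx b) = Dx (U b)) (k : ℕ) (b : DiffPoly F) :
    U (dx k b) = dx k (U b) := by
  induction k with
  | zero => rfl
  | succ k ih => rw [dx_succ, hU, ih, dx_succ]

/-- A derivation commuting with `∂ₓ` acts on operators as a derivation. -/
theorem map_pmul (hU : ∀ b, U (Dx b) = Dx (U b)) (a b : Ser F) :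
    (pmul a b).map U = pmul (a.map U) b + pmul a (b.map U) := by
  ext1; funext n
  obtain ⟨B, hB⟩ := exists_deep b
  refine op_induction (P := fun a => ((pmul a b).map U).coeff n =
    (pmul (a.map U) b + pmul a (b.map U)).coeff n)
    (fun a a' h h' => ?_) (fun u i => ?_) ⟨n - B + 1, fun a ha => ?_⟩ a
  · rw [add_pmul, map_add_ser, map_add_ser, add_pmul, add_pmul, HahnSeries.coeff_add, h, h']
    simp only [HahnSeries.coeff_add]
    ring
  · refine op_induction (P := fun b => ((pmul (op u i) b).map U).coeff n =
      (pmul ((op u i).map U) b + pmul (op u i) (b.map U)).coeff n)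
      (fun b b' h h' => ?_) (fun v j => ?_) ⟨n + i + 1, fun b hb => ?_⟩ b
    · rw [pmul_add, map_add_ser, map_add_ser, pmul_add, pmul_add, HahnSeries.coeff_add, h, h']
      simp only [HahnSeries.coeff_add]
      ring
    · rw [map_op, map_op, HahnSeries.map_coeff, HahnSeries.coeff_add]
      rcases lt_or_ge (n + i + j) 0 with h | h
      · rw [op_pmul_op_mem_deep _ _ _ _ n (by omega), op_pmul_op_mem_deep _ _ _ _ n (by omega),
          op_pmul_op_mem_deep _ _ _ _ n (by omega), map_zero, add_zero]
      · obtain ⟨T, hT⟩ := Int.eq_ofNat_of_zero_le h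
        rw [coeff_op_pmul_op _ _ _ _ n T (by omega), coeff_op_pmul_op _ _ _ _ n T (by omega),
          coeff_op_pmul_op _ _ _ _ n T (by omega), map_zsmul, Derivation.leibniz, map_dx hU,
          ← smul_add]
        congr 1
        simp only [smul_eq_mul]
        ring
    · rw [map_mem_deep U (pmul_mem_deep (op_mem_deep u i) hb) n (by omega), HahnSeries.coeff_add,
        pmul_mem_deep (map_mem_deep U (op_mem_deep u i)) hb n (by omega),
        pmul_mem_deep (op_mem_deep u i) (map_mem_deep U hb) n (by omega), add_zero]
  · rw [map_mem_deep U (pmul_mem_deep ha hB) n (by omega), HahnSeries.coeff_add,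
      pmul_mem_deep (map_mem_deep U ha) hB n (by omega),
      pmul_mem_deep ha (map_mem_deep U hB) n (by omega), add_zero]

variable (U) in
/-- The coefficientwise action of a derivation, as an additive endomorphism of the ring of
operators. -/
def mapHom : PDO F →+ PDO F :=
  AddMonoidHom.mk' (fun a => HahnSeries.map (show Ser F from a) U) (map_add_ser U)

theorem map_adicSum (c : ℕ → DiffPoly F) (g : ℕ → Ser F) :
    (adicSum c g).map U = adicSum (fun k => U (c k)) g + adicSum c (fun k => (g k).map U) := by
  ext1; funext n
  simp only [adicSum, HahnSeries.map_coeff, HahnSeries.coeff_add, coeff_ofCoeffs]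
  split_ifs with h
  · rw [map_sum, ← Finset.sum_add_distrib]
    refine Finset.sum_congr rfl fun k _ => ?_
    rw [Derivation.leibniz, smul_eq_mul, smul_eq_mul]
    ring
  · simp

end Map

/-! ### Commutation of flows -/

/-- Two flows `V K = -(K A K⁻¹)₋ K` and `D K = -(K B K⁻¹)₋ K` commute on `K` if `B` is constant
along `V` and `D A = [B, A]`. -/
theorem flows_commute_on_dressing {R : Type*} [Ring R] (m V D : R →+ R)
    (hm : ∀ a b, m (m a * m b) = m a * m b) (hp : ∀ a b, m ((a - m a) * (b - m b)) = 0)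
    (hV : ∀ a b, V (a * b) = V a * b + a * V b) (hD : ∀ a b, D (a * b) = D a * b + a * D b)
    (hVm : ∀ a, V (m a) = m (V a)) (hDm : ∀ a, D (m a) = m (D a))
    {K K' A B : R} (h1 : K * K' = 1) (h2 : K' * K = 1)
    (hVK : V K = -(m (K * A * K') * K)) (hDK : D K = -(m (K * B * K') * K))
    (hVB : V B = 0) (hDA : D A = B * A - A * B) : V (D K) = D (V K) := by
  have hone : ∀ W : R →+ R, (∀ a b, W (a * b) = W a * b + a * W b) → W 1 = 0 := by
    intro W hW
    have := hW 1 1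
    simpa using this
  have hinv : ∀ W : R →+ R, (∀ a b, W (a * b) = W a * b + a * W b) →
      W K' = -(K' * W K * K') := by
    intro W hW
    have h3 := hW K' K
    rw [h2, hone W hW] at h3
    have h4 : W K' * K * K' = -(K' * W K * K') := by
      rw [← neg_mul, eq_neg_of_add_eq_zero_left h3.symm]
    rwa [mul_assoc, h1, mul_one] at h4
  set P := K * A * K' with hP
  set Q := K * B * K' with hQ
  have hVQ : V Q = -(m P * Q) + Q * m P := by
    rw [hQ, hV, hV, hVB, hinv V hV, hVK]
    calc (-(m P * K) * B + K * 0) * K' + K * B * -(K' * -(m P * K) * K')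
        = -(m P * (K * B * K')) + K * B * K' * m P * (K * K') := by noncomm_ring
      _ = _ := by rw [h1, mul_one]
  have hDP : D P = -(m Q * P) + P * m Q + (Q * P - P * Q) := by
    have hc : K * (B * A - A * B) * K' = Q * P - P * Q := by
      calc K * (B * A - A * B) * K' = K * B * 1 * A * K' - K * A * 1 * B * K' := by noncomm_ring
        _ = _ := by rw [← h2, hP, hQ]; noncomm_ring
    rw [← hc, hP, hD, hD, hinv D hD, hDK, hDA]
    calc (-(m Q * K) * A + K * (B * A - A * B)) * K' + K * A * -(K' * -(m Q * K) * K')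
        = -(m Q * (K * A * K')) + K * A * K' * m Q * (K * K') + K * (B * A - A * B) * K' := by
          noncomm_ring
      _ = _ := by rw [h1, mul_one]
  -- The remaining identity follows by splitting `P` and `Q` into their two parts.
  have key : m (V Q) - m Q * m P = m (D P) - m P * m Q := by
    have e1 : V Q - D P = (m Q * m P - m P * m Q) +
        ((P - m P) * (Q - m Q) - (Q - m Q) * (P - m P)) := by
      rw [hVQ, hDP]
      noncomm_ring
    have e2 := congrArg m e1
    rw [map_sub, map_add, map_sub, map_sub, hm, hm, hp, hp, sub_zero, add_zero] at e2
    calc m (V Q) - m Q * m P = m (V Q) - m (D P) + m (D P) - m Q * m P := by abel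
      _ = _ := by rw [e2]; abel
  rw [hDK, hVK, map_neg, map_neg, hV, hD, hVm, hDm, hVK, hDK]
  calc -(m (V Q) * K + m Q * -(m P * K)) = -((m (V Q) - m Q * m P) * K) := by noncomm_ring
    _ = _ := by rw [key]; noncomm_ring

theorem flow_x (A : Ser F) : flow A (MvPolynomial.X Coord.x) = 0 := by
  simp [flow, MvPolynomial.mkDerivation_X]

theorem flow_y (A : Ser F) : flow A (MvPolynomial.X Coord.y) = 0 := by
  simp [flow, MvPolynomial.mkDerivation_X]

theorem flow_K (A : Ser F) (j i : ℕ) : flow A (MvPolynomial.X (Coord.K j i)) =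
    dx i ((-(pmul (minusPart (dress A)) dressing)).coeff (j + 1)) := by
  simp [flow, MvPolynomial.mkDerivation_X, iterate_Dx]

theorem Dx_x : (Dx : Derivation F _ (DiffPoly F)) (MvPolynomial.X Coord.x) = 1 := by
  simp [Dx, MvPolynomial.mkDerivation_X]

theorem Dx_y : (Dx : Derivation F _ (DiffPoly F)) (MvPolynomial.X Coord.y) = 0 := by
  simp [Dx, MvPolynomial.mkDerivation_X]

theorem Dx_K (j i : ℕ) : (Dx : Derivation F _ (DiffPoly F)) (MvPolynomial.X (Coord.K j i)) =
    MvPolynomial.X (Coord.K j (i + 1)) := by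
  simp [Dx, MvPolynomial.mkDerivation_X]

theorem Dx_C (a : F) : (Dx : Derivation F _ (DiffPoly F)) (MvPolynomial.C a) = 0 :=
  Derivation.map_algebraMap _ a

theorem Dx_two_y : Dx (2 * MvPolynomial.X Coord.y : DiffPoly F) = 0 := by
  rw [Derivation.leibniz, Dx_y, show (2 : DiffPoly F) = ((2 : ℕ) : DiffPoly F) by norm_num,
    Derivation.map_natCast, smul_zero, smul_zero, add_zero]

theorem dx_K (j i : ℕ) : dx i (MvPolynomial.X (Coord.K j 0) : DiffPoly F) =
    MvPolynomial.X (Coord.K j i) := by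
  induction i with
  | zero => rfl
  | succ i ih => rw [dx_succ, ih, Dx_K]

theorem derivation_eq_zero {σ R : Type*} [CommRing R] [Algebra R (MvPolynomial σ F)]
    (U : Derivation R (MvPolynomial σ F) (MvPolynomial σ F))
    (hC : ∀ a : F, U (MvPolynomial.C a) = 0) (hX : ∀ v, U (MvPolynomial.X v) = 0) : U = 0 := by
  refine Derivation.ext fun p => ?_
  rw [Derivation.zero_apply]
  induction p using MvPolynomial.induction_on with
  | C a => exact hC a
  | add p q hp hq => rw [map_add, hp, hq, add_zero]
  | mul_X p v hp => rw [Derivation.leibniz, hp, hX, smul_zero, smul_zero, add_zero]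

theorem derivation_ext_coords {σ R : Type*} [CommRing R] [Algebra R (MvPolynomial σ F)]
    {U W : Derivation R (MvPolynomial σ F) (MvPolynomial σ F)}
    (hC : ∀ a : F, U (MvPolynomial.C a) = W (MvPolynomial.C a))
    (hX : ∀ v, U (MvPolynomial.X v) = W (MvPolynomial.X v)) : U = W := by
  rw [← sub_eq_zero]
  apply derivation_eq_zero
  · intro a
    rw [Derivation.sub_apply, hC, sub_self]
  · intro v
    rw [Derivation.sub_apply, hX, sub_self]

theorem flow_Dx (A : Ser F) (b : DiffPoly F) : flow A (Dx b) = Dx (flow A b) := by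
  have : ⁅flow A, (Dx : Derivation F _ (DiffPoly F))⁆ = 0 := by
    apply derivation_eq_zero
    · intro a
      exact Derivation.map_algebraMap _ a
    · rintro (_ | _ | ⟨j, i⟩)
      · rw [Derivation.commutator_apply, Dx_x, flow_x, map_zero, Derivation.map_one_eq_zero,
          sub_zero]
      · rw [Derivation.commutator_apply, Dx_y, flow_y, map_zero, map_zero, sub_zero]
      · rw [Derivation.commutator_apply, Dx_K, flow_K, flow_K, dx_succ, sub_self]
  have h := DFunLike.congr_fun this b
  rwa [Derivation.commutator_apply, Derivation.zero_apply, sub_eq_zero] at h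

theorem Dy_Dx (b : DiffPoly F) : Dy (Dx b) = Dx (Dy b) := by
  have : ⁅(Dy : Derivation F _ (DiffPoly F)), (Dx : Derivation F _ (DiffPoly F))⁆ = 0 := by
    apply derivation_eq_zero
    · intro a
      exact Derivation.map_algebraMap _ a
    · rintro (_ | _ | ⟨j, i⟩) <;>
      simp [Derivation.commutator_apply, Dx_x, Dx_y, Dx_K, Dy, MvPolynomial.mkDerivation_X, flow_x,
        flow_y, flow_K, dx_succ]
  have h := DFunLike.congr_fun this b
  rwa [Derivation.commutator_apply, Derivation.zero_apply, sub_eq_zero] at h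

theorem minusHom_mul (a b : PDO F) : minusHom (minusHom a * minusHom b) = minusHom a * minusHom b :=
  minusPart_of_mem_deep (deep_mono (by norm_num)
    (pmul_mem_deep (minusPart_mem_deep (F := F) a) (minusPart_mem_deep (F := F) b)))

/-- The commutation of two flows on the dressing operator, read off coefficientwise. -/
theorem map_map_dressing {R S : Type*} [CommRing R] [Algebra R (DiffPoly F)] [CommRing S]
    [Algebra S (DiffPoly F)] (U : Derivation R (DiffPoly F) (DiffPoly F))
    (D : Derivation S (DiffPoly F) (DiffPoly F)) (hU : ∀ b, U (Dx b) = Dx (U b))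
    (hD : ∀ b, D (Dx b) = Dx (D b)) {A B : Ser F}
    (hUK : dressing.map U = -(pmul (minusPart (dress A)) dressing))
    (hDK : dressing.map D = -(pmul (minusPart (dress B)) dressing))
    (hUB : B.map U = 0) (hDA : A.map D = pmul B A - pmul A B) :
    (dressing.map D).map U = (dressing.map U).map D :=
  flows_commute_on_dressing minusHom (mapHom U) (mapHom D) minusHom_mul
    (minusPart_pmul_differential (F := F)) (map_pmul hU) (map_pmul hD) (map_minusPart U)
    (map_minusPart D) (K := toPDO dressing) (K' := toPDO (pinv dressing)) (A := toPDO A)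
    (B := toPDO B) dressing_pmul_pinv pinv_pmul_dressing hUK hDK hUB hDA

theorem map_flow_dressing (A : Ser F) :
    dressing.map (flow A) = -(pmul (minusPart (dress A)) dressing) := by
  have h0 : -(pmul (minusPart (dress A)) dressing) ∈ deep F 1 :=
    neg_mem (pmul_mem_deep (minusPart_mem_deep _) dressing_mem_deep)
  ext1; funext n
  rw [HahnSeries.map_coeff]
  rcases lt_trichotomy n 0 with h | rfl | h
  · rw [h0 n (by omega), dressing_mem_deep n h, map_zero]
  · rw [h0 0 (by omega), coeff_dressing_zero, Derivation.map_one_eq_zero]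
  · obtain ⟨j, hj⟩ := Int.eq_ofNat_of_zero_le (a := n - 1) (by omega)
    obtain rfl : n = (j : ℤ) + 1 := by omega
    rw [coeff_dressing_succ, flow_K, dx_zero]

/-- A derivation that differs from a flow by one which kills the fields acts in the same way on the
dressing operator. -/
theorem map_dressing_eq_of_K {R : Type*} [CommRing R] [Algebra R (DiffPoly F)]
    (U : Derivation R (DiffPoly F) (DiffPoly F)) {A : Ser F}
    (h : ∀ j, U (MvPolynomial.X (Coord.K j 0)) = flow A (MvPolynomial.X (Coord.K j 0))) :
    dressing.map U = -(pmul (minusPart (dress A)) dressing) := by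
  rw [← map_flow_dressing]
  ext1; funext n
  rw [HahnSeries.map_coeff, HahnSeries.map_coeff]
  rcases lt_trichotomy n 0 with h' | rfl | h'
  · rw [dressing_mem_deep n h', map_zero, map_zero]
  · rw [coeff_dressing_zero, Derivation.map_one_eq_zero, Derivation.map_one_eq_zero]
  · obtain ⟨j, hj⟩ := Int.eq_ofNat_of_zero_le (a := n - 1) (by omega)
    obtain rfl : n = (j : ℤ) + 1 := by omega
    rw [coeff_dressing_succ, h]

theorem Dy_C (a : F) : Dy (MvPolynomial.C a) = 0 := Derivation.map_algebraMap _ a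

theorem Dy_x : (Dy : Derivation F _ (DiffPoly F)) (MvPolynomial.X Coord.x) = 0 := by
  simp [Dy, MvPolynomial.mkDerivation_X, flow_x]

theorem Dy_y : (Dy : Derivation F _ (DiffPoly F)) (MvPolynomial.X Coord.y) = 1 := by
  simp [Dy, MvPolynomial.mkDerivation_X, flow_y]

theorem Dy_K (j i : ℕ) : (Dy : Derivation F _ (DiffPoly F)) (MvPolynomial.X (Coord.K j i)) =
    flow (op 1 2) (MvPolynomial.X (Coord.K j i)) := by
  simp [Dy, MvPolynomial.mkDerivation_X]

theorem op_one_pmul_op_one (m n : ℤ) :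
    pmul (op (1 : DiffPoly F) m) (op 1 n) = op 1 (m + n) := by
  rw [op_pmul_op_of_Dx_eq_zero _ _ _ _ (Derivation.map_one_eq_zero _), mul_one]

theorem op_pmul_op_one (u : DiffPoly F) (m n : ℤ) : pmul (op u m) (op 1 n) = op u (m + n) := by
  rw [op_pmul_op_of_Dx_eq_zero _ _ _ _ (Derivation.map_one_eq_zero _), mul_one]

theorem op_pmul_x (u : DiffPoly F) (m n : ℤ) :
    pmul (op u m) (op (MvPolynomial.X Coord.x) n) =
      op (u * MvPolynomial.X Coord.x) (m + n) + op (m • u) (m + n - 1) := by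
  ext1; funext i
  rw [HahnSeries.coeff_add, coeff_op, coeff_op]
  rcases lt_or_ge (i + m + n) 0 with h | h
  · rw [op_pmul_op_mem_deep _ _ _ _ i (by omega), if_neg (by omega), if_neg (by omega), zero_add]
  · obtain ⟨T, hT⟩ := Int.eq_ofNat_of_zero_le h
    rw [coeff_op_pmul_op _ _ _ _ i T (by omega)]
    rcases T with _ | _ | T
    · simp only [Nat.cast_zero] at hT
      rw [if_pos (by omega), if_neg (by omega)]
      simp
    · simp only [zero_add, Nat.cast_one] at hT
      rw [if_neg (by omega), if_pos (by omega)]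
      simp [Dx_x]
    · push_cast at hT
      rw [if_neg (by omega), if_neg (by omega), dx_succ', dx_succ', Dx_x,
        Derivation.map_one_eq_zero]
      simp

/-- The commutator of an operator with a convergent sum is approximated by that with the partial
sums. -/
theorem comm_adicSum_sub_mem_deep {c : ℕ → DiffPoly F} {g : ℕ → Ser F}
    (hg : ∀ k : ℕ, g k ∈ deep F ((1 * k : ℕ) : ℤ)) (hc : ∀ k, Dx (c k) = 0) {B : Ser F} {b : ℕ}
    (hB : B ∈ deep F (-b)) (M : ℕ) :
    (pmul B (adicSum c g) - pmul (adicSum c g) B) - ∑ k ∈ Finset.range (M + b),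
      pmul (op (c k) 0) (pmul B (g k) - pmul (g k) B) ∈ deep F M := by
  have h1 := adicSum_sub_mem_deep c g 1 le_rfl hg (M + b)
  have h2 := deep_mono (m := M) (by push_cast; omega) (pmul_mem_deep hB h1)
  have h3 := deep_mono (m := M) (by push_cast; omega) (pmul_mem_deep h1 hB)
  have h4 : ∑ k ∈ Finset.range (M + b), pmul (op (c k) 0) (pmul B (g k) - pmul (g k) B) =
      pmul B (∑ k ∈ Finset.range (M + b), pmul (op (c k) 0) (g k)) -
        pmul (∑ k ∈ Finset.range (M + b), pmul (op (c k) 0) (g k)) B := by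
    rw [pmul_sum, sum_pmul, ← Finset.sum_sub_distrib]
    refine Finset.sum_congr rfl fun k _ => ?_
    rw [pmul_sub, ← pmul_assoc, ← pmul_assoc, ← pmul_assoc, pmul_op_zero_comm _ (hc k)]
  have h5 := sub_mem h2 h3
  rw [pmul_sub, sub_pmul] at h5
  rw [h4]
  convert h5 using 1
  abel

theorem map_ppow {R : Type*} [CommRing R] [Algebra R (DiffPoly F)]
    {U : Derivation R (DiffPoly F) (DiffPoly F)} (hU : ∀ b, U (Dx b) = Dx (U b)) {a B : Ser F}
    (ha : a.map U = pmul B a - pmul a B) (k : ℕ) :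
    (ppow a k).map U = pmul B (ppow a k) - pmul (ppow a k) B := by
  induction k with
  | zero => rw [ppow, map_op, Derivation.map_one_eq_zero, op_zero, pmul_one, one_pmul, sub_self]
  | succ k ih => rw [ppow, map_pmul hU, ih, ha, sub_pmul, pmul_sub, pmul_assoc, pmul_assoc,
      pmul_assoc, sub_add_sub_cancel]

theorem map_ppow_eq_zero {R : Type*} [CommRing R] [Algebra R (DiffPoly F)]
    {U : Derivation R (DiffPoly F) (DiffPoly F)} (hU : ∀ b, U (Dx b) = Dx (U b)) {a : Ser F}
    (ha : a.map U = 0) (k : ℕ) : (ppow a k).map U = 0 := by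
  induction k with
  | zero => rw [ppow, map_op, Derivation.map_one_eq_zero, op_zero]
  | succ k ih => rw [ppow, map_pmul hU, ih, ha, pmul_zero, zero_pmul, add_zero]

theorem comm_ppow {a B : Ser F} (ha : pmul B a - pmul a B = op 1 0) (k : ℕ) :
    pmul B (ppow a (k + 1)) - pmul (ppow a (k + 1)) B = (k + 1) • ppow a k := by
  induction k with
  | zero => simpa [ppow, one_pmul] using ha
  | succ k ih =>
    have e : pmul B (ppow a (k + 2)) - pmul (ppow a (k + 2)) B =
        pmul (pmul B (ppow a (k + 1)) - pmul (ppow a (k + 1)) B) a +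
          pmul (ppow a (k + 1)) (pmul B a - pmul a B) := by
      rw [sub_pmul, pmul_sub]
      simp only [ppow, pmul_assoc]
      abel
    rw [e, ih, ha, pmul_one]
    have e2 : pmul ((k + 1) • ppow a k) a = (k + 1) • ppow a (k + 1) :=
      smul_mul_assoc (k + 1) (toPDO (ppow a k)) (toPDO a)
    rw [e2, ← succ_nsmul]

theorem map_op_one {R : Type*} [CommRing R] [Algebra R (DiffPoly F)]
    (U : Derivation R (DiffPoly F) (DiffPoly F)) (n : ℤ) : (op (1 : DiffPoly F) n).map U = 0 := by
  rw [map_op, Derivation.map_one_eq_zero, op_zero]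

end Flows

section Symmetry

variable {F : Type*} [CommRing F] [Algebra ℂ F]

/-! ### The flows are symmetries of the equation -/

theorem coeffDer_C {σ : Type*} (δ : Derivation ℂ F F) (a : F) :
    coeffDer δ (MvPolynomial.C a : MvPolynomial σ F) = MvPolynomial.C (δ a) := by
  classical
  ext m
  change δ (MvPolynomial.coeff m (MvPolynomial.C a)) = _
  rw [MvPolynomial.coeff_C, MvPolynomial.coeff_C]
  split_ifs <;> simp

theorem coeffDer_X {σ : Type*} (δ : Derivation ℂ F F) (v : σ) :
    coeffDer δ (MvPolynomial.X v : MvPolynomial σ F) = 0 := by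
  classical
  ext m
  change δ (MvPolynomial.coeff m (MvPolynomial.X v)) = _
  rw [MvPolynomial.coeff_X]
  split_ifs <;> simp

variable (δ : Derivation ℂ F F)

theorem Dt_C (N : ℕ) (a : F) : Dt δ N (MvPolynomial.C a) = MvPolynomial.C (δ a) := by
  have : flow (op 1 N) (MvPolynomial.C a) = 0 := Derivation.map_algebraMap _ a
  simp [Dt, coeffDer_C, this]

theorem Dt_x (N : ℕ) : Dt δ N (MvPolynomial.X Coord.x) = 0 := by
  simp [Dt, coeffDer_X, flow_x]

theorem Dt_y (N : ℕ) : Dt δ N (MvPolynomial.X Coord.y) = 0 := by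
  simp [Dt, coeffDer_X, flow_y]

theorem Dt_K (N : ℕ) (j i : ℕ) : Dt δ N (MvPolynomial.X (Coord.K j i)) =
    flow (op 1 N) (MvPolynomial.X (Coord.K j i)) := by
  simp [Dt, coeffDer_X]

theorem Dt_Dx (N : ℕ) (b : DiffPoly F) : Dt δ N (Dx b) = Dx (Dt δ N b) := by
  have : ⁅Dt δ N, (Dx : Derivation F _ (DiffPoly F)).restrictScalars ℂ⁆ = 0 := by
    apply derivation_eq_zero
    · intro a
      simp [Derivation.commutator_apply, Dt_C]
    · rintro (_ | _ | ⟨j, i⟩)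
      · simp [Derivation.commutator_apply, Dx_x, Dt_x]
      · simp [Derivation.commutator_apply, Dx_y, Dt_y]
      · simp [Derivation.commutator_apply, Dx_K, Dt_K, flow_K, dx_succ]
  have h := DFunLike.congr_fun this b
  rwa [Derivation.commutator_apply, Derivation.zero_apply, sub_eq_zero] at h

theorem const_eq_smul (c : ℂ) : const (F := F) c = c • 1 := by
  rw [const, ← MvPolynomial.algebraMap_eq, Algebra.smul_def, mul_one]
  rfl

theorem Dx_smul (c : ℂ) (b : DiffPoly F) : Dx (c • b) = c • Dx b :=
  (Dx.restrictScalars ℂ).map_smul c b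

theorem smul_op (c : ℂ) (a : DiffPoly F) (n : ℤ) : c • op a n = op (c • a) n := by
  ext1; funext i
  rw [HahnSeries.coeff_smul, coeff_op, coeff_op]
  split_ifs <;> simp

theorem smul_pmul (c : ℂ) (a b : Ser F) : pmul (c • a) b = c • pmul a b := by
  ext1; funext i
  rw [HahnSeries.coeff_smul, coeff_pmul, coeff_pmul, smul_finsum']
  · refine finsum_congr fun p => ?_
    rw [HahnSeries.coeff_smul, smul_mul_assoc, smul_comm]
  · exact pmul_support_finite a b i

theorem smul_eq_pmul (c : ℂ) (b : Ser F) : c • b = pmul (op (c • 1) 0) b := by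
  ext1; funext i
  rw [op_zero_pmul, HahnSeries.coeff_smul, smul_mul_assoc, one_mul]

theorem pmul_smul (c : ℂ) (a b : Ser F) : pmul a (c • b) = c • pmul a b := by
  have h : Dx (c • (1 : DiffPoly F)) = 0 := by
    rw [Dx_smul, Derivation.map_one_eq_zero, smul_zero]
  rw [smul_eq_pmul, smul_eq_pmul, ← pmul_assoc, pmul_op_zero_comm _ h, pmul_assoc]

theorem smul_sub_ser (c : ℂ) (a b : Ser F) : c • (a - b) = c • a - c • b := by
  rw [smul_eq_pmul, pmul_sub, ← smul_eq_pmul, ← smul_eq_pmul]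

/-- The operator `(1/N) x̂ ∂^(1-N) - t_N = (1/N) (x ∂^(1-N) + 2 y ∂^(2-N) + t₀ ∂^(-N))`. -/
def shiftOp (F : Type*) [CommRing F] [Algebra ℂ F] (t₀ : ℂ) (N : ℕ) : Ser F :=
  (N : ℂ)⁻¹ • (op (MvPolynomial.X Coord.x) (1 - N) + op (2 * MvPolynomial.X Coord.y) (2 - N) +
    op (const t₀) (-N))

theorem opE_sub (t : F) (t₀ : ℂ) (N : ℕ) (hN : N ≠ 0) :
    opE t t₀ N - op (MvPolynomial.C t) 0 = shiftOp F t₀ N := by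
  have h1 : Dx (1 : DiffPoly F) = 0 := Derivation.map_one_eq_zero _
  have h2 : op (MvPolynomial.C t : DiffPoly F) 0 = (N : ℂ)⁻¹ • op (MvPolynomial.C (N * t)) 0 := by
    rw [smul_op, map_mul, map_natCast, ← nsmul_eq_mul, ← Nat.cast_smul_eq_nsmul ℂ, smul_smul,
      inv_mul_cancel₀ (by exact_mod_cast hN), one_smul]
  unfold opE shiftOp xhat
  rw [h2, ← smul_sub_ser]
  congr 1
  simp only [add_pmul, op_pmul_op_of_Dx_eq_zero _ _ _ _ h1, mul_one]
  rw [show (-1 + (1 - (N : ℤ))) = -N by ring, show (1 + (1 - (N : ℤ))) = 2 - N by ring,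
    show ((N : ℤ) - 1 + (1 - (N : ℤ))) = 0 by ring, zero_add]
  abel

theorem shiftOp_mem_deep (t₀ : ℂ) (N : ℕ) : shiftOp F t₀ N ∈ deep F ((N : ℤ) - 2) := by
  unfold shiftOp
  have h1 := deep_mono (m := (N : ℤ) - 2) (by omega)
    (op_mem_deep (MvPolynomial.X Coord.x : DiffPoly F) (1 - N))
  have h2 := deep_mono (m := (N : ℤ) - 2) (by omega)
    (op_mem_deep (2 * MvPolynomial.X Coord.y : DiffPoly F) (2 - N))
  have h3 := deep_mono (m := (N : ℤ) - 2) (by omega) (op_mem_deep (const t₀ : DiffPoly F) (-N))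
  intro i hi
  rw [HahnSeries.coeff_smul, add_mem (add_mem h1 h2) h3 i hi, smul_zero]

theorem ppow_shiftOp_mem_deep (t₀ : ℂ) {N : ℕ} (hN : 3 ≤ N) (k : ℕ) :
    ppow (shiftOp F t₀ N) k ∈ deep F (((N - 2) * k : ℕ) : ℤ) :=
  ppow_mem_deep (by
    rw [show ((N - 2 : ℕ) : ℤ) = (N : ℤ) - 2 by omega]
    exact shiftOp_mem_deep t₀ N) k

theorem funOp_eq (t : F) (t₀ : ℂ) (N : ℕ) (hN : N ≠ 0) (h : F) :
    funOp δ t t₀ N h = adicSum (taylorCoeff δ h) (ppow (shiftOp F t₀ N)) := by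
  rw [funOp, opE_sub t t₀ N hN]

theorem C_smul_complex {σ : Type*} (c : ℂ) (a : F) :
    (MvPolynomial.C (c • a) : MvPolynomial σ F) = c • MvPolynomial.C a := by
  classical
  ext m
  rw [MvPolynomial.coeff_smul, MvPolynomial.coeff_C, MvPolynomial.coeff_C]
  split_ifs <;> simp

/-- The commutation relation `[∂ⁿ, X] = (n/N) ∂^(n-N)` for `X = (1/N) x̂ ∂^(1-N) - t_N`. -/
theorem op_comm_shiftOp (t₀ : ℂ) (N : ℕ) (n : ℤ) :
    pmul (op 1 n) (shiftOp F t₀ N) - pmul (shiftOp F t₀ N) (op 1 n) =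
      (N : ℂ)⁻¹ • op ((n : ℂ) • (1 : DiffPoly F)) (n - N) := by
  have hc : Dx (const t₀ : DiffPoly F) = 0 := Dx_C _
  unfold shiftOp
  rw [pmul_smul, smul_pmul, ← smul_sub_ser]
  congr 1
  simp only [pmul_add, add_pmul, op_pmul_op_one, op_pmul_x]
  rw [op_pmul_op_of_Dx_eq_zero _ _ _ _ Dx_two_y, op_pmul_op_of_Dx_eq_zero _ _ _ _ hc]
  rw [show n + (1 - (N : ℤ)) - 1 = n - N by ring, add_comm n (1 - (N : ℤ)),
    add_comm n (2 - (N : ℤ)), add_comm n (-(N : ℤ)), one_mul, one_mul, one_mul,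
    ← Int.cast_smul_eq_zsmul ℂ]
  abel

theorem Dx_taylorCoeff (h : F) (k : ℕ) : Dx (taylorCoeff δ h k) = 0 := Dx_C _

theorem coeffDer_taylorCoeff (N : ℕ) (h : F) (k : ℕ) :
    Dt δ N (taylorCoeff δ h k) = ((k + 1 : ℕ) : ℂ) • taylorCoeff δ h (k + 1) := by
  unfold taylorCoeff
  rw [Dt_C, δ.map_smul, ← C_smul_complex, smul_smul, Function.iterate_succ', Function.comp_apply]
  congr 2
  have : ((k + 1 : ℕ) : ℂ) ≠ 0 := by exact_mod_cast k.succ_ne_zero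
  have : (k.factorial : ℂ) ≠ 0 := by exact_mod_cast k.factorial_ne_zero
  rw [Nat.factorial_succ]
  push_cast
  field_simp

theorem map_smul_ser (U : Derivation ℂ (DiffPoly F) (DiffPoly F)) (c : ℂ) (a : Ser F) :
    (c • a).map U = c • a.map U := by
  ext1; funext n
  simp

theorem ppow_shiftOp_mem_deep_one (t₀ : ℂ) {N : ℕ} (hN : 3 ≤ N) (k : ℕ) :
    ppow (shiftOp F t₀ N) k ∈ deep F ((1 * k : ℕ) : ℤ) :=
  ppow_mem_deep' (deep_mono (by omega) (shiftOp_mem_deep t₀ N)) k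

theorem map_two (U : Derivation ℂ (DiffPoly F) (DiffPoly F)) : U 2 = 0 :=
  U.map_natCast 2

/-- `h(∂_E)` satisfies the evolution equation `∂A/∂y = [∂², A]`. -/
theorem map_Dy_funOp (t : F) (t₀ : ℂ) (N : ℕ) (hN : 3 ≤ N) (h : F) :
    (funOp δ t t₀ N h).map (Dy.restrictScalars ℂ) =
      pmul (op 1 2) (funOp δ t t₀ N h) - pmul (funOp δ t t₀ N h) (op 1 2) := by
  have hD : ∀ b, (Dy.restrictScalars ℂ) (Dx b) = Dx ((Dy (F := F).restrictScalars ℂ) b) := Dy_Dx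
  have hX : (shiftOp F t₀ N).map (Dy.restrictScalars ℂ) =
      pmul (op 1 2) (shiftOp F t₀ N) - pmul (shiftOp F t₀ N) (op 1 2) := by
    rw [op_comm_shiftOp, shiftOp, map_smul_ser]
    congr 1
    rw [map_add_ser, map_add_ser, map_op, map_op, map_op]
    have e1 : (Dy (F := F).restrictScalars ℂ) (MvPolynomial.X Coord.x) = 0 := Dy_x
    have e2 : (Dy (F := F).restrictScalars ℂ) (MvPolynomial.X Coord.y) = 1 := Dy_y
    have e3 : (Dy (F := F).restrictScalars ℂ) (const t₀) = 0 := Dy_C _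
    have e4 : ((2 : ℤ) : ℂ) • (1 : DiffPoly F) = 2 := by
      rw [Algebra.smul_def, mul_one, Int.cast_ofNat, map_ofNat]
    rw [e1, e3, Derivation.leibniz, e2, map_two, e4]
    simp
  rw [funOp_eq δ t t₀ N (by omega)]
  have hc : ∀ k, (Dy.restrictScalars ℂ) (taylorCoeff δ h k) = 0 := fun k => Dy_C _
  refine eq_of_forall_sub_mem_deep fun m => ?_
  have h1 := comm_adicSum_sub_mem_deep (ppow_shiftOp_mem_deep_one t₀ hN) (Dx_taylorCoeff δ h)
    (B := op 1 2) (b := 2) (op_mem_deep _ _) m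
  have h2 := map_mem_deep (Dy.restrictScalars ℂ) (adicSum_sub_mem_deep (taylorCoeff δ h) _ 1 le_rfl
    (ppow_shiftOp_mem_deep_one (F := F) t₀ hN) (m + 2))
  have h3 := sub_mem (deep_mono (m := m) (by push_cast; omega) h2) h1
  have e : (∑ k ∈ Finset.range (m + 2), pmul (op (taylorCoeff δ h k) 0)
      (ppow (shiftOp F t₀ N) k)).map (Dy.restrictScalars ℂ) = ∑ k ∈ Finset.range (m + 2),
      pmul (op (taylorCoeff δ h k) 0) (pmul (op 1 2) (ppow (shiftOp F t₀ N) k) -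
        pmul (ppow (shiftOp F t₀ N) k) (op 1 2)) := by
    have := map_sum (mapHom (Dy (F := F).restrictScalars ℂ)) (fun k =>
      toPDO (pmul (op (taylorCoeff δ h k) 0) (ppow (shiftOp F t₀ N) k))) (Finset.range (m + 2))
    refine this.trans (Finset.sum_congr rfl fun k _ => ?_)
    refine (map_pmul hD _ _).trans ?_
    rw [map_op, hc, op_zero, zero_pmul, zero_add, map_ppow hD hX]
  rw [map_sub_ser, e] at h3
  convert h3 using 1
  abel

/-- `h(∂_E)` satisfies the evolution equation `∂A/∂t_N = [∂^N, A]`. -/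
theorem map_Dt_funOp (t : F) (t₀ : ℂ) (N : ℕ) (hN : 3 ≤ N) (h : F) :
    (funOp δ t t₀ N h).map (Dt δ N) =
      pmul (op 1 N) (funOp δ t t₀ N h) - pmul (funOp δ t t₀ N h) (op 1 N) := by
  have hX : (shiftOp F t₀ N).map (Dt δ N) = 0 := by
    have e3 : Dt δ N (const t₀ : DiffPoly F) = 0 := by
      rw [const_eq_smul, (Dt δ N).map_smul, Derivation.map_one_eq_zero, smul_zero]
    rw [shiftOp, map_smul_ser, map_add_ser, map_add_ser, map_op, map_op, map_op, Dt_x, e3,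
      Derivation.leibniz, Dt_y, map_two]
    simp
  have hcomm : pmul (op 1 N) (shiftOp F t₀ N) - pmul (shiftOp F t₀ N) (op 1 N) = op 1 0 := by
    rw [op_comm_shiftOp, smul_op, smul_smul, sub_self, Int.cast_natCast,
      inv_mul_cancel₀ (by exact_mod_cast (by omega : N ≠ 0)), one_smul]
  rw [funOp_eq δ t t₀ N (by omega), map_adicSum]
  have hz : ∀ k, (ppow (shiftOp F t₀ N) k).map (Dt δ N) = 0 := map_ppow_eq_zero (Dt_Dx δ N) hX
  refine eq_of_forall_sub_mem_deep fun m => ?_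
  have h1 := comm_adicSum_sub_mem_deep (ppow_shiftOp_mem_deep_one t₀ hN) (Dx_taylorCoeff δ h)
    (B := op 1 N) (b := N) (op_mem_deep _ _) m
  have h2 := adicSum_sub_mem_deep (fun k => Dt δ N (taylorCoeff δ h k)) _ 1 le_rfl
    (ppow_shiftOp_mem_deep_one (F := F) t₀ hN) (m + (N - 1))
  have h0 : adicSum (taylorCoeff δ h) (fun k => (ppow (shiftOp F t₀ N) k).map (Dt δ N)) = 0 := by
    ext1; funext n
    simp [adicSum, coeff_ofCoeffs, hz]
  have h3 := sub_mem (deep_mono (m := m) (by push_cast; omega) h2) h1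
  have e : ∑ k ∈ Finset.range (m + (N - 1)), pmul (op (Dt δ N (taylorCoeff δ h k)) 0)
      (ppow (shiftOp F t₀ N) k) = ∑ k ∈ Finset.range (m + N),
      pmul (op (taylorCoeff δ h k) 0) (pmul (op 1 N) (ppow (shiftOp F t₀ N) k) -
        pmul (ppow (shiftOp F t₀ N) k) (op 1 N)) := by
    rw [show m + N = m + (N - 1) + 1 by omega, Finset.sum_range_succ']
    simp only [ppow, pmul_one, one_pmul, sub_self, pmul_zero, add_zero]
    refine Finset.sum_congr rfl fun k _ => ?_
    have := comm_ppow hcomm k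
    rw [ppow] at this
    rw [this, coeffDer_taylorCoeff]
    ext1; funext i
    rw [op_zero_pmul, op_zero_pmul, HahnSeries.coeff_smul, Nat.cast_smul_eq_nsmul,
      smul_mul_assoc, mul_smul_comm]
  rw [e] at h3
  rw [h0, add_zero]
  convert h3 using 1
  abel

/-- An evolution equation `∂A = [∂ⁿ, A]` is preserved under multiplication by powers of `∂`. -/
theorem map_pmul_op_one {D : Derivation ℂ (DiffPoly F) (DiffPoly F)}
    (hD : ∀ b, D (Dx b) = Dx (D b)) {n : ℤ} {A : Ser F}
    (hA : A.map D = pmul (op 1 n) A - pmul A (op 1 n)) (α : ℤ) :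
    (pmul A (op 1 α)).map D =
      pmul (op 1 n) (pmul A (op 1 α)) - pmul (pmul A (op 1 α)) (op 1 n) := by
  rw [map_pmul hD, hA, map_op_one, pmul_zero, add_zero, sub_pmul, pmul_assoc, pmul_assoc,
    pmul_assoc, op_one_pmul_op_one, op_one_pmul_op_one, add_comm n α]

/-- A flow commutes with the evolution along `∂ⁿ` as soon as its generator `A` satisfies the
evolution equation `∂A = [∂ⁿ, A]`. -/
theorem flow_comm_of_evolution {A : Ser F} {D : Derivation ℂ (DiffPoly F) (DiffPoly F)}
    (hD : ∀ b, D (Dx b) = Dx (D b)) {n : ℤ}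
    (hK : ∀ j, D (MvPolynomial.X (Coord.K j 0)) = flow (op 1 n) (MvPolynomial.X (Coord.K j 0)))
    (hC : ∀ a : F, ∃ b : F, D (MvPolynomial.C a) = MvPolynomial.C b)
    (hx : ∃ b : F, D (MvPolynomial.X Coord.x) = MvPolynomial.C b)
    (hy : ∃ b : F, D (MvPolynomial.X Coord.y) = MvPolynomial.C b)
    (hA : A.map D = pmul (op 1 n) A - pmul A (op 1 n)) :
    ⁅(flow A).restrictScalars ℂ, D⁆ = 0 := by
  have hf : ∀ a : F, flow A (MvPolynomial.C a) = 0 := fun a => Derivation.map_algebraMap _ a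
  apply derivation_eq_zero
  · intro a
    obtain ⟨b, hb⟩ := hC a
    simp [Derivation.commutator_apply, hf, hb]
  · rintro (_ | _ | ⟨j, i⟩)
    · obtain ⟨b, hb⟩ := hx
      simp [Derivation.commutator_apply, flow_x, hb, hf]
    · obtain ⟨b, hb⟩ := hy
      simp [Derivation.commutator_apply, flow_y, hb, hf]
    · have h1 := map_map_dressing (flow A) D (flow_Dx A) hD (map_flow_dressing A)
        (map_dressing_eq_of_K D hK) (map_op_one _ n) hA
      have h2 := congrArg (fun s => s.coeff ((j : ℤ) + 1)) h1
      simp only [HahnSeries.map_coeff, coeff_dressing_succ] at h2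
      rw [Derivation.commutator_apply, Derivation.restrictScalars_apply,
        Derivation.restrictScalars_apply, ← dx_K, map_dx hD, map_dx (flow_Dx A),
        map_dx (flow_Dx A), map_dx hD, h2, sub_self]

/-- All flows `V^N(α, h)` are symmetries. -/
theorem isKPSymmetry_V (t : F) (t₀ : ℂ) (N : ℕ) (hN : 3 ≤ N) (α : ℤ) (h : F) :
    IsKPSymmetry δ N (V δ t t₀ N α h) := by
  have hf : ∀ (A : Ser F) (a : F), flow A (MvPolynomial.C a) = 0 := fun A a =>
    Derivation.map_algebraMap _ a
  refine ⟨fun a => hf _ a, flow_x _, flow_y _, ?_, ?_, ?_⟩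
  · refine Derivation.ext fun b => ?_
    rw [Derivation.commutator_apply, Derivation.zero_apply, sub_eq_zero]
    exact flow_Dx _ b
  · have hD : ∀ b, (Dy.restrictScalars ℂ) (Dx b) = Dx ((Dy (F := F).restrictScalars ℂ) b) := Dy_Dx
    have hA := map_pmul_op_one hD (map_Dy_funOp δ t t₀ N hN h) α
    refine flow_comm_of_evolution hD (fun j => ?_) (fun a => ⟨0, ?_⟩) ⟨0, ?_⟩ ⟨1, ?_⟩ hA
    · exact Dy_K j 0
    · simp
    · simp [Dy_x]
    · simp [Dy_y]
  · have hA := map_pmul_op_one (Dt_Dx δ N) (map_Dt_funOp δ t t₀ N hN h) α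
    refine flow_comm_of_evolution (Dt_Dx δ N) (fun j => Dt_K δ N j 0)
      (fun a => ⟨δ a, Dt_C δ N a⟩) ⟨0, ?_⟩ ⟨0, ?_⟩ hA
    · simp [Dt_x]
    · simp [Dt_y]

end Symmetry

section Residue

variable {F : Type*} [CommRing F]

/-! ### Residues and the Baker-Akhiezer functions -/

/-- The top coefficient of a product is the product of the top coefficients. -/
theorem coeff_pmul_top {A B : ℤ} {a b : Ser F} (ha : a ∈ deep F A) (hb : b ∈ deep F B) :
    (pmul a b).coeff (A + B) = a.coeff A * b.coeff B := by
  rw [coeff_pmul, finsum_eq_single _ ((A, 0) : ℤ × ℕ)]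
  · simp
  · rintro ⟨i, k⟩ hne
    by_contra hp
    obtain ⟨h1, h2⟩ := pmul_support ha hb (A + B) hp
    simp only at h1 h2
    exact hne (by rw [show i = A by omega, show k = 0 by omega])

theorem mem_deep_succ {a : Ser F} {m : ℤ} (ha : a ∈ deep F m) (h : a.coeff m = 0) :
    a ∈ deep F (m + 1) := by
  intro i hi
  rcases (show i < m ∨ i = m by omega) with h' | rfl
  · exact ha i h'
  · exact h

theorem comm_mem_deep {A B : ℤ} {a b : Ser F} (ha : a ∈ deep F A) (hb : b ∈ deep F B) :
    pmul a b - pmul b a ∈ deep F (A + B + 1) := by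
  apply mem_deep_succ
  · exact sub_mem (pmul_mem_deep ha hb) (by rw [add_comm A]; exact pmul_mem_deep hb ha)
  · have h := coeff_pmul_top hb ha
    rw [add_comm B] at h
    rw [HahnSeries.coeff_sub, coeff_pmul_top ha hb, h, mul_comm, sub_self]

/-- The value of the flow of `A` on `w` is twice the residue of the dressed operator. -/
theorem flow_w (A : Ser F) : flow A w = 2 * (dress A).coeff 1 := by
  have h2 : flow A (-2 : DiffPoly F) = 0 := by
    have := (flow A).map_intCast (-2)
    rwa [Int.cast_neg, Int.cast_ofNat] at this
  have h1 : (pmul (minusPart (dress A)) dressing).coeff 1 = (dress A).coeff 1 := by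
    have := coeff_pmul_top (minusPart_mem_deep (dress A)) (dressing_mem_deep (F := F))
    rw [add_zero] at this
    rw [this, coeff_dressing_zero, mul_one, coeff_minusPart, if_pos le_rfl]
  rw [w, Derivation.leibniz, h2, smul_zero, add_zero, flow_K, dx_zero, Nat.cast_zero, zero_add,
    HahnSeries.coeff_neg, h1, smul_eq_mul]
  ring

theorem mul_mem_deep {A B : ℤ} {a b : Ser F} (ha : a ∈ deep F A) (hb : b ∈ deep F B) :
    a * b ∈ deep F (A + B) := by
  intro n hn
  rw [HahnSeries.coeff_mul]
  refine Finset.sum_eq_zero fun p hp => ?_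
  rw [Finset.mem_antidiagonal] at hp
  rcases lt_or_ge p.1 A with h | h
  · rw [ha _ h, zero_mul]
  · rw [hb _ (by omega), mul_zero]

theorem coeff_op_mul (u : DiffPoly F) (m : ℤ) (s : Ser F) (n : ℤ) :
    (op u m * s).coeff n = u * s.coeff (n + m) := by
  have := HahnSeries.coeff_single_mul_add (r := u) (x := s) (a := n + m) (b := -m)
  rwa [add_neg_cancel_right] at this

theorem op_mul_op (u v : DiffPoly F) (m n : ℤ) : op u m * op v n = op (u * v) (m + n) := by
  rw [op, op, HahnSeries.single_mul_single, op, neg_add]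

theorem pmul_op_one (a : Ser F) (m : ℤ) : pmul a (op 1 m) = op 1 m * a := by
  ext1; funext n
  refine op_induction (P := fun a => (pmul a (op 1 m)).coeff n = (op 1 m * a).coeff n)
    (fun a a' h h' => ?_) (fun u i => ?_) ⟨n + m + 1, fun a ha => ?_⟩ a
  · rw [add_pmul, mul_add, HahnSeries.coeff_add, HahnSeries.coeff_add, h, h']
  · rw [op_pmul_op_one, op_mul_op, one_mul, add_comm i]
  · rw [pmul_mem_deep ha (op_mem_deep 1 m) n (by omega),
      mul_mem_deep (op_mem_deep 1 m) ha n (by omega)]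

/-- The symbol of the conjugate operator, as an operator acting on exponentials `e^{-xλ}`. -/
def starSymbol (a : Ser F) : Ser F := ofCoeffs fun n => (-1) ^ n * (conj a).coeff n

theorem coeff_starSymbol (a : Ser F) (n : ℕ) : (starSymbol a).coeff n =
    (-1) ^ n * ∑ m ∈ Finset.range (n + 1), (-1) ^ m *
      (Ring.choose (-(m : ℤ)) (n - m) • dx (n - m) (a.coeff m)) := by
  rw [starSymbol, coeff_ofCoeffs, if_pos (by omega), Int.toNat_natCast, conj, coeff_ofCoeffs,
    if_pos (by omega), Int.toNat_natCast]
  congr 1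
  refine Finset.sum_congr rfl fun m hm => ?_
  rw [Finset.mem_range] at hm
  rw [coeff_op_pmul_op _ _ _ _ _ (n - m) (by omega), one_mul]

theorem starSymbol_mem_deep {a : Ser F} {M : ℕ} (ha : a ∈ deep F M) :
    starSymbol a ∈ deep F M := by
  intro i hi
  rcases lt_or_ge i 0 with h | h
  · exact ofCoeffs_mem_deep _ i h
  · obtain ⟨n, rfl⟩ := Int.eq_ofNat_of_zero_le h
    rw [coeff_starSymbol, Finset.sum_eq_zero, mul_zero]
    intro m hm
    rw [Finset.mem_range] at hm
    rw [ha m (by omega), map_zero, smul_zero, mul_zero]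

theorem starSymbol_add (a b : Ser F) : starSymbol (a + b) = starSymbol a + starSymbol b := by
  ext1; funext i
  rw [HahnSeries.coeff_add]
  rcases lt_or_ge i 0 with h | h
  · have : ∀ c : Ser F, (starSymbol c).coeff i = 0 := fun c => ofCoeffs_mem_deep _ i h
    rw [this, this, this, add_zero]
  · obtain ⟨n, rfl⟩ := Int.eq_ofNat_of_zero_le h
    rw [coeff_starSymbol, coeff_starSymbol, coeff_starSymbol, ← mul_add,
      ← Finset.sum_add_distrib]
    congr 1
    refine Finset.sum_congr rfl fun m _ => ?_
    rw [HahnSeries.coeff_add, map_add, smul_add, mul_add]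

/-- The residue of a product of operators is the residue of the product of their actions on
`e^{xλ}` and, after conjugation, on `e^{-xλ}`. -/
theorem coeff_pmul_eq_coeff_mul_starSymbol (a : Ser F) {b : Ser F} (hb : b ∈ deep F 0) :
    (pmul a b).coeff 1 = (a * starSymbol b).coeff 1 := by
  refine op_induction (P := fun a => (pmul a b).coeff 1 = (a * starSymbol b).coeff 1)
    (fun a a' h h' => ?_) (fun u i => ?_) ⟨2, fun a ha => ?_⟩ a
  · rw [add_pmul, add_mul, HahnSeries.coeff_add, HahnSeries.coeff_add, h, h']
  · refine deep_induction (P := fun b => (pmul (op u i) b).coeff 1 =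
      (op u i * starSymbol b).coeff 1) 0
      (fun b b' h h' => ?_) (fun v j hj => ?_) ⟨((2 + i).toNat : ℤ), fun b hb => ?_⟩ hb
    · rw [pmul_add, starSymbol_add, mul_add, HahnSeries.coeff_add, HahnSeries.coeff_add, h, h']
    · obtain ⟨m, hm⟩ := Int.eq_ofNat_of_zero_le (a := -j) (by omega)
      obtain rfl : j = -(m : ℤ) := by omega
      rw [coeff_op_mul]
      rcases lt_or_ge (1 + i) m with h | h
      · have hv : starSymbol (op v (-(m : ℤ))) ∈ deep F m :=
          starSymbol_mem_deep (by simpa using op_mem_deep v (-(m : ℤ)))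
        rw [hv _ h, mul_zero, op_pmul_op_mem_deep _ _ _ _ 1 (by omega)]
      · obtain ⟨k, hk⟩ := Int.eq_ofNat_of_zero_le (a := 1 + i - m) (by omega)
        rw [coeff_op_pmul_op _ _ _ _ 1 k (by omega),
          show 1 + i = ((k + m : ℕ) : ℤ) by push_cast; omega,
          coeff_starSymbol, Finset.sum_eq_single_of_mem m (by simp)]
        · rw [coeff_op, neg_neg, if_pos rfl, Nat.add_sub_cancel, Ring.choose_neg,
            show (m : ℤ) + k - 1 = i by omega, pow_add, Units.smul_def, Int.coe_negOnePow_natCast]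
          have e : ((-1 : DiffPoly F) ^ m * (-1) ^ m) = 1 := by
            rw [← mul_pow, neg_one_mul, neg_neg, one_pow]
          have e' : ((-1 : DiffPoly F) ^ k * (-1) ^ k) = 1 := by
            rw [← mul_pow, neg_one_mul, neg_neg, one_pow]
          simp only [zsmul_eq_mul, smul_eq_mul, Int.cast_mul, Int.cast_pow, Int.cast_neg,
            Int.cast_one]
          linear_combination (-((-1 : DiffPoly F) ^ k * (-1) ^ k *
            ((Ring.choose i k : ℤ) : DiffPoly F) * u * (dx k) v)) * e -
            (((Ring.choose i k : ℤ) : DiffPoly F) * u * (dx k) v) * e'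
        · intro m' _ hm'
          rw [coeff_op, if_neg (by omega), map_zero, smul_zero, mul_zero]
    · rw [pmul_mem_deep (op_mem_deep u i) hb 1 (by omega),
        mul_mem_deep (op_mem_deep u i) (starSymbol_mem_deep hb) 1 (by omega)]
  · rw [pmul_mem_deep ha hb 1 (by norm_num), mul_mem_deep ha
      (starSymbol_mem_deep (M := 0) (by simpa using hb)) 1 (by norm_num)]

theorem bakerStar_eq : bakerStar = starSymbol (pinv (dressing (F := F))) := rfl

theorem pmul_adicSum {a : Ser F} (ha : a ∈ deep F 0) {c : ℕ → DiffPoly F} (hc : ∀ k, Dx (c k) = 0)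
    {g : ℕ → Ser F} (hg : ∀ k : ℕ, g k ∈ deep F ((1 * k : ℕ) : ℤ)) :
    pmul a (adicSum c g) = adicSum c fun k => pmul a (g k) := by
  refine eq_of_forall_sub_mem_deep fun m => ?_
  have h1 := pmul_mem_deep ha (adicSum_sub_mem_deep c g 1 le_rfl hg m)
  have h2 := adicSum_sub_mem_deep c (fun k => pmul a (g k)) 1 le_rfl (fun k => by
    have := pmul_mem_deep ha (hg k)
    rwa [zero_add] at this) m
  have h3 := sub_mem h1 (by rwa [zero_add])
  rw [one_mul, zero_add] at h3
  convert h3 using 1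
  rw [pmul_sub, pmul_sum]
  have e : ∑ k ∈ Finset.range m, pmul a (pmul (op (c k) 0) (g k)) =
      ∑ k ∈ Finset.range m, pmul (op (c k) 0) (pmul a (g k)) :=
    Finset.sum_congr rfl fun k _ => by
      rw [← pmul_assoc, ← pmul_assoc, pmul_op_zero_comm _ (hc k)]
  rw [e]
  abel

theorem euler_add (a b : Ser F) : euler (a + b) = euler a + euler b := by
  ext1; funext n
  simp [euler]

theorem euler_op (u : DiffPoly F) (m : ℤ) : euler (op u m) = op (m • u) m := by
  ext1; funext n
  change -n • (op u m).coeff n = _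
  rw [coeff_op, coeff_op]
  split_ifs with h
  · rw [h, neg_neg]
  · rw [smul_zero]

theorem euler_mem_deep {a : Ser F} {m : ℤ} (ha : a ∈ deep F m) : euler a ∈ deep F m := by
  intro i hi
  change -i • a.coeff i = 0
  rw [ha i hi, smul_zero]

end Residue

section ResidueFormula

variable {F : Type*} [CommRing F] [Algebra ℂ F]

theorem Dx_const (c : ℂ) : Dx (const c : DiffPoly F) = 0 := Dx_C _

theorem shiftE_eq (t₀ : ℂ) (N : ℕ) (b : Ser F) : shiftE t₀ N b =
    (N : ℂ)⁻¹ • (op 1 (-N) * euler b + (op (2 * MvPolynomial.X Coord.y) (2 - N) +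
      op (MvPolynomial.X Coord.x) (1 - N) + op (const t₀) (-N)) * b) := by
  simp only [shiftE, op, neg_sub, neg_neg]

theorem smul_add_ser (c : ℂ) (a b : Ser F) : c • (a + b) = c • a + c • b := by
  rw [smul_eq_pmul, pmul_add, ← smul_eq_pmul, ← smul_eq_pmul]

theorem smul_mem_deep (c : ℂ) {a : Ser F} {m : ℤ} (ha : a ∈ deep F m) : c • a ∈ deep F m := by
  intro i hi
  rw [HahnSeries.coeff_smul, ha i hi, smul_zero]

theorem shiftE_add (t₀ : ℂ) (N : ℕ) (a b : Ser F) :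
    shiftE t₀ N (a + b) = shiftE t₀ N a + shiftE t₀ N b := by
  rw [shiftE_eq, shiftE_eq, shiftE_eq, ← smul_add_ser, euler_add]
  congr 1
  ring

theorem shiftE_mem_deep (t₀ : ℂ) (N : ℕ) {a : Ser F} {m : ℤ} (ha : a ∈ deep F m) :
    shiftE t₀ N a ∈ deep F (m + (N - 2)) := by
  rw [shiftE_eq]
  refine smul_mem_deep _ (add_mem ?_ ?_)
  · exact deep_mono (by omega) (mul_mem_deep (op_mem_deep 1 _) (euler_mem_deep ha))
  · rw [add_mul, add_mul]
    refine add_mem (add_mem ?_ ?_) ?_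
    · exact deep_mono (by omega) (mul_mem_deep (op_mem_deep _ _) ha)
    · exact deep_mono (by omega) (mul_mem_deep (op_mem_deep _ _) ha)
    · exact deep_mono (by omega) (mul_mem_deep (op_mem_deep _ _) ha)

theorem shiftE_op (t₀ : ℂ) (N : ℕ) (u : DiffPoly F) (m : ℤ) : shiftE t₀ N (op u m) =
    (N : ℂ)⁻¹ • (op (2 * MvPolynomial.X Coord.y * u) (m + 2 - N) +
      op (MvPolynomial.X Coord.x * u) (m + 1 - N) + op (m • u + t₀ • u) (m - N)) := by
  rw [shiftE_eq, euler_op, add_mul, add_mul, op_mul_op, op_mul_op, op_mul_op, op_mul_op, one_mul,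
    const_eq_smul, smul_mul_assoc, one_mul, op_add]
  rw [show -(N : ℤ) + m = m - N by ring, show 2 - (N : ℤ) + m = m + 2 - N by ring,
    show 1 - (N : ℤ) + m = m + 1 - N by ring]
  congr 1
  abel

/-- Multiplication by `(1/N) x̂ ∂^(1-N) - t_N` from the right corresponds, on symbols, to the
action of `∂_E - t_N`. -/
theorem pmul_shiftOp (t₀ : ℂ) (N : ℕ) (b : Ser F) :
    pmul b (shiftOp F t₀ N) = shiftE t₀ N b := by
  ext1; funext n
  refine op_induction (P := fun b => (pmul b (shiftOp F t₀ N)).coeff n = (shiftE t₀ N b).coeff n)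
    (fun a a' h h' => ?_) (fun u m => ?_) ⟨n + 2 - N + 1, fun a ha => ?_⟩ b
  · rw [add_pmul, shiftE_add, HahnSeries.coeff_add, HahnSeries.coeff_add, h, h']
  · rw [shiftOp, pmul_smul, shiftE_op, pmul_add, pmul_add, op_pmul_x,
      op_pmul_op_of_Dx_eq_zero _ _ _ _ Dx_two_y,
      op_pmul_op_of_Dx_eq_zero _ _ _ _ (Dx_const t₀), const_eq_smul,
      mul_smul_comm, mul_one, op_add, mul_comm u, mul_comm u,
      show m + (1 - (N : ℤ)) - 1 = m - N by ring, show m + (1 - (N : ℤ)) = m + 1 - N by ring,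
      show m + (2 - (N : ℤ)) = m + 2 - N by ring, show m + -(N : ℤ) = m - N by ring]
    congr 2
    abel
  · rw [pmul_mem_deep ha (shiftOp_mem_deep t₀ N) n (by omega), shiftE_mem_deep t₀ N ha n (by omega)]

theorem pmul_ppow_shiftOp (t₀ : ℂ) (N : ℕ) (b : Ser F) (k : ℕ) :
    pmul b (ppow (shiftOp F t₀ N) k) = (shiftE t₀ N)^[k] b := by
  induction k with
  | zero => exact pmul_one b
  | succ k ih => rw [ppow, ← pmul_assoc, ih, pmul_shiftOp, Function.iterate_succ_apply']

/-- The residue formula `V^N(α, h) w = 2 res_λ λ^α [h(∂_E) φ] φ^*`. -/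
theorem V_w_eq_residueForm (δ : Derivation ℂ F F) (t : F) (t₀ : ℂ) (N : ℕ) (hN : 3 ≤ N) (α : ℤ)
    (h : F) : V δ t t₀ N α h w = residueForm δ t₀ N α h := by
  have h1 : pmul dressing (funOp δ t t₀ N h) = funBaker δ t₀ N h := by
    rw [funOp_eq δ t t₀ N (by omega), pmul_adicSum dressing_mem_deep (Dx_taylorCoeff δ h)
      (ppow_shiftOp_mem_deep_one t₀ hN), funBaker]
    simp only [pmul_ppow_shiftOp]
    rfl
  refine (flow_w _).trans ?_
  rw [residueForm, dress, coeff_pmul_eq_coeff_mul_starSymbol _ (pinv_mem_deep _), ← bakerStar_eq,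
    ← pmul_assoc, h1, pmul_op_one]
  rfl

end ResidueFormula

section DressedResidue

variable {F : Type*} [CommRing F]

/-! ### Residues of dressed operators -/

/-- The residue of the dressed operator `K Z K⁻¹`. -/
def res (Z : Ser F) : DiffPoly F := (dress Z).coeff 1

theorem flow_w_eq_res (A : Ser F) : flow A w = 2 * res A := flow_w A

theorem res_add (a b : Ser F) : res (a + b) = res a + res b := by
  rw [res, dress, pmul_add, add_pmul, HahnSeries.coeff_add]
  rfl

theorem res_sum {ι : Type*} (s : Finset ι) (a : ι → Ser F) :
    res (∑ i ∈ s, a i) = ∑ i ∈ s, res (a i) :=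
  map_sum (AddMonoidHom.mk' (res (F := F)) res_add) a s

theorem res_op_zero_pmul (c : DiffPoly F) (hc : Dx c = 0) (Z : Ser F) :
    res (pmul (op c 0) Z) = c * res Z := by
  rw [res, dress, ← pmul_assoc, pmul_op_zero_comm c hc, pmul_assoc, pmul_assoc, op_zero_pmul,
    ← pmul_assoc]
  rfl

theorem coeff_pinv_dressing_zero : (pinv (dressing (F := F))).coeff 0 = 1 := by
  have h := coeff_pmul_top (dressing_mem_deep (F := F)) (pinv_mem_deep dressing)
  rw [dressing_pmul_pinv, coeff_dressing_zero, zero_add, one_mul] at h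
  rw [← h]
  simp

theorem dress_eq (Z : Ser F) :
    dress Z = Z + pmul (pmul dressing Z - pmul Z dressing) (pinv dressing) := by
  rw [sub_pmul, pmul_assoc Z, dressing_pmul_pinv, pmul_one, dress]
  abel

theorem comm_dressing_mem_deep {Z : Ser F} {m : ℤ} (hZ : Z ∈ deep F m) :
    pmul dressing Z - pmul Z dressing ∈ deep F (m + 2) := by
  have h := comm_mem_deep hZ (one_sub_dressing_mem_deep (F := F))
  rw [pmul_sub, sub_pmul, pmul_one, one_pmul, add_assoc, one_add_one_eq_two] at h
  convert h using 1
  abel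

/-- For an operator of order at most one the residue of the dressed operator is read off from the
commutator with `K`. -/
theorem res_eq_of_mem_deep {Z : Ser F} (hZ : Z ∈ deep F (-1)) :
    res Z = Z.coeff 1 + (pmul dressing Z - pmul Z dressing).coeff 1 := by
  have h := coeff_pmul_top (comm_dressing_mem_deep hZ) (pinv_mem_deep (dressing (F := F)))
  rw [coeff_pinv_dressing_zero, mul_one] at h
  rw [res, dress_eq, HahnSeries.coeff_add]
  exact congrArg _ h

theorem res_of_mem_deep_zero {Z : Ser F} (hZ : Z ∈ deep F 0) : res Z = Z.coeff 1 := by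
  rw [res_eq_of_mem_deep (deep_mono (by norm_num) hZ), comm_dressing_mem_deep hZ 1 (by norm_num),
    add_zero]

theorem res_of_mem_deep_two {Z : Ser F} (hZ : Z ∈ deep F 2) : res Z = 0 := by
  rw [res_of_mem_deep_zero (deep_mono (by norm_num) hZ), hZ 1 (by norm_num)]

theorem res_congr {Z Z' : Ser F} (h : Z - Z' ∈ deep F 2) : res Z = res Z' := by
  have := res_add (Z - Z') Z'
  rwa [sub_add_cancel, res_of_mem_deep_two h, zero_add] at this

theorem res_op_of_le {n : ℤ} (z : DiffPoly F) (hn : n ≤ -2) : res (op z n) = 0 :=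
  res_of_mem_deep_two (deep_mono (by omega) (op_mem_deep z n))

theorem res_op_neg_one (z : DiffPoly F) : res (op z (-1)) = z := by
  rw [res_of_mem_deep_zero (deep_mono (by norm_num) (op_mem_deep z (-1))), coeff_op,
    if_pos (by norm_num)]

theorem res_op_zero (z : DiffPoly F) : res (op z 0) = 0 := by
  rw [res_of_mem_deep_zero (op_mem_deep z 0), coeff_op, if_neg (by norm_num)]

theorem coeff_comm_op (u z : DiffPoly F) (n : ℤ) :
    (pmul (op u (-n)) (op z n) - pmul (op z n) (op u (-n))).coeff 1 = -(n • Dx (z * u)) := by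
  rw [HahnSeries.coeff_sub, coeff_op_pmul_op _ _ _ _ 1 1 (by push_cast; ring),
    coeff_op_pmul_op _ _ _ _ 1 1 (by push_cast; ring), Ring.choose_one_right,
    Ring.choose_one_right, dx_one, dx_one, Derivation.leibniz]
  simp only [smul_eq_mul, zsmul_eq_mul]
  push_cast
  ring

theorem res_op_one (z : DiffPoly F) : res (op z 1) = -Dx (z * MvPolynomial.X (Coord.K 0 0)) := by
  rw [res_eq_of_mem_deep (op_mem_deep z 1), coeff_op, if_neg (by norm_num), zero_add]
  have h : op 1 0 + op (MvPolynomial.X (Coord.K 0 0)) (-1) - dressing (F := F) ∈ deep F 2 := by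
    have h1 : op 1 0 + op (MvPolynomial.X (Coord.K 0 0)) (-1) - dressing (F := F) ∈ deep F 1 := by
      have := add_mem (one_sub_dressing_mem_deep (F := F))
        (op_mem_deep (MvPolynomial.X (Coord.K 0 0) : DiffPoly F) (-1))
      convert this using 1
      abel
    refine mem_deep_succ h1 ?_
    have := coeff_dressing_succ (F := F) 0
    rw [Nat.cast_zero, zero_add] at this
    simp [this]
  have h2 := comm_mem_deep h (op_mem_deep z 1) 1 (by norm_num)
  have h3 := coeff_comm_op (MvPolynomial.X (Coord.K 0 0)) z 1
  rw [one_smul] at h3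
  rw [← h3]
  simp only [sub_pmul, pmul_sub, add_pmul, pmul_add, one_pmul, pmul_one, HahnSeries.coeff_sub,
    HahnSeries.coeff_add] at h2 ⊢
  linear_combination -h2

theorem Dx_w : Dx (w : DiffPoly F) = 2 * res (op 1 1) := by
  rw [res_op_one, one_mul, w, Derivation.leibniz]
  have : Dx (-2 : DiffPoly F) = 0 := by
    have := (Dx (F := F)).map_intCast (-2)
    rwa [Int.cast_neg, Int.cast_ofNat] at this
  rw [this, smul_zero, add_zero, smul_eq_mul]
  ring

theorem Dy_w : Dy (w : DiffPoly F) = 2 * res (op 1 2) := by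
  have : Dy (w : DiffPoly F) = flow (op 1 2) w := by
    simp only [w, Derivation.leibniz, Dy_K]
    congr 2
    have h : ∀ U : Derivation F (DiffPoly F) (DiffPoly F), U (-2) = 0 := fun U => by
      have := U.map_intCast (-2)
      rwa [Int.cast_neg, Int.cast_ofNat] at this
    rw [h, h]
  rw [this, flow_w_eq_res]

theorem res_pmul_congr {a b : Ser F} {m α : ℤ} (h : a - b ∈ deep F m) (hm : α + 2 ≤ m) :
    res (pmul a (op 1 α)) = res (pmul b (op 1 α)) := by
  apply res_congr
  rw [← sub_pmul]
  exact deep_mono (by omega) (pmul_mem_deep h (op_mem_deep 1 α))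

end DressedResidue

section Expansion

variable {F : Type*} [CommRing F] [Algebra ℂ F]

theorem Dt_w (δ : Derivation ℂ F F) (N : ℕ) : Dt δ N (w : DiffPoly F) = 2 * res (op 1 N) := by
  have : Dt δ N (w : DiffPoly F) = flow (op 1 N) w := by
    simp only [w, Derivation.leibniz, Dt_K]
    congr 2
    have h := (Dt δ N).map_intCast (-2)
    have h' := (flow (op (1 : DiffPoly F) N)).map_intCast (-2)
    rw [Int.cast_neg, Int.cast_ofNat] at h h'
    rw [h, h']
  rw [this, flow_w_eq_res]

theorem res_smul (c : ℂ) (Z : Ser F) : res (c • Z) = c • res Z := by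
  have h : Dx (c • (1 : DiffPoly F)) = 0 := by
    rw [Dx_smul, Derivation.map_one_eq_zero, smul_zero]
  rw [smul_eq_pmul, res_op_zero_pmul _ h, smul_mul_assoc, one_mul]

variable (δ : Derivation ℂ F F)

/-- The residue that gives the flow `V^N(α, h)`, as a finite sum over the Taylor coefficients of
`h`. -/
theorem res_V (t : F) (t₀ : ℂ) {N : ℕ} (hN : 3 ≤ N) (α : ℤ) (h : F) (M : ℕ)
    (hM : α + 2 ≤ (N - 2) * M) :
    V δ t t₀ N α h w = 2 * ∑ k ∈ Finset.range M, taylorCoeff δ h k *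
      res (pmul ((shiftE t₀ N)^[k] (op 1 0)) (op 1 α)) := by
  refine (flow_w_eq_res _).trans ?_
  congr 1
  have h1 := adicSum_sub_mem_deep (taylorCoeff δ h) _ (N - 2) (by omega)
    (ppow_shiftOp_mem_deep (F := F) t₀ hN) M
  have h2 := deep_mono (m := 2) (by push_cast [show 2 ≤ N by omega]; linarith)
    (pmul_mem_deep h1 (op_mem_deep 1 α))
  rw [sub_pmul, ← funOp_eq δ t t₀ N (by omega)] at h2
  rw [res_congr h2, sum_pmul, res_sum]
  refine Finset.sum_congr rfl fun k _ => ?_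
  rw [pmul_assoc, res_op_zero_pmul _ (Dx_taylorCoeff δ h k), ← pmul_ppow_shiftOp, one_pmul]

theorem taylorCoeff_eq_smul (h : F) (k : ℕ) :
    taylorCoeff δ h k = ((k.factorial : ℂ)⁻¹) • MvPolynomial.C ((δ : F → F)^[k] h) := by
  classical
  ext m
  rw [taylorCoeff, MvPolynomial.coeff_smul, MvPolynomial.coeff_C, MvPolynomial.coeff_C]
  split_ifs <;> simp

theorem shiftE_sub (t₀ : ℂ) (N : ℕ) (a b : Ser F) :
    shiftE t₀ N (a - b) = shiftE t₀ N a - shiftE t₀ N b := by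
  rw [eq_sub_iff_add_eq, ← shiftE_add, sub_add_cancel]

theorem shiftE_congr (t₀ : ℂ) {N : ℕ} {a b : Ser F} {m m' : ℤ} (h : a - b ∈ deep F m)
    (hm : m' ≤ m + (N - 2)) : shiftE t₀ N a - shiftE t₀ N b ∈ deep F m' := by
  rw [← shiftE_sub]
  exact deep_mono hm (shiftE_mem_deep t₀ N h)

theorem shiftE_one (t₀ : ℂ) (N : ℕ) : shiftE t₀ N (op (1 : DiffPoly F) 0) =
    (N : ℂ)⁻¹ • (op (2 * MvPolynomial.X Coord.y) (2 - N) + op (MvPolynomial.X Coord.x) (1 - N) +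
      op (t₀ • 1) (-N)) := by
  rw [shiftE_op, mul_one, mul_one, zero_smul, zero_add, zero_add, zero_add, zero_sub]

theorem shiftE_smul (t₀ : ℂ) (N : ℕ) (c : ℂ) (a : Ser F) :
    shiftE t₀ N (c • a) = c • shiftE t₀ N a := by
  rw [← pmul_shiftOp, ← pmul_shiftOp, smul_pmul]

/-- `X ∂^α` under dressing, for `X = (1/N) x̂ ∂^(1-N) - t_N`. -/
theorem res_shiftE_one (t₀ : ℂ) (N : ℕ) (α : ℤ) :
    res (pmul (shiftE t₀ N (op (1 : DiffPoly F) 0)) (op 1 α)) =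
      (N : ℂ)⁻¹ • (2 * MvPolynomial.X Coord.y * res (op 1 (2 - N + α)) +
        res (op (MvPolynomial.X Coord.x) (1 - N + α)) + t₀ • res (op 1 (-N + α))) := by
  rw [shiftE_one, smul_pmul, res_smul, add_pmul, add_pmul, op_pmul_op_one, op_pmul_op_one,
    op_pmul_op_one, res_add, res_add, ← smul_op, res_smul]
  congr 3
  rw [← res_op_zero_pmul _ Dx_two_y, op_pmul_op_of_Dx_eq_zero _ _ _ _
    (Derivation.map_one_eq_zero _), mul_one, zero_add]

theorem shiftE_two (t₀ : ℂ) (N : ℕ) : shiftE t₀ N (shiftE t₀ N (op (1 : DiffPoly F) 0)) -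
    ((N : ℂ)⁻¹ ^ 2) • (op (4 * MvPolynomial.X Coord.y ^ 2) (4 - 2 * N) +
      op (4 * (MvPolynomial.X Coord.x * MvPolynomial.X Coord.y)) (3 - 2 * N) +
      op (MvPolynomial.X Coord.x ^ 2 + (4 * t₀ + 2 * (2 - N)) • MvPolynomial.X Coord.y)
        (2 - 2 * N)) ∈
      deep F (2 * N - 1) := by
  rw [shiftE_one, shiftE_smul, shiftE_add, shiftE_add, shiftE_op, shiftE_op, shiftE_op]
  rw [show (2 - N + 2 - N : ℤ) = 4 - 2 * N by ring, show (2 - N + 1 - N : ℤ) = 3 - 2 * N by ring,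
    show (2 - N - N : ℤ) = 2 - 2 * N by ring, show (1 - N + 2 - N : ℤ) = 3 - 2 * N by ring,
    show (1 - N + 1 - N : ℤ) = 2 - 2 * N by ring, show (1 - N - N : ℤ) = 1 - 2 * N by ring,
    show (-N + 2 - N : ℤ) = 2 - 2 * N by ring, show (-N + 1 - N : ℤ) = 1 - 2 * N by ring,
    show (-N - N : ℤ) = -(2 * N) by ring]
  intro i hi
  simp only [HahnSeries.coeff_sub, HahnSeries.coeff_smul, HahnSeries.coeff_add, coeff_op,
    ← Int.cast_smul_eq_zsmul ℂ]
  push_cast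
  split_ifs <;> first | omega | algebra with ℂ

theorem shiftE_two_three (t₀ : ℂ) : (shiftE t₀ 3)^[2] (op (1 : DiffPoly F) 0) -
    (3 : ℂ)⁻¹ ^ 2 • (op (4 * MvPolynomial.X Coord.y ^ 2) (-2) +
      op (4 * (MvPolynomial.X Coord.x * MvPolynomial.X Coord.y)) (-3) +
      op (MvPolynomial.X Coord.x ^ 2 + (4 * t₀ - 2) • MvPolynomial.X Coord.y) (-4)) ∈ deep F 5 := by
  have h := shiftE_two (F := F) t₀ 3
  norm_num at h ⊢
  rwa [show 4 * t₀ + -2 = 4 * t₀ - 2 by ring] at h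

theorem shiftE_three_three (t₀ : ℂ) : (shiftE t₀ 3)^[3] (op (1 : DiffPoly F) 0) -
    (3 : ℂ)⁻¹ ^ 3 • (op (8 * MvPolynomial.X Coord.y ^ 3) (-3) +
      op (12 * (MvPolynomial.X Coord.x * MvPolynomial.X Coord.y ^ 2)) (-4)) ∈ deep F 5 := by
  rw [Function.iterate_succ_apply']
  have h := shiftE_congr t₀ (N := 3) (m' := 5) (shiftE_two_three (F := F) t₀) (by norm_num)
  have h' : shiftE t₀ 3 ((3 : ℂ)⁻¹ ^ 2 • (op (4 * MvPolynomial.X Coord.y ^ 2) (-2) +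
      op (4 * (MvPolynomial.X Coord.x * MvPolynomial.X Coord.y)) (-3) +
      op (MvPolynomial.X Coord.x ^ 2 + (4 * t₀ - 2) • MvPolynomial.X Coord.y) (-4))) -
      (3 : ℂ)⁻¹ ^ 3 • (op (8 * MvPolynomial.X Coord.y ^ 3) (-3) +
      op (12 * (MvPolynomial.X Coord.x * MvPolynomial.X Coord.y ^ 2)) (-4)) ∈ deep F 5 := by
    rw [shiftE_smul, shiftE_add, shiftE_add, shiftE_op, shiftE_op, shiftE_op]
    norm_num
    intro i hi
    simp only [HahnSeries.coeff_sub, HahnSeries.coeff_smul, HahnSeries.coeff_add, coeff_op]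
    split_ifs <;> first | omega | algebra with ℂ
  have := add_mem h h'
  rwa [sub_add_sub_cancel] at this

theorem shiftE_four_three (t₀ : ℂ) : (shiftE t₀ 3)^[4] (op (1 : DiffPoly F) 0) -
    (3 : ℂ)⁻¹ ^ 4 • op (16 * MvPolynomial.X Coord.y ^ 4) (-4) ∈ deep F 5 := by
  rw [Function.iterate_succ_apply']
  have h := shiftE_congr t₀ (N := 3) (m' := 5) (shiftE_three_three (F := F) t₀) (by norm_num)
  have h' : shiftE t₀ 3 ((3 : ℂ)⁻¹ ^ 3 • (op (8 * MvPolynomial.X Coord.y ^ 3) (-3) +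
      op (12 * (MvPolynomial.X Coord.x * MvPolynomial.X Coord.y ^ 2)) (-4))) -
      (3 : ℂ)⁻¹ ^ 4 • op (16 * MvPolynomial.X Coord.y ^ 4) (-4) ∈ deep F 5 := by
    rw [shiftE_smul, shiftE_add, shiftE_op, shiftE_op]
    norm_num
    intro i hi
    simp only [HahnSeries.coeff_sub, HahnSeries.coeff_smul, HahnSeries.coeff_add, coeff_op]
    split_ifs <;> first | omega | algebra with ℂ
  have := add_mem h h'
  rwa [sub_add_sub_cancel] at this

theorem res_shiftE_two (t₀ : ℂ) (N : ℕ) (α : ℤ) (hα : α ≤ 2 * N - 3) :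
    res (pmul ((shiftE t₀ N)^[2] (op (1 : DiffPoly F) 0)) (op 1 α)) =
      (N : ℂ)⁻¹ ^ 2 • (res (op (4 * MvPolynomial.X Coord.y ^ 2) (4 - 2 * N + α)) +
        res (op (4 * (MvPolynomial.X Coord.x * MvPolynomial.X Coord.y)) (3 - 2 * N + α)) +
        res (op (MvPolynomial.X Coord.x ^ 2 + (4 * t₀ + 2 * (2 - N)) • MvPolynomial.X Coord.y)
          (2 - 2 * N + α))) := by
  refine (res_pmul_congr (shiftE_two t₀ N) (by omega)).trans ?_
  rw [smul_pmul, res_smul, add_pmul, add_pmul, op_pmul_op_one, op_pmul_op_one, op_pmul_op_one,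
    res_add, res_add]

theorem res_shiftE_three (t₀ : ℂ) (α : ℤ) (hα : α ≤ 3) :
    res (pmul ((shiftE t₀ 3)^[3] (op (1 : DiffPoly F) 0)) (op 1 α)) =
      (3 : ℂ)⁻¹ ^ 3 • (res (op (8 * MvPolynomial.X Coord.y ^ 3) (-3 + α)) +
        res (op (12 * (MvPolynomial.X Coord.x * MvPolynomial.X Coord.y ^ 2)) (-4 + α))) := by
  rw [res_pmul_congr (shiftE_three_three t₀) (by omega), smul_pmul, res_smul, add_pmul,
    op_pmul_op_one, op_pmul_op_one, res_add]

theorem res_shiftE_four (t₀ : ℂ) (α : ℤ) (hα : α ≤ 3) :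
    res (pmul ((shiftE t₀ 3)^[4] (op (1 : DiffPoly F) 0)) (op 1 α)) =
      (3 : ℂ)⁻¹ ^ 4 • res (op (16 * MvPolynomial.X Coord.y ^ 4) (-4 + α)) := by
  rw [res_pmul_congr (shiftE_four_three t₀) (by omega), smul_pmul, res_smul, op_pmul_op_one]

end Expansion

section PointFields

variable {F : Type*} [CommRing F] [Algebra ℂ F]

/-! ### The vector fields of the point symmetries -/

variable (δ : Derivation ℂ F F)

theorem pointField_C (v₁ v₂ vN p : PFun F) (a : F) :
    pointField δ v₁ v₂ vN p (MvPolynomial.C a) = vN * MvPolynomial.C (δ a) := by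
  simp [pointField, coeffDer_C]

theorem pointField_x (v₁ v₂ vN p : PFun F) :
    pointField δ v₁ v₂ vN p (MvPolynomial.X PCoord.x) = v₁ := by
  classical
  simp [pointField, coeffDer_X, MvPolynomial.pderiv_X]

theorem pointField_y (v₁ v₂ vN p : PFun F) :
    pointField δ v₁ v₂ vN p (MvPolynomial.X PCoord.y) = v₂ := by
  classical
  simp [pointField, coeffDer_X, MvPolynomial.pderiv_X]

theorem pointField_w (v₁ v₂ vN p : PFun F) :
    pointField δ v₁ v₂ vN p (MvPolynomial.X PCoord.w) = p := by
  classical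
  simp [pointField, coeffDer_X, MvPolynomial.pderiv_X]

/-- The indicator of `N = m`, as a complex number. The symmetries of the equations with `N = 3`,
`N = 4` and `N = 5` contain terms that are absent for all other `N`. -/
def ind (N m : ℕ) : ℂ := if N = m then 1 else 0

/-- The vector field of the flow `V^N(N, f)`. -/
def virField (t₀ : ℂ) (N : ℕ) (f : F) : Derivation ℂ (PFun F) (PFun F) :=
  pointField δ
    ((N : ℂ)⁻¹ • (MvPolynomial.C (δ f) * MvPolynomial.X PCoord.x) +
      (2 * ind N 3 * (N : ℂ)⁻¹ ^ 2) • (MvPolynomial.C (δ (δ f)) * MvPolynomial.X PCoord.y ^ 2))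
    ((2 * (N : ℂ)⁻¹) • (MvPolynomial.C (δ f) * MvPolynomial.X PCoord.y))
    (MvPolynomial.C f)
    (-((N : ℂ)⁻¹ • (MvPolynomial.C (δ f) * MvPolynomial.X PCoord.w)) -
      (ind N 3 * (N : ℂ)⁻¹ ^ 2) • (MvPolynomial.C (δ (δ f)) * (MvPolynomial.X PCoord.x ^ 2 +
        (4 * t₀ - 2) • MvPolynomial.X PCoord.y)) -
      (4 * ind N 4 * (N : ℂ)⁻¹ ^ 2) • (MvPolynomial.C (δ (δ f)) * (MvPolynomial.X PCoord.x *
        MvPolynomial.X PCoord.y)) -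
      (4 * ind N 5 * (N : ℂ)⁻¹ ^ 2) • (MvPolynomial.C (δ (δ f)) * MvPolynomial.X PCoord.y ^ 2) -
      (4 * ind N 3 * (N : ℂ)⁻¹ ^ 3) • (MvPolynomial.C (δ (δ (δ f))) * (MvPolynomial.X PCoord.x *
        MvPolynomial.X PCoord.y ^ 2)) -
      (4 / 3 * ind N 3 * (N : ℂ)⁻¹ ^ 4) • (MvPolynomial.C (δ (δ (δ (δ f)))) *
        MvPolynomial.X PCoord.y ^ 4))

/-- The vector field `(p₀ + p₁ y) ∂_x + p₂ ∂_y + (p₃ + p₄ y + p₅ x + p₆ y² + p₇ x y + p₈ y³) ∂_w`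
with coefficients `pᵢ` depending on `t_N` only. -/
def loopField (p : Fin 9 → F) : Derivation ℂ (PFun F) (PFun F) :=
  pointField δ (MvPolynomial.C (p 0) + MvPolynomial.C (p 1) * MvPolynomial.X PCoord.y)
    (MvPolynomial.C (p 2)) 0
    (MvPolynomial.C (p 3) + MvPolynomial.C (p 4) * MvPolynomial.X PCoord.y +
      MvPolynomial.C (p 5) * MvPolynomial.X PCoord.x +
      MvPolynomial.C (p 6) * MvPolynomial.X PCoord.y ^ 2 +
      MvPolynomial.C (p 7) * (MvPolynomial.X PCoord.x * MvPolynomial.X PCoord.y) +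
      MvPolynomial.C (p 8) * MvPolynomial.X PCoord.y ^ 3)

/-- The coefficients, in the sense of `loopField`, of the field of the flow
`V^N(2, a) + V^N(1, b) + V^N(0, c) + V^N(-1, e)`. -/
def curParam (t₀ : ℂ) (N : ℕ) (a b c e : F) : Fin 9 → F :=
  ![b,
    (2 * ind N 3 * (N : ℂ)⁻¹) • δ a,
    a,
    (-2 * t₀ * ind N 3 * (N : ℂ)⁻¹) • δ a + (-2 : ℂ) • e,
    (-4 * ind N 5 * (N : ℂ)⁻¹) • δ a + (-4 * ind N 4 * (N : ℂ)⁻¹) • δ b +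
      (-4 * ind N 3 * (N : ℂ)⁻¹) • δ c,
    (-2 * ind N 4 * (N : ℂ)⁻¹) • δ a + (-2 * ind N 3 * (N : ℂ)⁻¹) • δ b,
    (-4 * ind N 3 * (N : ℂ)⁻¹ ^ 2) • δ (δ b),
    (-4 * ind N 3 * (N : ℂ)⁻¹ ^ 2) • δ (δ a),
    (-8 / 3 * ind N 3 * (N : ℂ)⁻¹ ^ 3) • δ (δ (δ a))]

/-- The vector field of the flow `V^N(2, a) + V^N(1, b) + V^N(0, c) + V^N(-1, e)`. -/
def curField (t₀ : ℂ) (N : ℕ) (a b c e : F) : Derivation ℂ (PFun F) (PFun F) :=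
  loopField δ (curParam δ t₀ N a b c e)

theorem loopField_C (p : Fin 9 → F) (a : F) : loopField δ p (MvPolynomial.C a) = 0 := by
  rw [loopField, pointField_C, zero_mul]

theorem loopField_x (p : Fin 9 → F) : loopField δ p (MvPolynomial.X PCoord.x) =
    MvPolynomial.C (p 0) + MvPolynomial.C (p 1) * MvPolynomial.X PCoord.y := pointField_x ..

theorem loopField_y (p : Fin 9 → F) : loopField δ p (MvPolynomial.X PCoord.y) =
    MvPolynomial.C (p 2) := pointField_y ..

theorem loopField_w (p : Fin 9 → F) : loopField δ p (MvPolynomial.X PCoord.w) =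
    MvPolynomial.C (p 3) + MvPolynomial.C (p 4) * MvPolynomial.X PCoord.y +
      MvPolynomial.C (p 5) * MvPolynomial.X PCoord.x +
      MvPolynomial.C (p 6) * MvPolynomial.X PCoord.y ^ 2 +
      MvPolynomial.C (p 7) * (MvPolynomial.X PCoord.x * MvPolynomial.X PCoord.y) +
      MvPolynomial.C (p 8) * MvPolynomial.X PCoord.y ^ 3 := pointField_w ..

theorem loopField_add (p q : Fin 9 → F) :
    loopField δ (p + q) = loopField δ p + loopField δ q := by
  apply derivation_ext_coords
  · intro a
    simp only [Derivation.add_apply, loopField_C, add_zero]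
  · rintro (_ | _ | _) <;>
    simp only [Derivation.add_apply, loopField_x, loopField_y, loopField_w, Pi.add_apply, map_add]
    <;> ring

theorem loopField_smul (c : ℂ) (p : Fin 9 → F) :
    loopField δ (c • p) = c • loopField δ p := by
  apply derivation_ext_coords
  · intro a
    simp only [Derivation.smul_apply, loopField_C, smul_zero]
  · rintro (_ | _ | _) <;>
    simp only [Derivation.smul_apply, loopField_x, loopField_y, loopField_w, Pi.smul_apply,
      C_smul_complex] <;> algebra with ℂ

/-- The coefficients of the commutator of two of the vector fields `loopField`. -/
def loopBracket (p q : Fin 9 → F) : Fin 9 → F :=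
  ![p 2 * q 1 - q 2 * p 1, 0, 0,
    p 0 * q 5 + p 2 * q 4 - (q 0 * p 5 + q 2 * p 4),
    p 0 * q 7 + p 1 * q 5 + 2 * p 2 * q 6 - (q 0 * p 7 + q 1 * p 5 + 2 * q 2 * p 6),
    p 2 * q 7 - q 2 * p 7,
    p 1 * q 7 + 3 * p 2 * q 8 - (q 1 * p 7 + 3 * q 2 * p 8), 0, 0]

theorem loopField_lie (p q : Fin 9 → F) :
    ⁅loopField δ p, loopField δ q⁆ = loopField δ (loopBracket p q) := by
  apply derivation_ext_coords
  · intro a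
    simp only [Derivation.commutator_apply, loopField_C, map_zero, sub_zero]
  · rintro (_ | _ | _) <;>
    simp only [Derivation.commutator_apply, loopField_x, loopField_y, loopField_w, map_add,
      Derivation.leibniz, Derivation.leibniz_pow, loopField_C, smul_eq_mul, loopBracket,
      Matrix.cons_val, map_sub, map_mul, map_zero, map_ofNat] <;> algebra with F

theorem virField_C (t₀ : ℂ) (N : ℕ) (f a : F) :
    virField δ t₀ N f (MvPolynomial.C a) = MvPolynomial.C (f * δ a) := by
  rw [virField, pointField_C, map_mul]

theorem virField_x (t₀ : ℂ) (N : ℕ) (f : F) : virField δ t₀ N f (MvPolynomial.X PCoord.x) =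
    (N : ℂ)⁻¹ • (MvPolynomial.C (δ f) * MvPolynomial.X PCoord.x) +
      (2 * ind N 3 * (N : ℂ)⁻¹ ^ 2) • (MvPolynomial.C (δ (δ f)) * MvPolynomial.X PCoord.y ^ 2) :=
  pointField_x ..

theorem virField_y (t₀ : ℂ) (N : ℕ) (f : F) : virField δ t₀ N f (MvPolynomial.X PCoord.y) =
    (2 * (N : ℂ)⁻¹) • (MvPolynomial.C (δ f) * MvPolynomial.X PCoord.y) := pointField_y ..

theorem virField_w (t₀ : ℂ) (N : ℕ) (f : F) : virField δ t₀ N f (MvPolynomial.X PCoord.w) =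
    -((N : ℂ)⁻¹ • (MvPolynomial.C (δ f) * MvPolynomial.X PCoord.w)) -
      (ind N 3 * (N : ℂ)⁻¹ ^ 2) • (MvPolynomial.C (δ (δ f)) * (MvPolynomial.X PCoord.x ^ 2 +
        (4 * t₀ - 2) • MvPolynomial.X PCoord.y)) -
      (4 * ind N 4 * (N : ℂ)⁻¹ ^ 2) • (MvPolynomial.C (δ (δ f)) * (MvPolynomial.X PCoord.x *
        MvPolynomial.X PCoord.y)) -
      (4 * ind N 5 * (N : ℂ)⁻¹ ^ 2) • (MvPolynomial.C (δ (δ f)) * MvPolynomial.X PCoord.y ^ 2) -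
      (4 * ind N 3 * (N : ℂ)⁻¹ ^ 3) • (MvPolynomial.C (δ (δ (δ f))) * (MvPolynomial.X PCoord.x *
        MvPolynomial.X PCoord.y ^ 2)) -
      (4 / 3 * ind N 3 * (N : ℂ)⁻¹ ^ 4) • (MvPolynomial.C (δ (δ (δ (δ f)))) *
        MvPolynomial.X PCoord.y ^ 4) := pointField_w ..

theorem virField_add (t₀ : ℂ) (N : ℕ) (f g : F) :
    virField δ t₀ N (f + g) = virField δ t₀ N f + virField δ t₀ N g := by
  apply derivation_ext_coords
  · intro a
    simp only [Derivation.add_apply, virField_C, add_mul, map_add]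
  · rintro (_ | _ | _) <;>
    simp only [Derivation.add_apply, virField, pointField_x, pointField_y, pointField_w, map_add]
    <;> algebra with ℂ

theorem virField_smul (t₀ : ℂ) (N : ℕ) (c : ℂ) (f : F) :
    virField δ t₀ N (c • f) = c • virField δ t₀ N f := by
  apply derivation_ext_coords
  · intro a
    simp only [Derivation.smul_apply, virField_C, smul_mul_assoc, C_smul_complex]
  · rintro (_ | _ | _) <;>
    simp only [Derivation.smul_apply, virField, pointField_x, pointField_y, pointField_w,
      Derivation.map_smul, C_smul_complex] <;> algebra with ℂ

/-- The embedding of the reparametrizations of `t_N` into the point symmetries. -/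
def virMap (t₀ : ℂ) (N : ℕ) : F →ₗ[ℂ] Derivation ℂ (PFun F) (PFun F) where
  toFun := virField δ t₀ N
  map_add' := virField_add δ t₀ N
  map_smul' := virField_smul δ t₀ N

theorem ind_self (N : ℕ) : ind N N = 1 := if_pos rfl

theorem ind_of_ne {N m : ℕ} (h : N ≠ m) : ind N m = 0 := if_neg h

/-- The values of the indicators: at most one of them is different from zero. -/
theorem ind_cases (N : ℕ) :
    (N = 3 ∧ ind N 3 = 1 ∧ ind N 4 = 0 ∧ ind N 5 = 0) ∨
    (N = 4 ∧ ind N 3 = 0 ∧ ind N 4 = 1 ∧ ind N 5 = 0) ∨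
    (N = 5 ∧ ind N 3 = 0 ∧ ind N 4 = 0 ∧ ind N 5 = 1) ∨
    (N ≠ 3 ∧ N ≠ 4 ∧ N ≠ 5 ∧ ind N 3 = 0 ∧ ind N 4 = 0 ∧ ind N 5 = 0) := by
  by_cases h3 : N = 3
  · subst h3
    exact Or.inl ⟨rfl, ind_self 3, ind_of_ne (by norm_num), ind_of_ne (by norm_num)⟩
  by_cases h4 : N = 4
  · subst h4
    exact Or.inr (Or.inl ⟨rfl, ind_of_ne (by norm_num), ind_self 4, ind_of_ne (by norm_num)⟩)
  by_cases h5 : N = 5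
  · subst h5
    exact Or.inr (Or.inr (Or.inl
      ⟨rfl, ind_of_ne (by norm_num), ind_of_ne (by norm_num), ind_self 5⟩))
  exact Or.inr (Or.inr (Or.inr ⟨h3, h4, h5, ind_of_ne h3, ind_of_ne h4, ind_of_ne h5⟩))

/-- The commutation relations of the Virasoro algebra. -/
theorem virField_lie (t₀ : ℂ) (N : ℕ) (f g : F) :
    ⁅virField δ t₀ N f, virField δ t₀ N g⁆ = virField δ t₀ N (f * δ g - δ f * g) := by
  apply derivation_ext_coords
  · intro a
    simp only [Derivation.commutator_apply, virField_C, Derivation.leibniz, smul_eq_mul,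
      ← map_sub]
    congr 1
    ring
  · rcases ind_cases N with ⟨rfl, e3, e4, e5⟩ | ⟨rfl, e3, e4, e5⟩ | ⟨rfl, e3, e4, e5⟩ |
      ⟨-, -, -, e3, e4, e5⟩ <;> rintro (_ | _ | _) <;>
    · simp only [Derivation.commutator_apply, virField_x, virField_y, virField_w, e3, e4, e5,
        mul_zero, zero_mul, zero_smul, add_zero, sub_zero, mul_one, Nat.cast_ofNat]
      simp only [map_add, map_sub, map_neg, Derivation.map_smul, Derivation.leibniz,
        Derivation.leibniz_pow, virField_x, virField_y, virField_w, virField_C, smul_eq_mul,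
        e3, e4, e5, mul_zero, zero_mul, zero_smul, add_zero, sub_zero, mul_one, Nat.cast_ofNat,
        map_mul]
      algebra with ℂ

/-- The commutator of two current fields, through the coefficients of the flows. -/
theorem curField_lie (t₀ : ℂ) (N : ℕ) (a b c e a' b' c' e' : F) :
    ⁅curField δ t₀ N a b c e, curField δ t₀ N a' b' c' e'⁆ =
      curField δ t₀ N 0 ((2 * ind N 3 * (N : ℂ)⁻¹) • (a * δ a' - a' * δ a))
        ((N : ℂ)⁻¹ • (2 * (a * δ b') - δ a * b' - (2 * (a' * δ b) - δ a' * b)))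
        ((ind N 3 * (N : ℂ)⁻¹) • (2 * (a * δ c' - a' * δ c) + (b * δ b' - b' * δ b)) +
          (ind N 4 * (N : ℂ)⁻¹) • (2 * (a * δ b') - δ a * b' - (2 * (a' * δ b) - δ a' * b)) +
          (ind N 5 * (N : ℂ)⁻¹) • (2 * (a * δ a' - a' * δ a))) := by
  have h2 : δ 2 = 0 := δ.map_natCast 2
  rw [curField, curField, curField, loopField_lie]
  congr 1
  rcases ind_cases N with ⟨rfl, e3, e4, e5⟩ | ⟨rfl, e3, e4, e5⟩ | ⟨rfl, e3, e4, e5⟩ |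
      ⟨-, -, -, e3, e4, e5⟩ <;>
  · ext i
    fin_cases i <;>
    · simp only [loopBracket, curParam, e3, e4, e5, Fin.zero_eta, Fin.mk_one, Fin.reduceFinMk,
        Matrix.cons_val, mul_zero, zero_mul, zero_smul, add_zero, sub_zero, mul_one,
        Nat.cast_ofNat, map_add, map_sub, Derivation.map_smul, Derivation.leibniz, h2, map_zero,
        smul_zero, smul_eq_mul, zero_add]
      try algebra with ℂ

/-- The commutator of a reparametrization of `t_N` and a current field. -/
theorem virField_lie_curField (t₀ : ℂ) (N : ℕ) (f a b c e : F) :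
    ⁅virField δ t₀ N f, curField δ t₀ N a b c e⁆ =
      curField δ t₀ N (f * δ a - (2 * (N : ℂ)⁻¹) • (δ f * a)) (f * δ b - (N : ℂ)⁻¹ • (δ f * b))
        (f * δ c) (f * δ e + (N : ℂ)⁻¹ • (δ f * e) +
          (ind N 3 * (N : ℂ)⁻¹ ^ 2) • (δ (δ f) * a)) := by
  apply derivation_ext_coords
  · intro x
    simp only [Derivation.commutator_apply, virField_C, curField, loopField_C, map_zero, sub_zero]
  · rcases ind_cases N with ⟨rfl, e3, e4, e5⟩ | ⟨rfl, e3, e4, e5⟩ | ⟨rfl, e3, e4, e5⟩ |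
      ⟨-, -, -, e3, e4, e5⟩ <;> rintro (_ | _ | _) <;>
    · simp only [Derivation.commutator_apply, virField_x, virField_y, virField_w, curField,
        loopField_x, loopField_y, loopField_w, curParam, Matrix.cons_val, e3, e4, e5,
        mul_zero, zero_mul, zero_smul, add_zero, sub_zero, mul_one, Nat.cast_ofNat, zero_add]
      simp only [map_add, map_sub, map_neg, Derivation.map_smul, Derivation.leibniz,
        Derivation.leibniz_pow, virField_x, virField_y, virField_C, smul_eq_mul,
        loopField_x, loopField_y, loopField_w, loopField_C, Matrix.cons_val,
        e3, mul_zero, zero_mul, zero_smul, add_zero, mul_one, Nat.cast_ofNat,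
        map_mul, map_zero, C_smul_complex]
      try algebra with ℂ

end PointFields

section Evaluation

variable {F : Type*} [CommRing F]

/-! ### The flows that represent point symmetries -/

theorem evalW_C (a : F) : evalW (MvPolynomial.C a : PFun F) = MvPolynomial.C a := by
  rw [evalW, MvPolynomial.aeval_C]
  rfl

theorem evalW_x : evalW (MvPolynomial.X PCoord.x : PFun F) = MvPolynomial.X Coord.x := by
  rw [evalW, MvPolynomial.aeval_X]

theorem evalW_y : evalW (MvPolynomial.X PCoord.y : PFun F) = MvPolynomial.X Coord.y := by
  rw [evalW, MvPolynomial.aeval_X]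

theorem evalW_w : evalW (MvPolynomial.X PCoord.w : PFun F) = w := by
  rw [evalW, MvPolynomial.aeval_X]

theorem Dx_ofNat (n : ℕ) [n.AtLeastTwo] : Dx (ofNat(n) : DiffPoly F) = 0 :=
  (Dx (F := F)).map_natCast n

end Evaluation

section Representations

variable {F : Type*} [CommRing F] [Algebra ℂ F]

theorem evalW_smul (c : ℂ) (p : PFun F) : evalW (c • p) = c • evalW p :=
  map_smul (evalW.restrictScalars ℂ) c p

theorem Represents.add {δ : Derivation ℂ F F} {N : ℕ}
    {U₁ U₂ : Derivation ℂ (DiffPoly F) (DiffPoly F)} {Z₁ Z₂ : Derivation ℂ (PFun F) (PFun F)}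
    (h₁ : Represents δ N U₁ Z₁) (h₂ : Represents δ N U₂ Z₂) :
    Represents δ N (U₁ + U₂) (Z₁ + Z₂) := by
  obtain ⟨v₁, v₂, vN, p, rfl, e⟩ := h₁
  obtain ⟨v₁', v₂', vN', p', rfl, e'⟩ := h₂
  refine ⟨v₁ + v₁', v₂ + v₂', vN + vN', p + p', ?_, ?_⟩
  · simp only [pointField, add_smul]
    abel
  · simp only [Derivation.add_apply, e, e', map_add]
    ring

variable (δ : Derivation ℂ F F) (t : F) (t₀ : ℂ)

theorem w_eq : (w : DiffPoly F) = (-2 : ℂ) • MvPolynomial.X (Coord.K 0 0) := by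
  rw [w]
  algebra with ℂ

theorem taylorCoeff_zero (h : F) : taylorCoeff δ h 0 = MvPolynomial.C h := by
  simp [taylorCoeff]

theorem taylorCoeff_one (h : F) : taylorCoeff δ h 1 = MvPolynomial.C (δ h) := by
  simp [taylorCoeff]

theorem taylorCoeff_two (h : F) :
    taylorCoeff δ h 2 = (2 : ℂ)⁻¹ • MvPolynomial.C (δ (δ h)) := by
  simp [taylorCoeff_eq_smul]

theorem taylorCoeff_three (h : F) :
    taylorCoeff δ h 3 = (6 : ℂ)⁻¹ • MvPolynomial.C (δ (δ (δ h))) := by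
  simp [taylorCoeff_eq_smul, Nat.factorial]

theorem taylorCoeff_four (h : F) :
    taylorCoeff δ h 4 = (24 : ℂ)⁻¹ • MvPolynomial.C (δ (δ (δ (δ h)))) := by
  simp [taylorCoeff_eq_smul, Nat.factorial]

theorem represents_virField {N : ℕ} (hN : 3 ≤ N) (f : F) :
    Represents δ N (V δ t t₀ N N f) (virField δ t₀ N f) := by
  refine ⟨_, _, _, _, rfl, ?_⟩
  rw [Dx_w, Dy_w, Dt_w]
  rcases ind_cases N with ⟨rfl, e3, e4, e5⟩ | ⟨rfl, e3, e4, e5⟩ | ⟨rfl, e3, e4, e5⟩ |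
      ⟨h3, h4, h5, e3, e4, e5⟩
  · rw [res_V δ t t₀ hN _ _ 5 (by norm_num)]
    simp only [Finset.sum_range_succ, Finset.sum_range_zero, zero_add, Nat.cast_ofNat,
      op_pmul_op_one, res_shiftE_one, res_shiftE_two t₀ 3 3 (by norm_num),
      res_shiftE_three t₀ 3 (by norm_num), res_shiftE_four t₀ 3 (by norm_num),
      Function.iterate_zero_apply, Function.iterate_one, taylorCoeff_zero, taylorCoeff_one,
      taylorCoeff_two, taylorCoeff_three, taylorCoeff_four, e3, e4, e5, Int.reduceSub,
      Int.reduceAdd, Int.reduceNeg, Int.reduceMul, res_op_neg_one, res_op_zero, res_op_one]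
    simp only [map_add, map_sub, map_neg, map_mul, map_pow, map_zero, evalW_smul, evalW_x, evalW_y,
      evalW_w, evalW_C, Derivation.leibniz, Derivation.leibniz_pow, Derivation.map_one_eq_zero,
      Dx_ofNat, Dx_x, Dx_y, Dx_K, smul_eq_mul, w_eq, mul_zero, zero_mul, zero_smul, smul_zero,
      add_zero, mul_one]
    algebra with ℂ
  · rw [res_V δ t t₀ hN _ _ 3 (by norm_num)]
    simp only [Finset.sum_range_succ, Finset.sum_range_zero, zero_add, Nat.cast_ofNat,
      op_pmul_op_one, res_shiftE_one, res_shiftE_two t₀ 4 4 (by norm_num),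
      Function.iterate_zero_apply, Function.iterate_one, taylorCoeff_zero, taylorCoeff_one,
      taylorCoeff_two, e3, e4, e5, Int.reduceSub, Int.reduceAdd, Int.reduceNeg, Int.reduceMul,
      res_op_neg_one, res_op_zero, res_op_one, res_op_of_le, Int.reduceLE]
    simp only [map_sub, map_neg, map_mul, map_zero, evalW_smul, evalW_x, evalW_y, evalW_w, evalW_C,
      Derivation.leibniz, Derivation.map_one_eq_zero, Dx_x, Dx_K, smul_eq_mul, w_eq, mul_zero,
      zero_mul, zero_smul, smul_zero, add_zero, mul_one]
    algebra with ℂ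
  · rw [res_V δ t t₀ hN _ _ 3 (by norm_num)]
    simp only [Finset.sum_range_succ, Finset.sum_range_zero, zero_add, Nat.cast_ofNat,
      op_pmul_op_one, res_shiftE_one, res_shiftE_two t₀ 5 5 (by norm_num),
      Function.iterate_zero_apply, Function.iterate_one, taylorCoeff_zero, taylorCoeff_one,
      taylorCoeff_two, e3, e4, e5, Int.reduceSub, Int.reduceAdd, Int.reduceNeg, Int.reduceMul,
      res_op_neg_one, res_op_zero, res_op_one, res_op_of_le, Int.reduceLE]
    simp only [map_sub, map_neg, map_mul, map_pow, map_zero, evalW_smul, evalW_x, evalW_y, evalW_w,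
      evalW_C, Derivation.leibniz, Derivation.map_one_eq_zero, Dx_x, Dx_K, smul_eq_mul, w_eq,
      mul_zero, zero_mul, zero_smul, smul_zero, add_zero, mul_one]
    algebra with ℂ
  · rw [res_V δ t t₀ hN _ _ 2 (by push_cast; linarith [show (6 : ℤ) ≤ N by omega])]
    simp only [Finset.sum_range_succ, Finset.sum_range_zero, zero_add, sub_add_cancel,
      neg_add_cancel, op_pmul_op_one, res_shiftE_one, Function.iterate_zero_apply,
      Function.iterate_one, taylorCoeff_zero, taylorCoeff_one, e3, e4, e5, res_op_zero, res_op_one]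
    simp only [map_sub, map_neg, map_mul, map_zero, evalW_smul, evalW_x, evalW_y, evalW_w, evalW_C,
      Derivation.leibniz, Derivation.map_one_eq_zero, Dx_x, Dx_K, smul_eq_mul, w_eq, mul_zero,
      zero_mul, zero_smul, smul_zero, add_zero, mul_one]
    algebra with ℂ

theorem represents_curField_two {N : ℕ} (hN : 3 ≤ N) (h : F) :
    Represents δ N (V δ t t₀ N 2 h) (curField δ t₀ N h 0 0 0) := by
  refine ⟨_, _, _, _, rfl, ?_⟩
  rw [Dx_w, Dy_w, Dt_w]
  rcases ind_cases N with ⟨rfl, e3, e4, e5⟩ | ⟨rfl, e3, e4, e5⟩ | ⟨rfl, e3, e4, e5⟩ |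
      ⟨h3, h4, h5, e3, e4, e5⟩
  · rw [res_V δ t t₀ hN _ _ 4 (by norm_num)]
    simp only [Finset.sum_range_succ, Finset.sum_range_zero, zero_add, Nat.cast_ofNat,
      op_pmul_op_one, res_shiftE_one, res_shiftE_two t₀ 3 2 (by norm_num),
      res_shiftE_three t₀ 2 (by norm_num), Function.iterate_zero_apply, Function.iterate_one,
      taylorCoeff_zero, taylorCoeff_one, taylorCoeff_two, taylorCoeff_three, curParam,
      Matrix.cons_val, e3, e4, e5, Int.reduceSub, Int.reduceAdd, Int.reduceNeg, Int.reduceMul,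
      res_op_neg_one, res_op_zero, res_op_one, res_op_of_le, Int.reduceLE]
    simp only [map_add, map_mul, map_pow, map_zero, evalW_smul, evalW_x, evalW_y, evalW_C,
      Derivation.leibniz, Derivation.map_one_eq_zero, Dx_K, C_smul_complex, smul_eq_mul, mul_zero,
      zero_mul, zero_smul, smul_zero, add_zero, mul_one]
    algebra with ℂ
  · rw [res_V δ t t₀ hN _ _ 2 (by norm_num)]
    simp only [Finset.sum_range_succ, Finset.sum_range_zero, zero_add, Nat.cast_ofNat,
      op_pmul_op_one, res_shiftE_one, Function.iterate_zero_apply, Function.iterate_one,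
      taylorCoeff_zero, taylorCoeff_one, curParam, Matrix.cons_val, e3, e4, e5, Int.reduceSub,
      Int.reduceAdd, Int.reduceNeg, res_op_neg_one, res_op_zero, res_op_one, res_op_of_le,
      Int.reduceLE]
    simp only [map_add, map_mul, map_zero, evalW_smul, evalW_x, evalW_C, Derivation.leibniz,
      Derivation.map_one_eq_zero, Dx_K, C_smul_complex, smul_eq_mul, mul_zero, zero_mul, zero_smul,
      smul_zero, add_zero, mul_one]
    algebra with ℂ
  · rw [res_V δ t t₀ hN _ _ 2 (by norm_num)]
    simp only [Finset.sum_range_succ, Finset.sum_range_zero, zero_add, Nat.cast_ofNat,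
      op_pmul_op_one, res_shiftE_one, Function.iterate_zero_apply, Function.iterate_one,
      taylorCoeff_zero, taylorCoeff_one, curParam, Matrix.cons_val, e3, e4, e5, Int.reduceSub,
      Int.reduceAdd, Int.reduceNeg, res_op_neg_one, res_op_one, res_op_of_le, Int.reduceLE]
    simp only [map_add, map_mul, map_zero, evalW_smul, evalW_y, evalW_C, Derivation.leibniz,
      Derivation.map_one_eq_zero, Dx_K, C_smul_complex, smul_eq_mul, mul_zero, zero_mul, zero_smul,
      smul_zero, add_zero, mul_one]
    algebra with ℂ
  · rw [res_V δ t t₀ hN _ _ 1 (by push_cast; linarith [show (6 : ℤ) ≤ N by omega])]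
    simp only [Finset.sum_range_succ, Finset.sum_range_zero, zero_add, op_pmul_op_one,
      Function.iterate_zero_apply, taylorCoeff_zero, curParam, Matrix.cons_val, e3, e4, e5,
      res_op_one]
    simp only [map_zero, evalW_C, Derivation.leibniz, Derivation.map_one_eq_zero, Dx_K, smul_eq_mul,
      mul_zero, zero_mul, zero_smul, smul_zero, add_zero]
    algebra with ℂ

theorem represents_curField_one {N : ℕ} (hN : 3 ≤ N) (h : F) :
    Represents δ N (V δ t t₀ N 1 h) (curField δ t₀ N 0 h 0 0) := by
  refine ⟨_, _, _, _, rfl, ?_⟩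
  rw [Dx_w, Dy_w, Dt_w]
  rcases ind_cases N with ⟨rfl, e3, e4, e5⟩ | ⟨rfl, e3, e4, e5⟩ | ⟨rfl, e3, e4, e5⟩ |
      ⟨h3, h4, h5, e3, e4, e5⟩
  · rw [res_V δ t t₀ hN _ _ 3 (by norm_num)]
    simp only [Finset.sum_range_succ, Finset.sum_range_zero, zero_add, Nat.cast_ofNat,
      op_pmul_op_one, res_shiftE_one, res_shiftE_two t₀ 3 1 (by norm_num),
      Function.iterate_zero_apply, Function.iterate_one, taylorCoeff_zero, taylorCoeff_one,
      taylorCoeff_two, curParam, Matrix.cons_val, e3, e4, e5, Int.reduceSub, Int.reduceAdd,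
      Int.reduceNeg, Int.reduceMul, res_op_neg_one, res_op_zero, res_op_one, res_op_of_le,
      Int.reduceLE]
    simp only [map_add, map_mul, map_pow, map_zero, evalW_smul, evalW_x, evalW_y, evalW_C,
      Derivation.leibniz, Derivation.map_one_eq_zero, Dx_K, C_smul_complex, smul_eq_mul, mul_zero,
      zero_mul, zero_smul, smul_zero, add_zero, mul_one]
    algebra with ℂ
  · rw [res_V δ t t₀ hN _ _ 2 (by norm_num)]
    simp only [Finset.sum_range_succ, Finset.sum_range_zero, zero_add, Nat.cast_ofNat,
      op_pmul_op_one, res_shiftE_one, Function.iterate_zero_apply, Function.iterate_one,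
      taylorCoeff_zero, taylorCoeff_one, curParam, Matrix.cons_val, e3, e4, e5, Int.reduceSub,
      Int.reduceAdd, Int.reduceNeg, res_op_neg_one, res_op_one, res_op_of_le, Int.reduceLE]
    simp only [map_add, map_mul, map_zero, evalW_smul, evalW_y, evalW_C, Derivation.leibniz,
      Derivation.map_one_eq_zero, Dx_K, C_smul_complex, smul_eq_mul, mul_zero, zero_mul, zero_smul,
      smul_zero, add_zero, mul_one]
    algebra with ℂ
  · rw [res_V δ t t₀ hN _ _ 1 (by norm_num)]
    simp only [Finset.sum_range_succ, Finset.sum_range_zero, zero_add, Nat.cast_ofNat,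
      op_pmul_op_one, Function.iterate_zero_apply, taylorCoeff_zero, curParam, Matrix.cons_val, e3,
      e4, e5, res_op_one]
    simp only [map_zero, evalW_C, Derivation.leibniz, Derivation.map_one_eq_zero, Dx_K, smul_eq_mul,
      mul_zero, zero_mul, zero_smul, smul_zero, add_zero, mul_one]
    algebra with ℂ
  · rw [res_V δ t t₀ hN _ _ 1 (by push_cast; linarith [show (6 : ℤ) ≤ N by omega])]
    simp only [Finset.sum_range_succ, Finset.sum_range_zero, zero_add, op_pmul_op_one,
      Function.iterate_zero_apply, taylorCoeff_zero, curParam, Matrix.cons_val, e3, e4, e5,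
      res_op_one]
    simp only [map_zero, evalW_C, Derivation.leibniz, Derivation.map_one_eq_zero, Dx_K, smul_eq_mul,
      mul_zero, zero_mul, zero_smul, smul_zero, add_zero]
    algebra with ℂ

theorem represents_curField_zero {N : ℕ} (hN : 3 ≤ N) (h : F) :
    Represents δ N (V δ t t₀ N 0 h) (curField δ t₀ N 0 0 h 0) := by
  refine ⟨_, _, _, _, rfl, ?_⟩
  rw [Dx_w, Dy_w, Dt_w]
  rcases ind_cases N with ⟨rfl, e3, e4, e5⟩ | ⟨rfl, e3, e4, e5⟩ | ⟨rfl, e3, e4, e5⟩ |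
      ⟨h3, h4, h5, e3, e4, e5⟩
  · rw [res_V δ t t₀ hN _ _ 2 (by norm_num)]
    simp only [Finset.sum_range_succ, Finset.sum_range_zero, zero_add, Nat.cast_ofNat,
      op_pmul_op_one, res_shiftE_one, Function.iterate_zero_apply, Function.iterate_one,
      taylorCoeff_zero, taylorCoeff_one, curParam, Matrix.cons_val, e3, e4, e5, Int.reduceSub,
      Int.reduceAdd, Int.reduceNeg, res_op_neg_one, res_op_zero, res_op_one, res_op_of_le,
      Int.reduceLE]
    simp only [map_add, map_mul, map_zero, evalW_smul, evalW_y, evalW_C, Derivation.leibniz,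
      Derivation.map_one_eq_zero, Dx_K, C_smul_complex, smul_eq_mul, mul_zero, zero_mul, smul_zero,
      add_zero, mul_one]
    algebra with ℂ
  · rw [res_V δ t t₀ hN _ _ 1 (by norm_num)]
    simp only [Finset.sum_range_succ, Finset.sum_range_zero, zero_add, Nat.cast_ofNat,
      op_pmul_op_one, Function.iterate_zero_apply, taylorCoeff_zero, curParam, Matrix.cons_val, e3,
      e4, e5, res_op_zero, res_op_one]
    simp only [map_zero, Derivation.leibniz, Derivation.map_one_eq_zero, Dx_K, smul_eq_mul,
      mul_zero, zero_mul, zero_smul, smul_zero, add_zero, mul_one]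
    algebra with ℂ
  · rw [res_V δ t t₀ hN _ _ 1 (by norm_num)]
    simp only [Finset.sum_range_succ, Finset.sum_range_zero, zero_add, Nat.cast_ofNat,
      op_pmul_op_one, Function.iterate_zero_apply, taylorCoeff_zero, curParam, Matrix.cons_val, e3,
      e4, e5, res_op_zero, res_op_one]
    simp only [map_zero, Derivation.leibniz, Derivation.map_one_eq_zero, Dx_K, smul_eq_mul,
      mul_zero, zero_mul, zero_smul, smul_zero, add_zero, mul_one]
    algebra with ℂ
  · rw [res_V δ t t₀ hN _ _ 1 (by push_cast; linarith [show (6 : ℤ) ≤ N by omega])]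
    simp only [Finset.sum_range_succ, Finset.sum_range_zero, zero_add, op_pmul_op_one,
      Function.iterate_zero_apply, taylorCoeff_zero, curParam, Matrix.cons_val, e3, e4, e5,
      res_op_zero, res_op_one]
    simp only [map_zero, Derivation.leibniz, Derivation.map_one_eq_zero, Dx_K, smul_eq_mul,
      mul_zero, zero_mul, zero_smul, smul_zero, add_zero]
    algebra with ℂ

theorem represents_curField_neg_one {N : ℕ} (hN : 3 ≤ N) (h : F) :
    Represents δ N (V δ t t₀ N (-1) h) (curField δ t₀ N 0 0 0 h) := by
  refine ⟨_, _, _, _, rfl, ?_⟩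
  rw [Dx_w, Dy_w, Dt_w]
  rw [res_V δ t t₀ hN _ _ 1 (by push_cast; linarith [show (3 : ℤ) ≤ N by omega])]
  simp only [Finset.sum_range_succ, Finset.sum_range_zero, zero_add, op_pmul_op_one,
    Function.iterate_zero_apply, taylorCoeff_zero, curParam, Matrix.cons_val, Int.reduceNeg,
    res_op_neg_one, res_op_one]
  simp only [map_add, map_zero, evalW_smul, evalW_C, Derivation.leibniz, Derivation.map_one_eq_zero,
    Dx_K, C_smul_complex, smul_eq_mul, mul_zero, zero_mul, smul_zero, add_zero, mul_one]
  algebra with ℂ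

/-- The flows that vanish on `w`. -/
theorem V_w_of_le {N : ℕ} (hN : 3 ≤ N) {α : ℤ} (hα : α ≤ -2) (h : F) : V δ t t₀ N α h w = 0 := by
  rw [res_V δ t t₀ hN _ _ 0 (by simpa using by omega), Finset.sum_range_zero, mul_zero]

end Representations

section Jets

variable {F : Type*} [CommRing F]

/-! ### Variation of a single coefficient of the dressing operator -/

/-- A derivation `U` that commutes with `∂ₓ` and kills the coefficients of `Z` acts on the dressed
operator by `U (K Z K⁻¹) = [(U K) K⁻¹, K Z K⁻¹]`. -/
theorem map_dress {R : Type*} [CommRing R] [Algebra R (DiffPoly F)]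
    {U : Derivation R (DiffPoly F) (DiffPoly F)} (hU : ∀ b, U (Dx b) = Dx (U b)) {Z : Ser F}
    (hZ : Z.map U = 0) :
    (dress Z).map U = pmul (pmul (dressing.map U) (pinv dressing)) (dress Z) -
      pmul (dress Z) (pmul (dressing.map U) (pinv dressing)) := by
  have h0 : pmul (dressing.map U) (pinv dressing) + pmul dressing ((pinv dressing).map U) = 0 := by
    rw [← map_pmul hU, dressing_pmul_pinv, map_op_one]
  have h1 : (pinv dressing).map U =
      -pmul (pinv dressing) (pmul (dressing.map U) (pinv dressing)) := by
    have := congrArg (pmul (pinv dressing)) (eq_neg_of_add_eq_zero_right h0)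
    rwa [← pmul_assoc, pinv_pmul_dressing, one_pmul, pmul_neg] at this
  have h2 : pmul (pmul (dressing.map U) (pinv dressing)) (dress Z) =
      pmul (pmul (dressing.map U) Z) (pinv dressing) := by
    rw [dress, ← pmul_assoc, ← pmul_assoc, pmul_assoc (dressing.map U), pinv_pmul_dressing,
      pmul_one]
  rw [dress, map_pmul hU, map_pmul hU, hZ, pmul_zero, add_zero, h1, pmul_neg, ← sub_eq_add_neg,
    ← dress, h2, dress, pmul_assoc _ (pinv dressing)]

/-- The evolutionary vector field `∂K_{j+1} = x`, for which the other `K_i` are constant. -/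
def jetDer (j : ℕ) : Derivation F (DiffPoly F) (DiffPoly F) :=
  MvPolynomial.mkDerivation F fun v => match v with
    | .x => 0
    | .y => 0
    | .K j' i => if j' = j then dx i (MvPolynomial.X Coord.x : DiffPoly F) else 0

theorem jetDer_x (j : ℕ) : jetDer (F := F) j (MvPolynomial.X Coord.x) = 0 := by
  simp [jetDer, MvPolynomial.mkDerivation_X]

theorem jetDer_y (j : ℕ) : jetDer (F := F) j (MvPolynomial.X Coord.y) = 0 := by
  simp [jetDer, MvPolynomial.mkDerivation_X]

theorem jetDer_K (j j' i : ℕ) : jetDer (F := F) j (MvPolynomial.X (Coord.K j' i)) =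
    if j' = j then dx i (MvPolynomial.X Coord.x : DiffPoly F) else 0 := by
  simp [jetDer, MvPolynomial.mkDerivation_X]

theorem jetDer_Dx (j : ℕ) (b : DiffPoly F) : jetDer j (Dx b) = Dx (jetDer j b) := by
  have h : ⁅jetDer (F := F) j, Dx (F := F)⁆ = 0 := by
    apply derivation_eq_zero
    · intro a
      exact Derivation.map_algebraMap _ a
    · rintro (_ | _ | ⟨j', i⟩)
      · rw [Derivation.commutator_apply, Dx_x, jetDer_x, map_zero, Derivation.map_one_eq_zero,
          sub_zero]
      · rw [Derivation.commutator_apply, Dx_y, jetDer_y, map_zero, map_zero, sub_zero]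
      · rw [Derivation.commutator_apply, Dx_K, jetDer_K, jetDer_K]
        split_ifs
        · rw [dx_succ, sub_self]
        · rw [map_zero, sub_zero]
  have := Derivation.congr_fun h b
  rwa [Derivation.commutator_apply, Derivation.coe_zero, Pi.zero_apply, sub_eq_zero] at this

theorem jetDer_two_mul (j : ℕ) (p : DiffPoly F) : jetDer j (2 * p) = 2 * jetDer j p := by
  rw [two_mul, map_add, two_mul]

theorem Dx_C_mul (a : F) (p : DiffPoly F) :
    Dx (MvPolynomial.C a * p) = MvPolynomial.C a * Dx p := by
  rw [← MvPolynomial.smul_eq_C_mul, Derivation.map_smul, MvPolynomial.smul_eq_C_mul]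

theorem map_jetDer_dressing (j : ℕ) :
    (dressing (F := F)).map (jetDer j) = op (MvPolynomial.X Coord.x) (-(j + 1)) := by
  ext1; funext n
  rw [HahnSeries.map_coeff, coeff_op, neg_neg]
  rcases lt_trichotomy n 0 with h | rfl | h
  · rw [dressing_mem_deep n h, map_zero, if_neg (by omega)]
  · rw [coeff_dressing_zero, Derivation.map_one_eq_zero, if_neg (by omega)]
  · obtain ⟨m, rfl⟩ : ∃ m : ℕ, n = m + 1 := ⟨(n - 1).toNat, by omega⟩
    rw [coeff_dressing_succ, jetDer_K, dx_zero]
    exact if_congr (by omega) rfl rfl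

theorem dress_mem_deep {Z : Ser F} {m : ℤ} (hZ : Z ∈ deep F m) : dress Z ∈ deep F m := by
  have := pmul_mem_deep (pmul_mem_deep (dressing_mem_deep (F := F)) hZ) (pinv_mem_deep dressing)
  rwa [zero_add, add_zero] at this

variable {Z : Ser F} {j : ℕ}

theorem jetDer_res_of_le (hZ : Z.map (jetDer j) = 0) {n : ℤ} (hn : n ≤ j)
    (hZ' : Z ∈ deep F (-n)) : jetDer j (res Z) = 0 := by
  have h := comm_mem_deep (pmul_mem_deep (op_mem_deep (MvPolynomial.X Coord.x) (-(j + 1)))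
    (pinv_mem_deep (dressing (F := F)))) (dress_mem_deep hZ')
  rw [← map_jetDer_dressing, ← map_dress (jetDer_Dx j) hZ] at h
  exact h 1 (by omega)

/-- The residue of the dressed operator of order `n` is affine in the derivative of `K_n`. -/
theorem jetDer_res (hZ : Z.map (jetDer j) = 0) (hZ' : Z ∈ deep F (-(j + 1))) :
    jetDer j (res Z) = -((j + 1 : ℤ) • Dx (Z.coeff (-(j + 1)) * MvPolynomial.X Coord.x)) := by
  have hG : pmul (op (MvPolynomial.X Coord.x) (-(j + 1))) (pinv (dressing (F := F))) -
      op (MvPolynomial.X Coord.x) (-(j + 1)) ∈ deep F (j + 2) := by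
    have h0 := pinv_mem_deep (dressing (F := F))
    have h1 : pinv dressing - op 1 0 ∈ deep F 1 :=
      mem_deep_succ (sub_mem h0 (op_mem_deep 1 0)) (by
        rw [HahnSeries.coeff_sub, coeff_pinv_dressing_zero, coeff_op]
        simp)
    have h2 := pmul_mem_deep (op_mem_deep (MvPolynomial.X Coord.x : DiffPoly F) (-(j + 1))) h1
    rw [pmul_sub, pmul_one] at h2
    exact deep_mono (by omega) h2
  have hD : dress Z - op (Z.coeff (-(j + 1))) (j + 1) ∈ deep F (-j) := by
    have h1 := deep_mono (m := -(j : ℤ)) (by omega)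
      (pmul_mem_deep (comm_dressing_mem_deep hZ') (pinv_mem_deep (dressing (F := F))))
    have h2 : Z - op (Z.coeff (-(j + 1))) (j + 1) ∈ deep F (-(j + 1) + 1) :=
      mem_deep_succ (sub_mem hZ' (op_mem_deep _ _)) (by
        rw [HahnSeries.coeff_sub, coeff_op, if_pos rfl, sub_self])
    have h3 := add_mem (deep_mono (m := -(j : ℤ)) (by omega) h2) h1
    rw [dress_eq]
    convert h3 using 1
    abel
  have h := map_dress (jetDer_Dx j) hZ
  rw [map_jetDer_dressing] at h
  have e : jetDer j (res Z) = ((dress Z).map (jetDer j)).coeff 1 := rfl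
  have h1 := comm_mem_deep hG (dress_mem_deep hZ') 1 (by omega)
  have h2 := comm_mem_deep (op_mem_deep (MvPolynomial.X Coord.x : DiffPoly F) (-(j + 1))) hD 1
    (by omega)
  have h3 := coeff_comm_op (MvPolynomial.X Coord.x) (Z.coeff (-(j + 1))) (j + 1)
  rw [e, h, ← h3]
  simp only [sub_pmul, pmul_sub, HahnSeries.coeff_sub] at h1 h2 ⊢
  linear_combination h1 + h2

end Jets

section Uniqueness

variable {F : Type*} [CommRing F] [Algebra ℂ F] (δ : Derivation ℂ F F) (t : F) (t₀ : ℂ)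

theorem map_jetDer_funOp (j : ℕ) {N : ℕ} (hN : 3 ≤ N) (h : F) :
    (funOp δ t t₀ N h).map ((jetDer j).restrictScalars ℂ) = 0 := by
  have hX : (shiftOp F t₀ N).map ((jetDer j).restrictScalars ℂ) = 0 := by
    rw [shiftOp, map_smul_ser, map_add_ser, map_add_ser, map_op, map_op, map_op]
    have h1 : (jetDer j).restrictScalars ℂ (2 * MvPolynomial.X Coord.y : DiffPoly F) = 0 :=
      (jetDer_two_mul j _).trans (by rw [jetDer_y, mul_zero])
    have h2 : (jetDer j).restrictScalars ℂ (const t₀ : DiffPoly F) = 0 :=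
      Derivation.map_algebraMap (jetDer (F := F) j) _
    have h3 : (jetDer j).restrictScalars ℂ (MvPolynomial.X Coord.x : DiffPoly F) = 0 := jetDer_x j
    rw [h1, h2, h3, op_zero, op_zero, op_zero, add_zero, add_zero, smul_zero]
  have h1 : ∀ k, (jetDer j).restrictScalars ℂ (taylorCoeff δ h k : DiffPoly F) = 0 := fun k =>
    Derivation.map_algebraMap (jetDer (F := F) j) _
  have h2 := map_ppow_eq_zero (U := (jetDer (F := F) j).restrictScalars ℂ) (jetDer_Dx j) hX
  rw [funOp_eq δ t t₀ N (by omega), map_adicSum]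
  ext1; funext n
  simp [adicSum, coeff_ofCoeffs, h1, h2]

theorem map_jetDer_V (j : ℕ) {N : ℕ} (hN : 3 ≤ N) (α : ℤ) (h : F) :
    (pmul (funOp δ t t₀ N h) (op 1 α)).map (jetDer j) = 0 := by
  have := map_pmul (U := (jetDer (F := F) j).restrictScalars ℂ) (jetDer_Dx j)
    (funOp δ t t₀ N h) (op 1 α)
  rw [map_jetDer_funOp δ t t₀ j hN, map_op_one, zero_pmul, pmul_zero, add_zero] at this
  exact this

theorem funOp_mem_deep (N : ℕ) (h : F) : funOp δ t t₀ N h ∈ deep F 0 := ofCoeffs_mem_deep _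

theorem V_op_mem_deep (N : ℕ) (α : ℤ) (h : F) :
    pmul (funOp δ t t₀ N h) (op 1 α) ∈ deep F (-α) := by
  have := pmul_mem_deep (funOp_mem_deep δ t t₀ N h) (op_mem_deep 1 α)
  rwa [zero_add] at this

theorem coeff_V_op (N : ℕ) (α : ℤ) (h : F) :
    (pmul (funOp δ t t₀ N h) (op 1 α)).coeff (-α) = MvPolynomial.C h := by
  have := coeff_pmul_top (funOp_mem_deep δ t t₀ N h) (op_mem_deep 1 α)
  rw [zero_add] at this
  rw [this, coeff_op, if_pos rfl, mul_one, funOp, adicSum, coeff_ofCoeffs]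
  simp [taylorCoeff, ppow, coeff_op]

theorem jetDer_V_of_le {N : ℕ} (hN : 3 ≤ N) {j : ℕ} {α : ℤ} (hα : α ≤ j) (h : F) :
    jetDer j (V δ t t₀ N α h w) = 0 := by
  have e : V δ t t₀ N α h w = _ := flow_w_eq_res _
  rw [e, jetDer_two_mul, jetDer_res_of_le (map_jetDer_V δ t t₀ j hN α h) hα
    (V_op_mem_deep δ t t₀ N α h), mul_zero]

theorem jetDer_V {N : ℕ} (hN : 3 ≤ N) (j : ℕ) (h : F) :
    jetDer j (V δ t t₀ N (j + 1) h w) = MvPolynomial.C ((-2 * (j + 1 : ℂ)) • h) := by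
  have e : V δ t t₀ N (j + 1) h w = _ := flow_w_eq_res _
  rw [e, jetDer_two_mul, jetDer_res (map_jetDer_V δ t t₀ j hN _ h) (V_op_mem_deep δ t t₀ N _ h),
    coeff_V_op, Dx_C_mul, Dx_x, mul_one, C_smul_complex, ← Int.cast_smul_eq_zsmul ℂ]
  push_cast
  algebra with ℂ

end Uniqueness

section Evaluation

variable {F : Type*} [CommRing F]

/-! ### Uniqueness of the vector field of a point symmetry -/

theorem derivation_evalW {U : Derivation F (DiffPoly F) (DiffPoly F)}
    (hx : U (MvPolynomial.X Coord.x) = 0) (hy : U (MvPolynomial.X Coord.y) = 0)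
    (hK : U (MvPolynomial.X (Coord.K 0 0)) = 0) (v : PFun F) : U (evalW v) = 0 := by
  have hw : U w = 0 := by
    rw [w, Derivation.leibniz, hK, smul_zero, zero_add]
    have := U.map_intCast (-2)
    rw [Int.cast_neg, Int.cast_ofNat] at this
    rw [this, smul_zero]
  induction v using MvPolynomial.induction_on with
  | C a => rw [evalW_C]; exact U.map_algebraMap a
  | add p q hp hq => rw [map_add, map_add, hp, hq, add_zero]
  | mul_X p v hp =>
    have hv : U (evalW (MvPolynomial.X v)) = 0 := by
      rcases v with _ | _ | _
      · rw [evalW_x, hx]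
      · rw [evalW_y, hy]
      · rw [evalW_w, hw]
    rw [map_mul, Derivation.leibniz, hp, hv, smul_zero, smul_zero, add_zero]

theorem jetDer_evalW_mul (j : ℕ) (v : PFun F) (p : DiffPoly F) :
    jetDer (j + 1) (evalW v * p) = evalW v * jetDer (j + 1) p := by
  rw [Derivation.leibniz, derivation_evalW (jetDer_x _) (jetDer_y _) (by
    rw [jetDer_K, if_neg (by omega)]), smul_zero, add_zero, smul_eq_mul]

theorem jetDer_evalW (j : ℕ) (v : PFun F) : jetDer (j + 1) (evalW v) = 0 := by
  have := jetDer_evalW_mul j v 1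
  rwa [Derivation.map_one_eq_zero, mul_zero, mul_one] at this

theorem jetDer_res_op_one_of_le {j n : ℕ} (h : n ≤ j) :
    jetDer j (res (op (1 : DiffPoly F) n)) = 0 :=
  jetDer_res_of_le (map_op_one _ _) (by exact_mod_cast h) (op_mem_deep _ _)

theorem jetDer_res_op_one (j : ℕ) :
    jetDer j (res (op (1 : DiffPoly F) (j + 1 : ℕ))) = -(j + 1 : DiffPoly F) := by
  rw [Nat.cast_succ, jetDer_res (map_op_one _ _) (op_mem_deep _ _), coeff_op, if_pos rfl,
    one_mul, Dx_x, zsmul_eq_mul, mul_one]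
  push_cast
  rfl

end Evaluation

section Uniqueness

variable {F : Type*} [CommRing F] [Algebra ℂ F]

theorem evalW_injective : Function.Injective (evalW : PFun F →ₐ[F] DiffPoly F) := by
  let r : DiffPoly F →ₐ[F] PFun F := MvPolynomial.aeval fun v => match v with
    | .x => MvPolynomial.X PCoord.x
    | .y => MvPolynomial.X PCoord.y
    | .K _ _ => (-2⁻¹ : ℂ) • MvPolynomial.X PCoord.w
  have h : r.comp evalW = AlgHom.id F _ := by
    apply MvPolynomial.algHom_ext
    rintro (_ | _ | _)
    · rw [AlgHom.comp_apply, evalW_x]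
      exact MvPolynomial.aeval_X _ _
    · rw [AlgHom.comp_apply, evalW_y]
      exact MvPolynomial.aeval_X _ _
    · rw [AlgHom.comp_apply, evalW_w, w, map_mul, map_neg, map_ofNat,
        show r (MvPolynomial.X (Coord.K 0 0)) = (-2⁻¹ : ℂ) • MvPolynomial.X PCoord.w from
          MvPolynomial.aeval_X _ _, AlgHom.id_apply]
      algebra with ℂ
  intro a b hab
  have := congrArg r hab
  rwa [← AlgHom.comp_apply, ← AlgHom.comp_apply, h] at this

theorem smul_eq_zero_of_ne {M : Type*} [AddCommGroup M] [Module ℂ M] {c : ℂ} (hc : c ≠ 0) {m : M}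
    (h : c • m = 0) : m = 0 := (IsUnit.mk0 c hc).smul_eq_zero.1 h

variable {δ : Derivation ℂ F F} {N : ℕ}

theorem dt_coeff_eq_zero (hN : 3 ≤ N) {v₁ v₂ vN p : PFun F}
    (h : jetDer (N - 1) (evalW v₁ * Dx w + evalW v₂ * Dy w + evalW vN * Dt δ N w - evalW p) = 0) :
    vN = 0 := by
  obtain ⟨j, rfl⟩ : ∃ j, N = j + 2 + 1 := ⟨N - 3, by omega⟩
  rw [Nat.add_sub_cancel] at h
  rw [map_sub, map_add, map_add, jetDer_evalW_mul, jetDer_evalW_mul, jetDer_evalW_mul,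
    jetDer_evalW, Dx_w, Dy_w, Dt_w, jetDer_two_mul, jetDer_two_mul, jetDer_two_mul,
    show (1 : ℤ) = (1 : ℕ) by rfl, show (2 : ℤ) = (2 : ℕ) by rfl,
    jetDer_res_op_one_of_le (by omega), jetDer_res_op_one_of_le (by omega),
    jetDer_res_op_one, mul_zero, mul_zero, mul_zero, zero_add, zero_add, sub_zero] at h
  apply evalW_injective
  rw [map_zero]
  refine smul_eq_zero_of_ne (c := -2 * (j + 2 + 1 : ℕ)) ?_ (Eq.trans ?_ h)
  · exact mul_ne_zero (by norm_num) (Nat.cast_ne_zero.2 (by omega))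
  · push_cast
    algebra with ℂ

theorem eq_zero_of_symmetry_eq_zero (hN : 3 ≤ N) {v₁ v₂ vN p : PFun F}
    (h : evalW v₁ * Dx w + evalW v₂ * Dy w + evalW vN * Dt δ N w - evalW p = 0) :
    v₁ = 0 ∧ v₂ = 0 ∧ vN = 0 ∧ p = 0 := by
  have hvN : vN = 0 := dt_coeff_eq_zero hN (by rw [h, map_zero])
  subst hvN
  rw [map_zero, zero_mul, add_zero] at h
  have h1 := congrArg (jetDer 1) h
  rw [map_zero, map_sub, map_add, jetDer_evalW_mul, jetDer_evalW_mul,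
    jetDer_evalW, Dx_w, Dy_w, jetDer_two_mul, jetDer_two_mul,
    show (1 : ℤ) = (1 : ℕ) by rfl, show (2 : ℤ) = (1 + 1 : ℕ) by rfl,
    jetDer_res_op_one_of_le (by omega), jetDer_res_op_one, mul_zero, mul_zero, zero_add,
    sub_zero] at h1
  have hv₂ : v₂ = 0 := by
    apply evalW_injective
    rw [map_zero]
    refine smul_eq_zero_of_ne (c := -4) (by norm_num) (Eq.trans ?_ h1)
    push_cast
    algebra with ℂ
  subst hv₂
  rw [map_zero, zero_mul, add_zero] at h
  have h2 := congrArg (MvPolynomial.pderiv (Coord.K 0 1)) h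
  have hx : ∀ v : PFun F, MvPolynomial.pderiv (Coord.K 0 1) (evalW v) = 0 :=
    derivation_evalW (MvPolynomial.pderiv_X_of_ne (by simp))
      (MvPolynomial.pderiv_X_of_ne (by simp)) (MvPolynomial.pderiv_X_of_ne (by simp))
  have hw : MvPolynomial.pderiv (Coord.K 0 1) (Dx w : DiffPoly F) = (-2 : ℂ) • 1 := by
    rw [w_eq, Dx_smul, Dx_K]
    exact (((MvPolynomial.pderiv (Coord.K 0 1)).restrictScalars ℂ).map_smul _ _).trans
      (congrArg _ (MvPolynomial.pderiv_X_self _))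
  rw [map_zero, map_sub, Derivation.leibniz, hx, hx, hw, smul_zero, add_zero, sub_zero,
    smul_eq_mul, mul_smul_comm, mul_one] at h2
  have hv₁ : v₁ = 0 := by
    apply evalW_injective
    rw [map_zero]
    exact smul_eq_zero_of_ne (by norm_num) h2
  subst hv₁
  rw [map_zero, zero_mul, zero_sub, neg_eq_zero] at h
  exact ⟨rfl, rfl, rfl, evalW_injective (h.trans (map_zero _).symm)⟩

theorem Represents.sub {U₁ U₂ : Derivation ℂ (DiffPoly F) (DiffPoly F)}
    {Z₁ Z₂ : Derivation ℂ (PFun F) (PFun F)}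
    (h₁ : Represents δ N U₁ Z₁) (h₂ : Represents δ N U₂ Z₂) :
    Represents δ N (U₁ - U₂) (Z₁ - Z₂) := by
  obtain ⟨v₁, v₂, vN, p, rfl, e⟩ := h₁
  obtain ⟨v₁', v₂', vN', p', rfl, e'⟩ := h₂
  refine ⟨v₁ - v₁', v₂ - v₂', vN - vN', p - p', ?_, ?_⟩
  · apply derivation_ext_coords
    · intro a
      simp only [Derivation.sub_apply, pointField_C, sub_mul]
    · rintro (_ | _ | _) <;>
      simp only [Derivation.sub_apply, pointField_x, pointField_y, pointField_w]
  · simp only [Derivation.sub_apply, e, e', map_sub]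
    ring

theorem Represents.eq_zero (hN : 3 ≤ N) {U : Derivation ℂ (DiffPoly F) (DiffPoly F)}
    {Z : Derivation ℂ (PFun F) (PFun F)} (h : Represents δ N U Z) (hU : U w = 0) : Z = 0 := by
  obtain ⟨v₁, v₂, vN, p, rfl, e⟩ := h
  obtain ⟨rfl, rfl, rfl, rfl⟩ := eq_zero_of_symmetry_eq_zero hN (e.symm.trans hU)
  simp only [pointField, zero_smul, add_zero]

/-- The vector field of a point symmetry is determined by the symmetry. -/
theorem Represents.unique (hN : 3 ≤ N) {U U' : Derivation ℂ (DiffPoly F) (DiffPoly F)}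
    {Z Z' : Derivation ℂ (PFun F) (PFun F)} (h : Represents δ N U Z) (h' : Represents δ N U' Z')
    (hU : U w = U' w) : Z = Z' :=
  sub_eq_zero.1 ((h.sub h').eq_zero hN (by rw [Derivation.sub_apply, hU, sub_self]))

end Uniqueness

section Classification

variable {F : Type*} [CommRing F] [Algebra ℂ F] (δ : Derivation ℂ F F) (t : F) (t₀ : ℂ)

/-! ### Classification of the point symmetries -/

theorem taylorCoeff_add (h h' : F) (k : ℕ) :
    taylorCoeff δ (h + h') k = taylorCoeff δ h k + taylorCoeff δ h' k := by
  rw [taylorCoeff, iterate_map_add, smul_add, map_add]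
  rfl

theorem taylorCoeff_smul (c : ℂ) (h : F) (k : ℕ) :
    taylorCoeff δ (c • h) k = c • taylorCoeff δ h k := by
  have : (δ : F → F)^[k] (c • h) = c • (δ : F → F)^[k] h := by
    induction k generalizing h with
    | zero => rfl
    | succ k ih => rw [Function.iterate_succ_apply, Derivation.map_smul, ih]; rfl
  rw [taylorCoeff, this, smul_comm, C_smul_complex]
  rfl

theorem le_sub_two_mul_toNat {N : ℕ} (hN : 3 ≤ N) (n : ℤ) : n ≤ (N - 2) * (n.toNat : ℕ) := by
  have h1 : (1 : ℤ) ≤ N - 2 := by omega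
  have h2 := mul_le_mul_of_nonneg_right h1 (Int.natCast_nonneg n.toNat)
  have h3 := Int.self_le_toNat n
  linarith

/-- The value of the flow `V^N(α, h)` on `w`, as a linear function of `h`. -/
def flowValue {N : ℕ} (hN : 3 ≤ N) (α : ℤ) : F →ₗ[ℂ] DiffPoly F where
  toFun h := V δ t t₀ N α h w
  map_add' h h' := by
    have hM := le_sub_two_mul_toNat hN (α + 2)
    rw [res_V δ t t₀ hN _ _ _ hM, res_V δ t t₀ hN _ _ _ hM, res_V δ t t₀ hN _ _ _ hM, ← mul_add,
      ← Finset.sum_add_distrib]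
    simp only [taylorCoeff_add, add_mul]
  map_smul' c h := by
    have hM := le_sub_two_mul_toNat hN (α + 2)
    rw [res_V δ t t₀ hN _ _ _ hM, res_V δ t t₀ hN _ _ _ hM, RingHom.id_apply, ← mul_smul_comm,
      Finset.smul_sum]
    simp only [taylorCoeff_smul, smul_mul_assoc]

variable {δ t t₀} {N : ℕ}

/-- On `w`, a linear combination of the flows is a sum over the finitely many `α` with
`-1 ≤ α ≤ N`. -/
theorem exists_flow_sum (hN : 3 ≤ N) {U : Derivation ℂ (DiffPoly F) (DiffPoly F)}
    (hU : U ∈ Submodule.span ℂ {U | ∃ α : ℤ, α ≤ N ∧ ∃ h : F, U = V δ t t₀ N α h}) :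
    ∃ g : ℤ → F, U w = ∑ α ∈ Finset.Icc (-1 : ℤ) N, flowValue δ t t₀ hN α (g α) := by
  induction hU using Submodule.span_induction with
  | mem U h =>
    obtain ⟨α, hα, h, rfl⟩ := h
    refine ⟨fun β => if β = α then h else 0, ?_⟩
    by_cases h1 : α ≤ -2
    · rw [V_w_of_le δ t t₀ hN h1, Finset.sum_eq_zero]
      intro β hβ
      have h2 : β ≠ α := by
        rw [Finset.mem_Icc] at hβ
        omega
      simp only [if_neg h2, map_zero]
    · rw [Finset.sum_eq_single α]
      · simp only
        rfl
      · intro β _ hβ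
        simp only [if_neg hβ, map_zero]
      · intro h2
        exact absurd (Finset.mem_Icc.2 ⟨by omega, hα⟩) h2
  | zero => exact ⟨0, by simp⟩
  | add U U' _ _ h h' =>
    obtain ⟨g, e⟩ := h
    obtain ⟨g', e'⟩ := h'
    refine ⟨g + g', ?_⟩
    rw [Derivation.add_apply, e, e', ← Finset.sum_add_distrib]
    simp only [Pi.add_apply, map_add]
  | smul c U _ h =>
    obtain ⟨g, e⟩ := h
    refine ⟨c • g, ?_⟩
    rw [Derivation.smul_apply, e, Finset.smul_sum]
    simp only [Pi.smul_apply, map_smul]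

theorem curField_add (a b c e a' b' c' e' : F) :
    curField δ t₀ N a b c e + curField δ t₀ N a' b' c' e' =
      curField δ t₀ N (a + a') (b + b') (c + c') (e + e') := by
  rw [curField, curField, curField, ← loopField_add]
  congr 1
  ext i
  fin_cases i <;> simp only [curParam, Fin.zero_eta, Fin.mk_one, Fin.reduceFinMk,
        Matrix.cons_val, Pi.add_apply, map_add] <;> algebra with ℂ

theorem curField_smul (r : ℂ) (a b c e : F) :
    r • curField δ t₀ N a b c e = curField δ t₀ N (r • a) (r • b) (r • c) (r • e) := by
  rw [curField, curField, ← loopField_smul]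
  congr 1
  ext i
  fin_cases i <;> simp only [curParam, Fin.zero_eta, Fin.mk_one, Fin.reduceFinMk,
        Matrix.cons_val, Pi.smul_apply, Derivation.map_smul] <;> algebra with ℂ

theorem represents_curField (hN : 3 ≤ N) (a b c e : F) :
    Represents δ N (V δ t t₀ N 2 a + V δ t t₀ N 1 b + V δ t t₀ N 0 c + V δ t t₀ N (-1) e)
      (curField δ t₀ N a b c e) := by
  have := (((represents_curField_two δ t t₀ hN a).add (represents_curField_one δ t t₀ hN b)).add
    (represents_curField_zero δ t t₀ hN c)).add (represents_curField_neg_one δ t t₀ hN e)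
  simpa only [curField_add, add_zero, zero_add] using this

/-- Terms with `3 ≤ α < N` are absent in a linear combination that is a point symmetry. -/
theorem coeff_eq_zero_of_represents (hN : 3 ≤ N) {U : Derivation ℂ (DiffPoly F) (DiffPoly F)}
    {Z : Derivation ℂ (PFun F) (PFun F)} (hZ : Represents δ N U Z) {g : ℤ → F}
    (hU : U w = ∑ α ∈ Finset.Ico (-1 : ℤ) N, flowValue δ t t₀ hN α (g α)) (m : ℕ) (hm : 3 ≤ m)
    (hmN : m < N) : g m = 0 := by
  obtain ⟨v₁, v₂, vN, p, rfl, e⟩ := hZ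
  have hvN : vN = 0 := by
    refine dt_coeff_eq_zero (δ := δ) hN (v₁ := v₁) (v₂ := v₂) (p := p) ?_
    rw [← e, hU, map_sum, Finset.sum_eq_zero]
    intro α hα
    rw [Finset.mem_Ico] at hα
    exact jetDer_V_of_le δ t t₀ hN (by omega) (g α)
  subst hvN
  obtain ⟨d, hd⟩ : ∃ d, m + d = N := ⟨N - m, by omega⟩
  induction d using Nat.strong_induction_on generalizing m with
  | _ d ih =>
    obtain ⟨j, rfl⟩ : ∃ j, m = j + 2 + 1 := ⟨m - 3, by omega⟩
    have h1 : jetDer (j + 2) (U w) = 0 := by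
      rw [e, map_zero, zero_mul, add_zero, map_sub, map_add, jetDer_evalW_mul, jetDer_evalW_mul,
        jetDer_evalW, Dx_w, Dy_w, jetDer_two_mul, jetDer_two_mul,
        show (1 : ℤ) = (1 : ℕ) by rfl, show (2 : ℤ) = (2 : ℕ) by rfl,
        jetDer_res_op_one_of_le (by omega), jetDer_res_op_one_of_le (by omega), mul_zero, mul_zero,
        mul_zero, add_zero, sub_zero]
    rw [hU, map_sum, Finset.sum_eq_single ((j + 2 + 1 : ℕ) : ℤ)] at h1
    · have h2 := (jetDer_V δ t t₀ hN (j + 2) (g ((j + 2 + 1 : ℕ) : ℤ))).symm.trans h1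
      rw [map_eq_zero_iff _ (MvPolynomial.C_injective _ _)] at h2
      exact smul_eq_zero_of_ne (mul_ne_zero (by norm_num) (Nat.cast_add_one_ne_zero _)) h2
    · intro α hα hα'
      rw [Finset.mem_Ico] at hα
      by_cases h3 : α ≤ (j + 2 : ℕ)
      · exact jetDer_V_of_le δ t t₀ hN h3 (g α)
      · have h4 := ih (N - α.toNat) (by omega) α.toNat (by omega) (by omega) (by omega)
        rw [Int.toNat_of_nonneg (by omega)] at h4
        rw [h4, map_zero, map_zero]
    · intro h3
      exact absurd (Finset.mem_Ico.2 ⟨by omega, by omega⟩) h3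

/-- The vector fields of the point symmetries among the linear combinations of the flows. -/
theorem eq_virField_add_curField (hN : 3 ≤ N) {U : Derivation ℂ (DiffPoly F) (DiffPoly F)}
    {Z : Derivation ℂ (PFun F) (PFun F)} (hZ : Represents δ N U Z) {g : ℤ → F}
    (hU : U w = ∑ α ∈ Finset.Icc (-1 : ℤ) N, flowValue δ t t₀ hN α (g α)) :
    (∀ m : ℕ, 3 ≤ m → m < N → g m = 0) ∧
      Z = virField δ t₀ N (g N) + curField δ t₀ N (g 2) (g 1) (g 0) (g (-1)) := by
  have h1 := hZ.sub (represents_virField δ t t₀ hN (g N))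
  have h2 : (U - V δ t t₀ N N (g N)) w =
      ∑ α ∈ Finset.Ico (-1 : ℤ) N, flowValue δ t t₀ hN α (g α) := by
    rw [Derivation.sub_apply, hU, ← Finset.Ico_insert_right (by omega : (-1 : ℤ) ≤ N),
      Finset.sum_insert Finset.right_notMem_Ico]
    exact add_sub_cancel_left _ _
  have h3 := coeff_eq_zero_of_represents hN h1 h2
  refine ⟨h3, ?_⟩
  rw [← sub_eq_iff_eq_add']
  refine h1.unique hN (represents_curField (t := t) hN (g 2) (g 1) (g 0) (g (-1))) ?_
  have h4 : Finset.Ico (-1 : ℤ) 3 ⊆ Finset.Ico (-1 : ℤ) N :=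
    Finset.Ico_subset_Ico_right (by omega)
  rw [h2, ← Finset.sum_subset h4]
  · rw [show Finset.Ico (-1 : ℤ) 3 = {2, 1, 0, -1} by decide, Finset.sum_insert (by decide),
      Finset.sum_insert (by decide), Finset.sum_insert (by decide), Finset.sum_singleton,
      ← add_assoc, ← add_assoc]
    rfl
  · intro α hα hα'
    rw [Finset.mem_Ico] at hα hα'
    have h5 := h3 α.toNat (by omega) (by omega)
    rw [Int.toNat_of_nonneg (by omega)] at h5
    rw [h5, map_zero]

end Classification

section Matrices

variable {F : Type*} [CommRing F]

/-! ### Strictly upper triangular matrices -/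

/-- The matrix of the vector field `loopField` on the span of `1, y, x, y², x y, y³, w` over the
functions of `t_N`. -/
def loopMatrix (R : Type*) [CommRing R] : (Fin 9 → R) →ₗ[R] Matrix (Fin 7) (Fin 7) R where
  toFun p := !![0, p 2, p 0, 0, 0, 0, p 3;
    0, 0, p 1, 2 * p 2, p 0, 0, p 4;
    0, 0, 0, 0, p 2, 0, p 5;
    0, 0, 0, 0, p 1, 3 * p 2, p 6;
    0, 0, 0, 0, 0, 0, p 7;
    0, 0, 0, 0, 0, 0, p 8;
    0, 0, 0, 0, 0, 0, 0]
  map_add' p q := by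
    simp only [Matrix.of_add_of, Matrix.cons_add_cons, Pi.add_apply, Matrix.empty_add_empty,
      mul_add, add_zero]
  map_smul' c p := by
    simp only [Matrix.smul_of, Matrix.smul_cons, Pi.smul_apply, Matrix.smul_empty, smul_eq_mul,
      mul_zero, mul_left_comm, RingHom.id_apply]

theorem loopMatrix_apply (p : Fin 9 → F) : loopMatrix F p =
    !![0, p 2, p 0, 0, 0, 0, p 3;
      0, 0, p 1, 2 * p 2, p 0, 0, p 4;
      0, 0, 0, 0, p 2, 0, p 5;
      0, 0, 0, 0, p 1, 3 * p 2, p 6;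
      0, 0, 0, 0, 0, 0, p 7;
      0, 0, 0, 0, 0, 0, p 8;
      0, 0, 0, 0, 0, 0, 0] := rfl

theorem loopMatrix_mul (p q : Fin 9 → F) : loopMatrix F p * loopMatrix F q =
    !![0, 0, p 2 * q 1, p 2 * (2 * q 2), p 2 * q 0 + p 0 * q 2, 0, p 2 * q 4 + p 0 * q 5;
      0, 0, 0, 0, p 1 * q 2 + 2 * p 2 * q 1, 2 * p 2 * (3 * q 2),
        p 1 * q 5 + (2 * p 2 * q 6 + p 0 * q 7);
      0, 0, 0, 0, 0, 0, p 2 * q 7;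
      0, 0, 0, 0, 0, 0, p 1 * q 7 + 3 * p 2 * q 8;
      0, 0, 0, 0, 0, 0, 0;
      0, 0, 0, 0, 0, 0, 0;
      0, 0, 0, 0, 0, 0, 0] := by
  rw [loopMatrix_apply, loopMatrix_apply]
  simp only [Matrix.cons_mul, Matrix.vecMul_cons, Matrix.empty_mul, Matrix.smul_cons,
    Matrix.smul_empty, smul_eq_mul, zero_smul, Matrix.cons_add_cons, Matrix.empty_add_empty,
    zero_add, mul_zero, add_zero, Matrix.empty_vecMul, Matrix.head_cons,
    Matrix.tail_cons, Equiv.symm_apply_apply]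
  have h0 : (0 : Fin 7 → F) = ![0, 0, 0, 0, 0, 0, 0] := by
    ext i
    fin_cases i <;> rfl
  rw [h0]

theorem loopMatrix_loopBracket (p q : Fin 9 → F) : loopMatrix F (loopBracket p q) =
    loopMatrix F p * loopMatrix F q - loopMatrix F q * loopMatrix F p := by
  rw [loopMatrix_mul, loopMatrix_mul, loopMatrix_apply]
  simp only [loopBracket, Matrix.cons_val, Matrix.of_sub_of, Matrix.cons_sub_cons,
    Matrix.empty_sub_empty]
  refine congrArg Matrix.of ?_
  simp only [Matrix.vecCons_inj, and_true]
  repeat' constructor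
  all_goals ring

theorem loopMatrix_eq_zero (p : Fin 9 → F) (i j : Fin 7) (h : j ≤ i) : loopMatrix F p i j = 0 := by
  fin_cases i <;> fin_cases j <;> first | rfl | exact absurd h (by decide)

theorem loopMatrix_injective : Function.Injective (loopMatrix F) := by
  intro p q h
  have e (i j : Fin 7) : loopMatrix F p i j = loopMatrix F q i j := by rw [h]
  ext i
  fin_cases i
  exacts [e 0 2, e 1 2, e 0 1, e 0 6, e 1 6, e 2 6, e 3 6, e 4 6, e 5 6]

end Matrices

section Algebras

variable {F : Type*} [CommRing F] [Algebra ℂ F] (δ : Derivation ℂ F F) (t : F) (t₀ : ℂ) (N : ℕ)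

/-! ### Explicit Lie algebras of vector fields -/

variable (F) in
/-- The coefficients of a vector field of the form `loopField`, as a linear map. -/
def loopCoeff : Derivation ℂ (PFun F) (PFun F) →ₗ[ℂ] Fin 9 → F :=
  let ev (v : PCoord) : Derivation ℂ (PFun F) (PFun F) →ₗ[ℂ] PFun F :=
    { toFun := fun Z => Z (MvPolynomial.X v)
      map_add' := fun _ _ => rfl
      map_smul' := fun _ _ => rfl }
  let dX : PFun F →ₗ[ℂ] PFun F := ((MvPolynomial.pderiv PCoord.x).restrictScalars ℂ).toLinearMap
  let dY : PFun F →ₗ[ℂ] PFun F := ((MvPolynomial.pderiv PCoord.y).restrictScalars ℂ).toLinearMap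
  let c : PFun F →ₗ[ℂ] F := (MvPolynomial.lcoeff F 0).restrictScalars ℂ
  LinearMap.pi ![c ∘ₗ ev .x, c ∘ₗ dY ∘ₗ ev .x, c ∘ₗ ev .y, c ∘ₗ ev .w, c ∘ₗ dY ∘ₗ ev .w,
    c ∘ₗ dX ∘ₗ ev .w, (2 : ℂ)⁻¹ • (c ∘ₗ dY ∘ₗ dY ∘ₗ ev .w), c ∘ₗ dX ∘ₗ dY ∘ₗ ev .w,
    (6 : ℂ)⁻¹ • (c ∘ₗ dY ∘ₗ dY ∘ₗ dY ∘ₗ ev .w)]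

theorem loopCoeff_loopField (p : Fin 9 → F) : loopCoeff F (loopField δ p) = p := by
  classical
  ext i
  have h2 (a : F) : (2 : ℂ)⁻¹ • (2 * a) = a := by algebra with ℂ
  have h6 (a : F) : (6 : ℂ)⁻¹ • (6 * a) = a := by algebra with ℂ
  have e2 : MvPolynomial.constantCoeff (2 : PFun F) = 2 := map_ofNat _ 2
  have e3 : MvPolynomial.constantCoeff (3 : PFun F) = 3 := map_ofNat _ 3
  have e2' : MvPolynomial.pderiv PCoord.y (2 : PFun F) = 0 := Derivation.map_natCast _ 2
  fin_cases i <;>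
    simp [loopCoeff, loopField_x, loopField_y, loopField_w, ← MvPolynomial.constantCoeff_eq,
      MvPolynomial.pderiv_X, Derivation.leibniz_pow, e2, e3, e2', ← mul_assoc]
  · exact (congrArg _ (mul_comm _ _)).trans (h2 _)
  · refine Eq.trans (congrArg _ ?_) (h6 _)
    ring

theorem loopMatrix_map (p : Fin 9 → ℂ) : loopMatrix F (fun i => algebraMap ℂ F (p i)) =
    (loopMatrix ℂ p).map (algebraMap ℂ F) := by
  ext i j
  fin_cases i <;> fin_cases j <;> simp [loopMatrix, map_ofNat (algebraMap ℂ F)]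

/-- The complex coefficients of `h^{(k)}` in the coefficients, in the sense of `loopField`, of the
field of `V^N(α, h)`. -/
def curCoeff (α : ℤ) (k : ℕ) : Fin 9 → ℂ :=
  if α = 2 then
    if k = 0 then ![0, 0, 1, 0, 0, 0, 0, 0, 0]
    else if k = 1 then ![0, 2 * ind N 3 * (N : ℂ)⁻¹, 0, -2 * t₀ * ind N 3 * (N : ℂ)⁻¹,
        -4 * ind N 5 * (N : ℂ)⁻¹, -2 * ind N 4 * (N : ℂ)⁻¹, 0, 0, 0]
    else if k = 2 then ![0, 0, 0, 0, 0, 0, 0, -4 * ind N 3 * (N : ℂ)⁻¹ ^ 2, 0]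
    else ![0, 0, 0, 0, 0, 0, 0, 0, -8 / 3 * ind N 3 * (N : ℂ)⁻¹ ^ 3]
  else if α = 1 then
    if k = 0 then ![1, 0, 0, 0, 0, 0, 0, 0, 0]
    else if k = 1 then ![0, 0, 0, 0, -4 * ind N 4 * (N : ℂ)⁻¹, -2 * ind N 3 * (N : ℂ)⁻¹, 0, 0, 0]
    else if k = 2 then ![0, 0, 0, 0, 0, 0, -4 * ind N 3 * (N : ℂ)⁻¹ ^ 2, 0, 0]
    else 0
  else if α = 0 then
    if k = 1 then ![0, 0, 0, 0, -4 * ind N 3 * (N : ℂ)⁻¹, 0, 0, 0, 0]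
    else 0
  else if k = 0 then ![0, 0, 0, -2, 0, 0, 0, 0, 0]
  else 0

theorem curParam_eq_sum (a b c e : F) : curParam δ t₀ N a b c e =
    ∑ k ∈ Finset.range 4, ((δ : F → F)^[k] a • (fun i => algebraMap ℂ F (curCoeff t₀ N 2 k i)) +
      (δ : F → F)^[k] b • (fun i => algebraMap ℂ F (curCoeff t₀ N 1 k i)) +
      (δ : F → F)^[k] c • (fun i => algebraMap ℂ F (curCoeff t₀ N 0 k i)) +
      (δ : F → F)^[k] e • (fun i => algebraMap ℂ F (curCoeff t₀ N (-1) k i))) := by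
  ext i
  fin_cases i <;>
    simp [Finset.sum_range_succ, curCoeff, curParam, Algebra.smul_def, mul_comm]
  exact add_comm _ _

/-- The vector fields of the flows with `α = N`. -/
def virAlgebra : LieSubalgebra ℂ (Derivation ℂ (PFun F) (PFun F)) where
  __ := LinearMap.range (virMap δ t₀ N)
  lie_mem' := by
    rintro _ _ ⟨f, rfl⟩ ⟨g, rfl⟩
    exact ⟨_, (virField_lie δ t₀ N f g).symm⟩

theorem zero_eq_curField : (0 : Derivation ℂ (PFun F) (PFun F)) = curField δ t₀ N 0 0 0 0 := by
  have := curField_smul (δ := δ) (t₀ := t₀) (N := N) 0 0 0 0 0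
  rwa [zero_smul, smul_zero] at this

/-- The vector fields of the flows with `α = 2, 1, 0, -1`. -/
def curAlgebra : LieSubalgebra ℂ (Derivation ℂ (PFun F) (PFun F)) where
  carrier := {Z | ∃ a b c e : F, Z = curField δ t₀ N a b c e}
  add_mem' := by
    rintro _ _ ⟨a, b, c, e, rfl⟩ ⟨a', b', c', e', rfl⟩
    exact ⟨_, _, _, _, curField_add ..⟩
  zero_mem' := ⟨0, 0, 0, 0, zero_eq_curField ..⟩
  smul_mem' := by
    rintro r _ ⟨a, b, c, e, rfl⟩
    exact ⟨_, _, _, _, curField_smul ..⟩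
  lie_mem' := by
    rintro _ _ ⟨a, b, c, e, rfl⟩ ⟨a', b', c', e', rfl⟩
    exact ⟨_, _, _, _, curField_lie ..⟩

theorem virField_lie_mem {Y : Derivation ℂ (PFun F) (PFun F)} (hY : Y ∈ curAlgebra δ t₀ N)
    (f : F) : ⁅virField δ t₀ N f, Y⁆ ∈ curAlgebra δ t₀ N := by
  obtain ⟨a, b, c, e, rfl⟩ := hY
  exact ⟨_, _, _, _, virField_lie_curField ..⟩

/-- The semidirect sum of the two algebras. -/
def symAlgebra : LieSubalgebra ℂ (Derivation ℂ (PFun F) (PFun F)) where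
  __ := (virAlgebra δ t₀ N).toSubmodule ⊔ (curAlgebra δ t₀ N).toSubmodule
  lie_mem' := by
    intro Z Z' hZ hZ'
    obtain ⟨_, ⟨f, rfl⟩, Y, hY, rfl⟩ := Submodule.mem_sup.1 hZ
    obtain ⟨_, ⟨g, rfl⟩, Y', hY', rfl⟩ := Submodule.mem_sup.1 hZ'
    refine Submodule.mem_sup.2 ⟨_, (virAlgebra δ t₀ N).lie_mem ⟨f, rfl⟩ ⟨g, rfl⟩,
      ⁅virField δ t₀ N f, Y'⁆ - ⁅virField δ t₀ N g, Y⁆ + ⁅Y, Y'⁆,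
      add_mem (sub_mem (virField_lie_mem δ t₀ N hY' f) (virField_lie_mem δ t₀ N hY g))
        ((curAlgebra δ t₀ N).lie_mem hY hY'), ?_⟩
    rw [add_lie, lie_add, lie_add, ← lie_skew (virField δ t₀ N g) Y]
    change _ = ⁅virField δ t₀ N f, virField δ t₀ N g⁆ + _ + _
    simp only [virMap, LinearMap.coe_mk, AddHom.coe_mk]
    abel

end Algebras

section Parts

variable {F : Type*} [CommRing F] [Algebra ℂ F] {δ : Derivation ℂ F F} {t : F} {t₀ : ℂ} {N : ℕ}

/-! ### The semidirect sum and its loop realization -/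

theorem virMap_injective (ht : δ t = 1) : Function.Injective (virMap δ t₀ N) := by
  intro f g h
  have := Derivation.congr_fun h (MvPolynomial.C t)
  change virField δ t₀ N f _ = virField δ t₀ N g _ at this
  rw [virField_C, virField_C, ht, mul_one, mul_one] at this
  exact MvPolynomial.C_injective _ _ this

theorem V_zero_w (hN : 3 ≤ N) (α : ℤ) : V δ t t₀ N α 0 w = 0 :=
  map_zero (flowValue δ t t₀ hN α)

/-- A point symmetry with zero vector field vanishes on `w`. -/
theorem Represents.apply_w_eq_zero (ht : δ t = 1) {U : Derivation ℂ (DiffPoly F) (DiffPoly F)}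
    (h : Represents δ N U 0) : U w = 0 := by
  obtain ⟨v₁, v₂, vN, p, e, e'⟩ := h
  have hx := pointField_x δ v₁ v₂ vN p
  have hy := pointField_y δ v₁ v₂ vN p
  have hw := pointField_w δ v₁ v₂ vN p
  have ht' := pointField_C δ v₁ v₂ vN p t
  rw [← e, Derivation.coe_zero, Pi.zero_apply] at hx hy hw ht'
  rw [ht, map_one, mul_one] at ht'
  subst hx hy hw ht'
  simpa using e'

theorem curField_zero_of_ne (hN : N ≠ 3) (c : F) : curField δ t₀ N 0 0 c 0 = 0 := by
  rw [zero_eq_curField δ t₀ N, curField, curField]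
  congr 1
  simp [curParam, ind_of_ne hN]

theorem curField_zero_of_const {c : F} (hc : δ c = 0) : curField δ t₀ N 0 0 c 0 = 0 := by
  rw [zero_eq_curField δ t₀ N, curField, curField]
  congr 1
  simp [curParam, hc]

theorem virasoroPart_eq (hN : 3 ≤ N) : virasoroPart δ t t₀ N = virAlgebra δ t₀ N := by
  apply le_antisymm
  · refine LieSubalgebra.lieSpan_le.2 ?_
    rintro Z ⟨h, hZ⟩
    exact ⟨h, (represents_virField δ t t₀ hN h).unique hN hZ rfl⟩
  · rintro _ ⟨f, rfl⟩
    exact LieSubalgebra.subset_lieSpan ⟨f, represents_virField δ t t₀ hN f⟩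

theorem currentPart_eq (hN : 3 ≤ N) : currentPart δ t t₀ N = curAlgebra δ t₀ N := by
  apply le_antisymm
  · refine LieSubalgebra.lieSpan_le.2 ?_
    rintro Z ⟨α, hα, h, hZ⟩
    rcases hα with rfl | rfl | rfl | ⟨rfl, -⟩
    · exact ⟨_, _, _, _, hZ.unique hN (represents_curField_two δ t t₀ hN h) rfl⟩
    · exact ⟨_, _, _, _, hZ.unique hN (represents_curField_one δ t t₀ hN h) rfl⟩
    · exact ⟨_, _, _, _, hZ.unique hN (represents_curField_neg_one δ t t₀ hN h) rfl⟩
    · exact ⟨_, _, _, _, hZ.unique hN (represents_curField_zero δ t t₀ hN h) rfl⟩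
  · rintro _ ⟨a, b, c, e, rfl⟩
    have h2 : curField δ t₀ N a 0 0 0 ∈ currentPart δ t t₀ N :=
      LieSubalgebra.subset_lieSpan ⟨2, Or.inl rfl, a, represents_curField_two δ t t₀ hN a⟩
    have h1 : curField δ t₀ N 0 b 0 0 ∈ currentPart δ t t₀ N :=
      LieSubalgebra.subset_lieSpan ⟨1, Or.inr (Or.inl rfl), b, represents_curField_one δ t t₀ hN b⟩
    have h0 : curField δ t₀ N 0 0 c 0 ∈ currentPart δ t t₀ N := by
      by_cases h3 : N = 3
      · exact LieSubalgebra.subset_lieSpan ⟨0, Or.inr (Or.inr (Or.inr ⟨rfl, h3⟩)), c,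
          represents_curField_zero δ t t₀ hN c⟩
      · rw [curField_zero_of_ne h3]
        exact zero_mem _
    have h1' : curField δ t₀ N 0 0 0 e ∈ currentPart δ t t₀ N :=
      LieSubalgebra.subset_lieSpan ⟨-1, Or.inr (Or.inr (Or.inl rfl)), e,
        represents_curField_neg_one δ t t₀ hN e⟩
    have h : curField δ t₀ N a b c e = curField δ t₀ N a 0 0 0 + curField δ t₀ N 0 b 0 0 +
        curField δ t₀ N 0 0 c 0 + curField δ t₀ N 0 0 0 e := by
      simp only [curField_add, add_zero, zero_add]
    rw [h]
    exact add_mem (add_mem (add_mem h2 h1) h0) h1'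

theorem IsKPSymmetry.add {U U' : Derivation ℂ (DiffPoly F) (DiffPoly F)}
    (h : IsKPSymmetry δ N U) (h' : IsKPSymmetry δ N U') : IsKPSymmetry δ N (U + U') := by
  obtain ⟨h1, h2, h3, h4, h5, h6⟩ := h
  obtain ⟨h1', h2', h3', h4', h5', h6'⟩ := h'
  refine ⟨fun a => ?_, ?_, ?_, ?_, ?_, ?_⟩
  · rw [Derivation.add_apply, h1, h1', add_zero]
  · rw [Derivation.add_apply, h2, h2', add_zero]
  · rw [Derivation.add_apply, h3, h3', add_zero]
  · exact (add_lie U U' _).trans ((congrArg₂ (· + ·) h4 h4').trans (add_zero 0))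
  · exact (add_lie U U' _).trans ((congrArg₂ (· + ·) h5 h5').trans (add_zero 0))
  · exact (add_lie U U' _).trans ((congrArg₂ (· + ·) h6 h6').trans (add_zero 0))

/-- The vector fields of point symmetries form the semidirect sum of the two algebras. -/
theorem mem_symAlgebra_iff (hN : 3 ≤ N) (Z : Derivation ℂ (PFun F) (PFun F)) :
    Z ∈ symAlgebra δ t₀ N ↔
      ∃ U ∈ Submodule.span ℂ {U | ∃ α : ℤ, α ≤ N ∧ ∃ h : F, U = V δ t t₀ N α h},
        IsKPSymmetry δ N U ∧ Represents δ N U Z := by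
  constructor
  · intro hZ
    obtain ⟨_, ⟨f, rfl⟩, _, ⟨a, b, c, e, rfl⟩, rfl⟩ := Submodule.mem_sup.1 hZ
    have hs (α : ℤ) (hα : α ≤ N) (h : F) := Submodule.subset_span (R := ℂ)
      (s := {U | ∃ α : ℤ, α ≤ N ∧ ∃ h : F, U = V δ t t₀ N α h}) ⟨α, hα, h, rfl⟩
    refine ⟨_, add_mem (hs N le_rfl f) (add_mem (add_mem (add_mem (hs 2 (by omega) a)
      (hs 1 (by omega) b)) (hs 0 (by omega) c)) (hs (-1) (by omega) e)), ?_,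
      (represents_virField δ t t₀ hN f).add (represents_curField hN a b c e)⟩
    have hv := isKPSymmetry_V δ t t₀ N hN
    exact (hv N f).add ((((hv 2 a).add (hv 1 b)).add (hv 0 c)).add (hv (-1) e))
  · rintro ⟨U, hU, -, hZ⟩
    obtain ⟨g, hg⟩ := exists_flow_sum hN hU
    rw [(eq_virField_add_curField hN hZ hg).2]
    exact Submodule.mem_sup.2 ⟨_, ⟨g N, rfl⟩, _, ⟨_, _, _, _, rfl⟩, rfl⟩

theorem pointAlgebra_eq (hN : 3 ≤ N) : pointAlgebra δ t t₀ N = symAlgebra δ t₀ N := by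
  have h : {Z | ∃ U ∈ Submodule.span ℂ {U | ∃ α : ℤ, α ≤ N ∧ ∃ h : F, U = V δ t t₀ N α h},
      IsKPSymmetry δ N U ∧ Represents δ N U Z} = (symAlgebra δ t₀ N : Set _) :=
    Set.ext fun Z => (mem_symAlgebra_iff hN Z).symm
  rw [pointAlgebra, h, LieSubalgebra.lieSpan_eq]

theorem lie_mem_curAlgebra {Z Y : Derivation ℂ (PFun F) (PFun F)} (hZ : Z ∈ symAlgebra δ t₀ N)
    (hY : Y ∈ curAlgebra δ t₀ N) : ⁅Z, Y⁆ ∈ curAlgebra δ t₀ N := by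
  obtain ⟨_, ⟨f, rfl⟩, Y', hY', rfl⟩ := Submodule.mem_sup.1 hZ
  refine (add_lie (virField δ t₀ N f) Y' Y).symm ▸ ?_
  exact add_mem (virField_lie_mem δ t₀ N hY f) ((curAlgebra δ t₀ N).lie_mem hY' hY)

theorem disjoint_parts (ht : δ t = 1) :
    Disjoint (virAlgebra δ t₀ N).toSubmodule (curAlgebra δ t₀ N).toSubmodule := by
  rw [Submodule.disjoint_def]
  rintro _ ⟨f, rfl⟩ ⟨a, b, c, e, h⟩
  have h1 := Derivation.congr_fun h (MvPolynomial.C t)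
  rw [curField, loopField_C] at h1
  change virField δ t₀ N f _ = 0 at h1
  rw [virField_C, ht, mul_one, map_eq_zero_iff _ (MvPolynomial.C_injective _ _)] at h1
  rw [h1, map_zero]

/-- The derivative of a power of an invertible time. -/
theorem derivation_zpow {u : Fˣ} (hu : δ (u : F) = 1) (n : ℤ) :
    δ ((u ^ n : Fˣ) : F) = (n : ℂ) • ((u ^ (n - 1) : Fˣ) : F) := by
  have e (m : ℤ) : (u : F) * ((u ^ (m - 1) : Fˣ) : F) = ((u ^ m : Fˣ) : F) := by
    rw [← Units.val_mul, ← zpow_one_add, add_sub_cancel]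
  induction n using Int.induction_on with
  | zero => simp
  | succ n ih =>
    rw [zpow_add_one, Units.val_mul, Derivation.leibniz, ih, hu, smul_eq_mul, smul_eq_mul,
      mul_smul_comm, e, add_sub_cancel_right]
    push_cast
    algebra with ℂ
  | pred n ih =>
    rw [← e, Derivation.leibniz, hu, smul_eq_mul, smul_eq_mul, mul_one] at ih
    refine u.isUnit.mul_left_cancel ?_
    rw [mul_smul_comm, e]
    refine (eq_sub_of_add_eq ih).trans ?_
    push_cast
    algebra with ℂ

/-- The loop matrices of the current fields. -/
def loopHom : curAlgebra δ t₀ N →ₗ[ℂ] Matrix (Fin 7) (Fin 7) F :=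
  (loopMatrix F).restrictScalars ℂ ∘ₗ loopCoeff F ∘ₗ (curAlgebra δ t₀ N).toSubmodule.subtype

theorem loopHom_apply (Z : curAlgebra δ t₀ N) {a b c e : F}
    (hZ : (Z : Derivation ℂ (PFun F) (PFun F)) = curField δ t₀ N a b c e) :
    loopHom Z = loopMatrix F (curParam δ t₀ N a b c e) :=
  congrArg (loopMatrix F) ((congrArg (loopCoeff F) hZ).trans (loopCoeff_loopField δ _))

theorem loopHom_injective : Function.Injective (loopHom (δ := δ) (t₀ := t₀) (N := N)) := by
  intro Y Z h
  obtain ⟨a, b, c, e, hY⟩ := Y.2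
  obtain ⟨a', b', c', e', hZ⟩ := Z.2
  rw [loopHom_apply Y hY, loopHom_apply Z hZ] at h
  apply Subtype.ext
  rw [hY, hZ, curField, curField, loopMatrix_injective h]

theorem loopHom_lie (Y Z : curAlgebra δ t₀ N) :
    loopHom ⁅Y, Z⁆ = loopHom Y * loopHom Z - loopHom Z * loopHom Y := by
  obtain ⟨a, b, c, e, hY⟩ := Y.2
  obtain ⟨a', b', c', e', hZ⟩ := Z.2
  have h : loopCoeff F (⁅(Y : Derivation ℂ (PFun F) (PFun F)), (Z : Derivation ℂ _ _)⁆) =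
      loopBracket (curParam δ t₀ N a b c e) (curParam δ t₀ N a' b' c' e') := by
    rw [hY, hZ, curField, curField, loopField_lie, loopCoeff_loopField]
  rw [loopHom_apply Y hY, loopHom_apply Z hZ, ← loopMatrix_loopBracket, ← h]
  rfl

theorem loopHom_eq_zero (Z : curAlgebra δ t₀ N) (i j : Fin 7) (h : j ≤ i) : loopHom Z i j = 0 :=
  loopMatrix_eq_zero _ i j h

/-- The `k`-th term of the lower central series lies on the diagonals above the `k`-th one. -/
theorem loopHom_eq_zero_of_mem_lcs (k : ℕ) : ∀ Z : curAlgebra δ t₀ N,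
    Z ∈ LieModule.lowerCentralSeries ℂ (curAlgebra δ t₀ N) (curAlgebra δ t₀ N) k →
      ∀ i j : Fin 7, (j : ℕ) ≤ i + k → loopHom Z i j = 0 := by
  induction k with
  | zero => exact fun Z _ i j h => loopHom_eq_zero Z i j h
  | succ k ih =>
    intro Z hZ
    rw [LieModule.lowerCentralSeries_succ, ← LieSubmodule.mem_toSubmodule,
      LieSubmodule.lieIdeal_oper_eq_linear_span'] at hZ
    induction hZ using Submodule.span_induction with
    | mem Z h =>
      obtain ⟨X, -, Y, hY, rfl⟩ := h
      intro i j hij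
      rw [loopHom_lie, Matrix.sub_apply, Matrix.mul_apply, Matrix.mul_apply, Finset.sum_eq_zero,
        Finset.sum_eq_zero, sub_zero]
      · intro l _
        by_cases h : (l : ℕ) ≤ i + k
        · rw [ih Y hY i l h, zero_mul]
        · rw [loopHom_eq_zero X l j (by rw [Fin.le_def]; omega), mul_zero]
      · intro l _
        by_cases h : (l : ℕ) ≤ i
        · rw [loopHom_eq_zero X i l h, zero_mul]
        · rw [ih Y hY l j (by omega), mul_zero]
    | zero => intro i j _; rw [map_zero, Matrix.zero_apply]
    | add Y Z _ _ hY hZ =>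
      intro i j h
      rw [map_add, Matrix.add_apply, hY i j h, hZ i j h, add_zero]
    | smul c Y _ hY =>
      intro i j h
      rw [map_smul, Matrix.smul_apply, hY i j h, smul_zero]

theorem isNilpotent_curAlgebra : LieRing.IsNilpotent (curAlgebra δ t₀ N) := by
  rw [LieRing.IsNilpotent, LieModule.isNilpotent_iff ℂ]
  refine ⟨6, (LieSubmodule.eq_bot_iff _).2 fun Z hZ => loopHom_injective ?_⟩
  ext i j
  rw [map_zero, Matrix.zero_apply, loopHom_eq_zero_of_mem_lcs 6 Z hZ i j (by omega)]

/-- The criterion for a single flow to be a nonvanishing point symmetry. -/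
theorem isLiePointSymmetry_V_iff (ht : δ t = 1) (hN : 3 ≤ N) {α : ℤ} (hα : α ≤ N) (h : F) :
    (IsLiePointSymmetry δ N (V δ t t₀ N α h) ∧ V δ t t₀ N α h w ≠ 0) ↔
      ((α = N ∨ α = 2 ∨ α = 1 ∨ α = -1) ∧ h ≠ 0) ∨ (α = 0 ∧ N = 3 ∧ δ h ≠ 0) := by
  constructor
  · rintro ⟨⟨-, Z, hZ⟩, hw⟩
    have hh : h ≠ 0 := by
      rintro rfl
      exact hw (V_zero_w hN α)
    have h1 : -1 ≤ α := by
      by_contra h1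
      exact hw (V_w_of_le δ t t₀ hN (by omega) h)
    by_cases h0 : α = 0
    · subst h0
      have h2 := represents_curField_zero δ t t₀ hN h
      refine Or.inr ⟨rfl, ?_, fun h3 => ?_⟩
      · by_contra h3
        rw [curField_zero_of_ne h3] at h2
        exact hw (h2.apply_w_eq_zero ht)
      · rw [curField_zero_of_const h3] at h2
        exact hw (h2.apply_w_eq_zero ht)
    refine Or.inl ⟨?_, hh⟩
    by_contra h2
    obtain ⟨m, rfl⟩ : ∃ m : ℕ, α = m := ⟨α.toNat, by omega⟩
    refine hh ?_
    have h3 := coeff_eq_zero_of_represents (t := t) (t₀ := t₀) hN hZ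
      (g := fun β => if β = m then h else 0) ?_ m (by omega) (by omega)
    · simpa using h3
    · rw [Finset.sum_eq_single (m : ℤ)]
      · simp only
        rfl
      · intro β _ hβ
        simp only [if_neg hβ, map_zero]
      · intro h3
        exact absurd (Finset.mem_Ico.2 ⟨by omega, by omega⟩) h3
  · have hp (p : Fin 9 → F) (i : Fin 9) (hp : p i ≠ 0) : loopField δ p ≠ 0 := by
      intro h1
      have := congrArg (loopCoeff F) h1
      rw [loopCoeff_loopField, map_zero] at this
      exact hp (congrFun this i)
    have key {Z : Derivation ℂ (PFun F) (PFun F)} (hZ : Represents δ N (V δ t t₀ N α h) Z)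
        (hZ' : Z ≠ 0) : IsLiePointSymmetry δ N (V δ t t₀ N α h) ∧ V δ t t₀ N α h w ≠ 0 :=
      ⟨⟨isKPSymmetry_V δ t t₀ N hN α h, Z, hZ⟩, fun hw => hZ' (hZ.eq_zero hN hw)⟩
    rintro (⟨rfl | rfl | rfl | rfl, hh⟩ | ⟨rfl, rfl, hh⟩)
    · exact key (represents_virField δ t t₀ hN h) fun h1 =>
        hh ((map_eq_zero_iff _ (virMap_injective (t₀ := t₀) (N := N) ht)).1 h1)
    · exact key (represents_curField_two δ t t₀ hN h) (hp _ 2 hh)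
    · exact key (represents_curField_one δ t t₀ hN h) (hp _ 0 hh)
    · refine key (represents_curField_neg_one δ t t₀ hN h) (hp _ 3 fun h1 => hh ?_)
      refine smul_eq_zero_of_ne (c := -2) (by norm_num) (Eq.trans ?_ h1)
      simp [curParam]
    · refine key (represents_curField_zero δ t t₀ hN h) (hp _ 4 fun h1 => hh ?_)
      refine smul_eq_zero_of_ne (c := -4 * ind 3 3 * ((3 : ℕ) : ℂ)⁻¹) ?_ (Eq.trans ?_ h1)
      · rw [ind_self]
        norm_num
      · simp [curParam]

/-- The loop matrices of the flows have the form of a finite sum `∑ₖ h⁽ᵏ⁾ M_{α,k}` with constant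
matrices `M_{α,k}`. -/
theorem loopHom_eq_sum (hN : 3 ≤ N) {α : ℤ} {h : F} {Z : curAlgebra δ t₀ N}
    (hα : IsCurrentIndex N α) (hZ : Represents δ N (V δ t t₀ N α h) Z) :
    loopHom Z = ∑ k ∈ Finset.range 4,
      (δ : F → F)^[k] h • (loopMatrix ℂ (curCoeff t₀ N α k)).map (algebraMap ℂ F) := by
  have h0 (k : ℕ) : (δ : F → F)^[k] 0 = 0 := Function.iterate_fixed (map_zero _) k
  have key {a b c e : F} (h1 : Represents δ N (V δ t t₀ N α h) (curField δ t₀ N a b c e))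
      (h2 : curParam δ t₀ N a b c e = ∑ k ∈ Finset.range 4,
        (δ : F → F)^[k] h • (fun i => algebraMap ℂ F (curCoeff t₀ N α k i))) :
      loopHom Z = ∑ k ∈ Finset.range 4,
        (δ : F → F)^[k] h • (loopMatrix ℂ (curCoeff t₀ N α k)).map (algebraMap ℂ F) := by
    rw [loopHom_apply Z (hZ.unique hN h1 rfl), h2, map_sum]
    exact Finset.sum_congr rfl fun k _ => by rw [map_smul, loopMatrix_map]
  rcases hα with rfl | rfl | rfl | ⟨rfl, -⟩
  · refine key (represents_curField_two δ t t₀ hN h) ?_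
    simp only [curParam_eq_sum, h0, zero_smul, add_zero]
  · refine key (represents_curField_one δ t t₀ hN h) ?_
    simp only [curParam_eq_sum, h0, zero_smul, add_zero, zero_add]
  · refine key (represents_curField_neg_one δ t t₀ hN h) ?_
    simp only [curParam_eq_sum, h0, zero_smul, zero_add]
  · refine key (represents_curField_zero δ t t₀ hN h) ?_
    simp only [curParam_eq_sum, h0, zero_smul, add_zero, zero_add]

/-- The generators `L_n = T(-t_N^{n+1})` satisfy the relations of the Virasoro algebra. -/
theorem virMap_zpow_lie {u : Fˣ} (hu : δ (u : F) = 1) (m n : ℤ) :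
    ⁅virMap δ t₀ N (-((u ^ (m + 1) : Fˣ) : F)), virMap δ t₀ N (-((u ^ (n + 1) : Fˣ) : F))⁆ =
      (m - n) • virMap δ t₀ N (-((u ^ (m + n + 1) : Fˣ) : F)) := by
  refine (virField_lie δ t₀ N _ _).trans ?_
  change virMap δ t₀ N _ = _
  rw [← map_zsmul]
  congr 1
  have e1 : ((u ^ (m + 1) : Fˣ) : F) * ((u ^ n : Fˣ) : F) = ((u ^ (m + n + 1) : Fˣ) : F) := by
    rw [← Units.val_mul, ← zpow_add, add_right_comm]
  have e2 : ((u ^ m : Fˣ) : F) * ((u ^ (n + 1) : Fˣ) : F) = ((u ^ (m + n + 1) : Fˣ) : F) := by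
    rw [← Units.val_mul, ← zpow_add, add_assoc]
  rw [map_neg, map_neg, derivation_zpow hu, derivation_zpow hu, add_sub_cancel_right,
    add_sub_cancel_right, neg_mul_neg, neg_mul_neg, mul_smul_comm, smul_mul_assoc, e1, e2,
    ← Int.cast_smul_eq_zsmul ℂ]
  push_cast
  algebra with ℂ

end Parts

end

end KPSym

theorem theorem4 {F : Type*} [CommRing F] [Algebra ℂ F] (δ : Derivation ℂ F F) (t : F)
    (ht : δ t = 1) (t₀ : ℂ) (N : ℕ) (hN : 3 ≤ N) :
    -- the flows are those of the residue formula
    (∀ α : ℤ, α ≤ N → ∀ h : F,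
      KPSym.V δ t t₀ N α h KPSym.w = KPSym.residueForm δ t₀ N α h) ∧
    -- the nonvanishing Lie point symmetries
    (∀ α : ℤ, α ≤ N → ∀ h : F,
      (KPSym.IsLiePointSymmetry δ N (KPSym.V δ t t₀ N α h) ∧
          KPSym.V δ t t₀ N α h KPSym.w ≠ 0) ↔
        ((α = N ∨ α = 2 ∨ α = 1 ∨ α = -1) ∧ h ≠ 0) ∨ (α = 0 ∧ N = 3 ∧ δ h ≠ 0)) ∧
    -- (a) the centerless Virasoro algebra of reparametrizations of `t_N`
    (∃ T : F →ₗ[ℂ] Derivation ℂ (KPSym.PFun F) (KPSym.PFun F),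
      Function.Injective T ∧
      (∀ f : F, KPSym.Represents δ N (KPSym.V δ t t₀ N N f) (T f)) ∧
      (∀ f g : F, T f (MvPolynomial.C g) = MvPolynomial.C (f * δ g)) ∧
      (∀ f g : F, ⁅T f, T g⁆ = T (f * δ g - δ f * g)) ∧
      (∀ u : Fˣ, (u : F) = t → ∀ m n : ℤ,
        ⁅T (-((u ^ (m + 1) : Fˣ) : F)), T (-((u ^ (n + 1) : Fˣ) : F))⁆ =
          (m - n) • T (-((u ^ (m + n + 1) : Fˣ) : F))) ∧
      LinearMap.range T = (KPSym.virasoroPart δ t t₀ N).toSubmodule) ∧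
    -- (b) the nilpotent current algebra, inside the loops in strictly upper triangular matrices
    LieRing.IsNilpotent (KPSym.currentPart δ t t₀ N) ∧
    (∃ (n d : ℕ) (ι : KPSym.currentPart δ t t₀ N →ₗ[ℂ] Matrix (Fin n) (Fin n) F)
        (M : ℤ → ℕ → Matrix (Fin n) (Fin n) ℂ),
      Function.Injective ι ∧
      (∀ Y Z, ι ⁅Y, Z⁆ = ι Y * ι Z - ι Z * ι Y) ∧
      (∀ Z i j, j ≤ i → ι Z i j = 0) ∧
      (∀ (α : ℤ) (h : F) (Z : KPSym.currentPart δ t t₀ N), KPSym.IsCurrentIndex N α →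
        KPSym.Represents δ N (KPSym.V δ t t₀ N α h) (Z : Derivation ℂ _ _) →
        ι Z = ∑ k ∈ Finset.range d, (δ : F → F)^[k] h • (M α k).map (algebraMap ℂ F))) ∧
    -- (c) the algebra of point symmetries is the semidirect sum of the two
    (∀ Z, Z ∈ KPSym.pointAlgebra δ t t₀ N ↔
      ∃ U ∈ Submodule.span ℂ {U | ∃ α : ℤ, α ≤ N ∧ ∃ h : F, U = KPSym.V δ t t₀ N α h},
        KPSym.IsKPSymmetry δ N U ∧ KPSym.Represents δ N U Z) ∧
    (∀ Z ∈ KPSym.pointAlgebra δ t t₀ N, ∀ Y ∈ KPSym.currentPart δ t t₀ N,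
      ⁅Z, Y⁆ ∈ KPSym.currentPart δ t t₀ N) ∧
    (KPSym.virasoroPart δ t t₀ N).toSubmodule ⊔ (KPSym.currentPart δ t t₀ N).toSubmodule =
      (KPSym.pointAlgebra δ t t₀ N).toSubmodule ∧
    Disjoint (KPSym.virasoroPart δ t t₀ N).toSubmodule
      (KPSym.currentPart δ t t₀ N).toSubmodule := by
  have hcur := KPSym.currentPart_eq (δ := δ) (t := t) (t₀ := t₀) hN
  refine ⟨fun α _ h => KPSym.V_w_eq_residueForm δ t t₀ N hN α h,
    fun α hα h => KPSym.isLiePointSymmetry_V_iff ht hN hα h,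
    ⟨KPSym.virMap δ t₀ N, KPSym.virMap_injective ht, KPSym.represents_virField δ t t₀ hN,
      KPSym.virField_C δ t₀ N, KPSym.virField_lie δ t₀ N,
      fun u hu => KPSym.virMap_zpow_lie (by rw [hu, ht]), ?_⟩, ?_, ?_, ?_, ?_, ?_, ?_⟩
  · rw [KPSym.virasoroPart_eq hN]
    rfl
  · rw [hcur]
    exact KPSym.isNilpotent_curAlgebra
  · rw [hcur]
    exact ⟨7, 4, KPSym.loopHom, fun α k => KPSym.loopMatrix ℂ (KPSym.curCoeff t₀ N α k),
      KPSym.loopHom_injective, KPSym.loopHom_lie, KPSym.loopHom_eq_zero,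
      fun α h Z hα hZ => KPSym.loopHom_eq_sum hN hα hZ⟩
  · intro Z
    rw [KPSym.pointAlgebra_eq hN]
    exact KPSym.mem_symAlgebra_iff hN Z
  · rw [KPSym.pointAlgebra_eq hN, hcur]
    exact fun Z hZ Y hY => KPSym.lie_mem_curAlgebra hZ hY
  · rw [KPSym.pointAlgebra_eq hN, KPSym.virasoroPart_eq hN, hcur]
    rfl
  · rw [KPSym.virasoroPart_eq hN, hcur]
    exact KPSym.disjoint_parts ht
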